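/- Let $K$ be an algebraically closed field and $A$ a finite-dimensional basic $K$-algebra with a complete set of primitive orthogonal idempotents $e_i$ $(i\in Q_0)$, where the finite set $Q_0$ carries a partial order $\le$. Modules are left modules; $P(i)=Ae_i$, $I(i)=\operatorname{Hom}_K(e_iA,K)$, $S(i)=\operatorname{top}P(i)$ and $[M:S(i)]=\dim_K e_iM$. The standard module $\Delta(i)$ is the largest factor module of $P(i)$, and the costandard module $\nabla(i)$ the largest submodule of $I(i)$, all of whose composition factors are of the form $S(j)$ with $j\le i$. For a module $M$ with a filtration whose subquotients are standard (resp. costandard) modules, $(M:\Delta(j))$ (resp. $(M:\nabla(j))$) is the number of subquotients isomorphic to $\Delta(j)$ (resp. $\nabla(j)$); $\mathfrak F(\Delta)$ and $\mathfrak F(\nabla)$ are the classes of finite-dimensional modules with such filtrations. The algebra $(A,\le)$ is quasi-hereditary if for all $i$: $[\Delta(i):S(i)]=1$, $P(i)\in\mathfrak F(\Delta)$, $(P(i):\Delta(j))=0$ for all $j\not\ge i$, and $(P(i):\Delta(i))=1$. It is 1-quasi-hereditary if moreover: (1) $(Q_0,\le)$ has a smallest element, written $1$, and a largest element, written $n$;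 (2) $[\Delta(i):S(j)]=(P(j):\Delta(i))=1$ whenever $j\le i$; (3) $\operatorname{soc}P(j)\cong\operatorname{top}I(j)\cong S(1)$ for all $j$; (4) for all $i$ there are an injective map $\Delta(i)\to\Delta(n)$ and a surjective map $\nabla(n)\to\nabla(i)$. Let $(A,\le)$ be 1-quasi-hereditary and $i\in Q_0$. Let $T(i)$ be the indecomposable direct summand at $i$ of the characteristic tilting module, i.e. the (up to isomorphism unique) indecomposable module in $\mathfrak F(\Delta)\cap\mathfrak F(\nabla)$ with $(T(i):\Delta(j))=(T(i):\nabla(j))=[T(i):S(j)]=0$ for $j\not\le i$ and $(T(i):\Delta(i))=(T(i):\nabla(i))=[T(i):S(i)]=1$. Let $A(i)=A/A\bigl(\sum_{j\not\le i}e_j\bigr)A$, with the images of the idempotents $e_j$ $(j\le i)$ and the order induced on $\{j\in Q_0: j\le i\}$. Recall that for each $l\in Q_0$ the module $P(1)$ has exactly one submodule isomorphic to $P(l)$, which is again written $P(l)$, and, dually, all surjections $I(1)\twoheadrightarrow I(l)$ (they exist) have the same kernel. Then the following statements are equivalent: (i) $A(i)$ is 1-quasi-hereditary; (ii) $T(i)\cong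 P(1)\big/\sum_{l\not\le i}P(l)$; (ii') $T(i)\cong\bigcap_{l\not\le i}\operatorname{Ker}\bigl(I(1)\twoheadrightarrow I(l)\bigr)$; (iii) $\operatorname{soc}T(i)$ is simple; (iii') $\operatorname{top}T(i)$ is simple. -/

import Mathlib

/-! Basic finite-dimensional algebras with a partially ordered set of vertices, standard and
costandard modules, good filtrations, 1-quasi-hereditary algebras, and the indecomposable
summands of the characteristic tilting module. All modules are left modules. -/

namespace OneQH

universe u v w x y

section Modules

variable (A : Type v) [Ring A] (M : Type x) [AddCommGroup M] [Module A M]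

/-- The radical of `M`, the intersection of its maximal submodules. -/
abbrev rad : Submodule A M := Module.jacobson A M

/-- The top `M / rad M`. -/
abbrev Top : Type x := M ⧸ rad A M

/-- The socle, the sum of all simple submodules. -/
def soc : Submodule A M := sSup {N : Submodule A M | IsSimpleModule A N}

/-- `M` is nonzero and has no decomposition into a direct sum of two nonzero submodules. -/
def IsIndecomposable : Prop :=
  Nontrivial M ∧ ∀ N N' : Submodule A M, IsCompl N N' → N = ⊥ ∨ N' = ⊥

end Modules

section RegularDual

variable (K : Type u) [Field K] (A : Type v) [Ring A] [Algebra K A]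

/-- The `K`-dual `D(A)` of the right regular module, a left `A`-module through
`(a • φ) x = φ (x * a)`. -/
def RegularDual : Type (max u v) := A →ₗ[K] K

noncomputable instance : AddCommGroup (RegularDual K A) :=
  inferInstanceAs (AddCommGroup (A →ₗ[K] K))

noncomputable instance : Module K (RegularDual K A) :=
  inferInstanceAs (Module K (A →ₗ[K] K))

instance : FunLike (RegularDual K A) A K :=
  inferInstanceAs (FunLike (A →ₗ[K] K) A K)

noncomputable instance : Module A (RegularDual K A) where
  smul a φ := LinearMap.comp (show A →ₗ[K] K from φ) (LinearMap.mulRight K a)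
  one_smul φ := LinearMap.ext fun z => congrArg (show A →ₗ[K] K from φ) (mul_one z)
  mul_smul a b φ :=
    LinearMap.ext fun z => congrArg (show A →ₗ[K] K from φ) (mul_assoc z a b).symm
  smul_zero _ := LinearMap.ext fun _ => rfl
  smul_add _ _ _ := LinearMap.ext fun _ => rfl
  add_smul a b φ := LinearMap.ext fun z =>
    (congrArg (show A →ₗ[K] K from φ) (mul_add z a b)).trans
      (map_add (show A →ₗ[K] K from φ) (z * a) (z * b))
  zero_smul φ := LinearMap.ext fun z =>
    (congrArg (show A →ₗ[K] K from φ) (mul_zero z)).trans (map_zero (show A →ₗ[K] K from φ))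

theorem RegularDual.smul_apply (a : A) (φ : RegularDual K A) (z : A) :
    (a • φ) z = φ (z * a) := rfl

theorem RegularDual.add_apply (φ ψ : RegularDual K A) (z : A) : (φ + ψ) z = φ z + ψ z := rfl

instance : IsScalarTower K A (RegularDual K A) where
  smul_assoc c a φ := LinearMap.ext fun z =>
    (congrArg (show A →ₗ[K] K from φ) (mul_smul_comm c z a)).trans
      (map_smul (show A →ₗ[K] K from φ) c (z * a))

end RegularDual

section Vertices

variable (K : Type u) [Field K] {A : Type v} [Ring A] [Algebra K A] {Q₀ : Type w} (e : Q₀ → A)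

/-- The indecomposable projective module `P(i) = A e_i`. -/
abbrev P (i : Q₀) : Submodule A A := Submodule.span A {e i}

/-- The indecomposable injective module `I(i) = D(e_i A)`, realised inside `D(A)` as the
functionals that vanish on the complement `(1 - e_i) A` of `e_i A`. -/
def I (i : Q₀) : Submodule A (RegularDual K A) where
  carrier := {φ | ∀ z, φ (e i * z) = φ z}
  add_mem' := fun {φ ψ} hφ hψ z => by
    rw [RegularDual.add_apply, RegularDual.add_apply, hφ z, hψ z]
  zero_mem' := fun _ => rfl
  smul_mem' := fun a φ hφ z => by
    rw [RegularDual.smul_apply, RegularDual.smul_apply, mul_assoc, hφ (z * a)]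

/-- The simple module `S(i)`, the top of `P(i)`. -/
abbrev S (i : Q₀) : Type v := Top A (P e i)

/-- The multiplicity `[M : S(i)] = dim_K e_i M`. -/
noncomputable def mult (M : Type x) [AddCommGroup M] [Module K M] [Module A M]
    [IsScalarTower K A M] (i : Q₀) : ℕ :=
  Module.finrank K (LinearMap.range (Algebra.lsmul K K M (e i)))

/-- `e` is a complete family of primitive orthogonal idempotents of `A` and `A` is basic, i.e.
the modules `A e_i` are pairwise non-isomorphic. -/
structure IsBasic [Fintype Q₀] : Prop where
  complete : CompleteOrthogonalIdempotents e
  ne_zero : ∀ i, e i ≠ 0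
  primitive : ∀ i, ∀ f g : A, IsIdempotentElem f → IsIdempotentElem g → f * g = 0 → g * f = 0 →
    e i = f + g → f = 0 ∨ g = 0
  basic : ∀ i j, Nonempty (P e i ≃ₗ[A] P e j) → i = j

/-- A filtration `0 = F 0 ≤ F 1 ≤ ⋯ ≤ F r = M` whose `k`-th subquotient is isomorphic to
`X (label k)`. -/
structure GoodFiltration {A : Type v} [Ring A] {Q₀ : Type w} (X : Q₀ → Type x)
    [∀ i, AddCommGroup (X i)] [∀ i, Module A (X i)]
    (M : Type y) [AddCommGroup M] [Module A M] where
  length : ℕ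
  sub : Fin (length + 1) → Submodule A M
  label : Fin length → Q₀
  mono : Monotone sub
  bot : sub 0 = ⊥
  top : sub (Fin.last length) = ⊤
  subquotient : ∀ k : Fin length,
    Nonempty ((sub k.succ ⧸ (sub k.castSucc).submoduleOf (sub k.succ)) ≃ₗ[A] X (label k))

/-- The number of subquotients of the filtration labelled by `i`. -/
noncomputable def GoodFiltration.count {A : Type v} [Ring A] {Q₀ : Type w} {X : Q₀ → Type x}
    [∀ i, AddCommGroup (X i)] [∀ i, Module A (X i)]
    {M : Type y} [AddCommGroup M] [Module A M] (F : GoodFiltration (A := A) X M) (i : Q₀) : ℕ :=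
  Nat.card {k : Fin F.length // F.label k = i}

variable [PartialOrder Q₀]

/-- The smallest submodule `U` of `P(i)` with `[P(i)/U : S(j)] = 0` for all `j ≰ i`. -/
noncomputable def standardKernel (i : Q₀) : Submodule A (P e i) :=
  sInf {U : Submodule A (P e i) | ∀ j, ¬ j ≤ i → mult K e (P e i ⧸ U) j = 0}

/-- The standard module `Δ(i)`: the largest factor module of `P(i)` all of whose composition
factors are of the form `S(j)` with `j ≤ i`. -/
abbrev Standard (i : Q₀) : Type v := P e i ⧸ standardKernel K e i

/-- The costandard module `∇(i)`: the largest submodule of `I(i)` all of whose composition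
factors are of the form `S(j)` with `j ≤ i`. -/
noncomputable def costandard (i : Q₀) : Submodule A (I K e i) :=
  sSup {U : Submodule A (I K e i) | ∀ j, ¬ j ≤ i → mult K e U j = 0}

abbrev Costandard (i : Q₀) : Type (max u v) := costandard K e i

/-- Filtrations with standard subquotients. -/
abbrev DeltaFiltration (M : Type y) [AddCommGroup M] [Module A M] :=
  GoodFiltration (A := A) (Standard K e) M

/-- Filtrations with costandard subquotients. -/
abbrev NablaFiltration (M : Type y) [AddCommGroup M] [Module A M] :=
  GoodFiltration (A := A) (Costandard K e) M

/-- `(A, ≤)` is a (basic) quasi-hereditary algebra. -/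
structure IsQuasiHereditary [Fintype Q₀] : Prop extends IsBasic e where
  standard_self : ∀ i, mult K e (Standard K e i) i = 1
  projective : ∀ i, ∃ F : DeltaFiltration K e (P e i),
    (∀ j, ¬ i ≤ j → F.count j = 0) ∧ F.count i = 1

/-- `(A, ≤)` is a (basic) 1-quasi-hereditary algebra. The multiplicity `(P(j) : Δ(i))` does not
depend on the `Δ`-good filtration used to count it. -/
structure IsOneQuasiHereditary [Fintype Q₀] : Prop extends IsQuasiHereditary K e where
  exists_smallest : ∃ o : Q₀, IsBot o
  exists_largest : ∃ t : Q₀, IsTop t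
  mult_standard : ∀ i j, j ≤ i → mult K e (Standard K e i) j = 1
  mult_projective : ∀ i j, j ≤ i → ∃ F : DeltaFiltration K e (P e j), F.count i = 1
  soc_projective : ∀ o : Q₀, IsBot o → ∀ j, Nonempty (soc A (P e j) ≃ₗ[A] S e o)
  top_injective : ∀ o : Q₀, IsBot o → ∀ j, Nonempty (Top A (I K e j) ≃ₗ[A] S e o)
  standard_embeds : ∀ t : Q₀, IsTop t → ∀ i,
    ∃ f : Standard K e i →ₗ[A] Standard K e t, Function.Injective f
  costandard_covers : ∀ t : Q₀, IsTop t → ∀ i,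
    ∃ f : Costandard K e t →ₗ[A] Costandard K e i, Function.Surjective f

/-- `T` is (isomorphic to) `T(i)`, the indecomposable direct summand at the vertex `i` of the
characteristic tilting module. -/
structure IsTiltingSummand (i : Q₀) (T : Type y) [AddCommGroup T] [Module K T] [Module A T]
    [IsScalarTower K A T] : Prop where
  finite : Module.Finite K T
  indecomposable : IsIndecomposable A T
  delta : ∃ F : DeltaFiltration K e T, (∀ j, ¬ j ≤ i → F.count j = 0) ∧ F.count i = 1
  nabla : ∃ F : NablaFiltration K e T, (∀ j, ¬ j ≤ i → F.count j = 0) ∧ F.count i = 1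
  mult_eq_zero : ∀ j, ¬ j ≤ i → mult K e T j = 0
  mult_self : mult K e T i = 1

/-- The two-sided ideal `J(i) = A (∑_{j ≰ i} e_j) A`. -/
noncomputable def J [Fintype Q₀] (i : Q₀) : Ideal A :=
  open Classical in (TwoSidedIdeal.span {∑ j with ¬ j ≤ i, e j}).asIdeal

instance [Fintype Q₀] (i : Q₀) : (J e i).IsTwoSided :=
  inferInstanceAs (TwoSidedIdeal.asIdeal _).IsTwoSided

/-- The factor algebra `A(i) = A / J(i)`. -/
abbrev FactorAlgebra [Fintype Q₀] (i : Q₀) : Type v := A ⧸ J e i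

noncomputable instance [Fintype Q₀] (i : Q₀) : Fintype (Set.Iic i) := Fintype.ofFinite _

/-- The images in `A(i)` of the idempotents `e_j` with `j ≤ i`. -/
noncomputable def factorVertex [Fintype Q₀] (i : Q₀) (j : Set.Iic i) : FactorAlgebra e i :=
  Ideal.Quotient.mk (J e i) (e j)

/-- The submodule `∑_{l ≰ i} P(l)` of `P(o)`, where `P(l)` stands for the submodule of `P(o)`
isomorphic to `P(l)` (there is exactly one if `o` is the smallest vertex of a 1-quasi-hereditary
algebra). -/
def sumP (o i : Q₀) : Submodule A (P e o) :=
  sSup {N : Submodule A (P e o) | ∃ l, ¬ l ≤ i ∧ Nonempty (N ≃ₗ[A] P e l)}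

/-- The submodule `⋂_{l ≰ i} Ker (I(o) ↠ I(l))` of `I(o)` (the kernel of a surjection
`I(o) → I(l)` does not depend on the surjection if `o` is the smallest vertex of a
1-quasi-hereditary algebra). -/
noncomputable def interKer (o i : Q₀) : Submodule A (I K e o) :=
  sInf {N : Submodule A (I K e o) | ∃ l, ¬ l ≤ i ∧
    ∃ f : I K e o →ₗ[A] I K e l, Function.Surjective f ∧ N = LinearMap.ker f}

end Vertices

end OneQH

/-! Let `o` be the smallest vertex, and say that a module has weight `j` where `e j` acts
nontrivially. Everything is compared with one numerical condition, `mult K e T o ≤ #{m | m ≤ i}`;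
its right side is written `upperCount (Set.Iic i) o o`.

Dimension vectors. All `Δ(m)` and `∇(m)` have dimension one at each weight `j ≤ m` and zero
elsewhere. Hence the part of `P(k)`, or of `I(k)`, supported on a lower set `Λ` has at weight `j` as
many dimensions as `j` and `k` have common upper bounds in `Λ` (`mult_quotient_trace`,
`mult_cotrace_I`). The sum of the `P(l)`, `l ≰ i`, is the submodule generated by the weights `l ≰ i`
(`sumP_eq`), and dually for the intersection of kernels (`interKer_eq`). So both candidates for
`T(i)` have dimension `#{m | m ≤ i}` at `o`.

The summand `T`. A lift to `T` of the generator of the subquotient `Δ(i)` has a nonzero multiple of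
weight `o`, so `Δ(i)` embeds in `T`. Together with `Δ(i)`, all `Δ(j)` with `j ≤ i` embed, and each
forces a subquotient `∇(j)` in any `∇`-filtration of `T` (`mem_of_path_standard`). Dually each
`Δ(j)` occurs (`mem_of_path_costandard`). Each subquotient contributes one dimension at `o`, so the
numerical condition says that every `Δ(j)` and every `∇(j)`, `j ≤ i`, occurs exactly once. The socle
of `T` involves only `S(o)`, each copy of which needs a subquotient `∇(o)`; one such subquotient
gives a simple socle, and dually one `Δ(o)` gives a simple top (`IsTiltingSummand.of_mult_le`).
Conversely, a simple socle embeds `T` into the intersection of kernels, and a simple top makes it a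
quotient of `P(o) / ∑ P(l)`; either bounds the dimension at `o`, and by dimensions the maps are then
isomorphisms. This settles (ii), (ii'), (iii), (iii').

The factor algebra. `P(o) / ∑ P(l)` is the projective `A(i)`-module at `o` and the intersection of
kernels corresponds to the injective one. If `A(i)` is 1-quasi-hereditary, the former has simple
socle, hence equals the latter, and it splits off `T` because the composite through `T` is nonzero
on the one-dimensional weight `i` (`nonempty_equiv_of_isCogenerated`). Conversely, of the axioms for
`A(i)` only those on socles of projectives and tops of injectives are not inherited at once. They
follow from the case of the vertex `o`, since all projectives embed into the one at `o` and all
injectives are quotients of the one at `o`, again by counting dimensions.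

Dual statements are proved directly, with `trace` and `cotrace`, rather than by passing to the
opposite algebra. -/

namespace OneQH

universe u v w x y z

/-! ### Weight spaces and additivity of multiplicities -/

section Finite

variable {K : Type u} [Field K] {A : Type v} [Ring A] [Algebra K A]
  {M : Type x} [AddCommGroup M] [Module K M] [Module A M] [IsScalarTower K A M]

theorem finite_submodule [Module.Finite K M] (N : Submodule A M) : Module.Finite K N :=
  Module.Finite.of_injective (N.subtype.restrictScalars K) N.injective_subtype

theorem finite_quotient [Module.Finite K M] (N : Submodule A M) : Module.Finite K (M ⧸ N) :=
  Module.Finite.of_surjective (N.mkQ.restrictScalars K) N.mkQ_surjective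

end Finite

section Mult

variable {K : Type u} [Field K] {A : Type v} [Ring A] [Algebra K A] {Q₀ : Type w} {e : Q₀ → A}
  {M : Type x} [AddCommGroup M] [Module K M] [Module A M] [IsScalarTower K A M]
  {N : Type y} [AddCommGroup N] [Module K N] [Module A N] [IsScalarTower K A N]
  {L : Type z} [AddCommGroup L] [Module K L] [Module A L] [IsScalarTower K A L]

theorem mem_weight {j : Q₀} (he : IsIdempotentElem (e j)) {m : M} :
    m ∈ LinearMap.range (Algebra.lsmul K K M (e j)) ↔ e j • m = m := by
  constructor
  · rintro ⟨n, rfl⟩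
    simp only [Algebra.lsmul_coe]
    rw [smul_smul, he.eq]
  · intro h
    exact ⟨m, by simpa using h⟩

theorem mult_eq_zero_iff [Module.Finite K M] {j : Q₀} :
    mult K e M j = 0 ↔ ∀ m : M, e j • m = 0 := by
  unfold mult
  rw [Submodule.finrank_eq_zero, LinearMap.range_eq_bot]
  constructor
  · intro h m
    simpa using LinearMap.congr_fun h m
  · intro h
    ext m
    simpa using h m

theorem mult_le_of_injective [Module.Finite K N] (f : M →ₗ[A] N) (hf : Function.Injective f)
    (j : Q₀) : mult K e M j ≤ mult K e N j := by
  have h : ∀ m ∈ LinearMap.range (Algebra.lsmul K K M (e j)),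
      f.restrictScalars K m ∈ LinearMap.range (Algebra.lsmul K K N (e j)) := by
    rintro _ ⟨m, rfl⟩
    exact ⟨f m, by simp⟩
  exact LinearMap.finrank_le_finrank_of_injective (f := (f.restrictScalars K).restrict h)
    (fun a b hab => Subtype.ext (hf (congrArg Subtype.val hab)))

theorem mult_congr (f : M ≃ₗ[A] N) (j : Q₀) : mult K e M j = mult K e N j := by
  have h : (LinearMap.range (Algebra.lsmul K K M (e j))).map
      ((f.restrictScalars K : M ≃ₗ[K] N) : M →ₗ[K] N) =
      LinearMap.range (Algebra.lsmul K K N (e j)) := by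
    ext n
    constructor
    · rintro ⟨_, ⟨m, rfl⟩, rfl⟩
      exact ⟨f m, by simp⟩
    · rintro ⟨n, rfl⟩
      exact ⟨e j • f.symm n, ⟨f.symm n, by simp⟩, by simp⟩
  unfold mult
  rw [← h]
  exact (LinearEquiv.finrank_map_eq (f.restrictScalars K : M ≃ₗ[K] N) _).symm

/-- Passing to `e j • _` is exact for an idempotent `e j`: an `f`-preimage of an element of weight
`j` has weight `j` by injectivity. The formula is then rank-nullity for `g` on the weight space of
`N`. -/
theorem mult_exact [Module.Finite K N] {j : Q₀} (he : IsIdempotentElem (e j))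
    (f : M →ₗ[A] N) (hf : Function.Injective f) (g : N →ₗ[A] L) (hg : Function.Surjective g)
    (h : ∀ n, g n = 0 ↔ ∃ m, f m = n) :
    mult K e N j = mult K e M j + mult K e L j := by
  set R := LinearMap.range (Algebra.lsmul K K N (e j)) with hR
  have h1 : LinearMap.range ((g.restrictScalars K).domRestrict R) =
      LinearMap.range (Algebra.lsmul K K L (e j)) := by
    ext l
    constructor
    · rintro ⟨⟨_, n, rfl⟩, rfl⟩
      exact ⟨g n, by simp⟩
    · rintro ⟨l, rfl⟩
      obtain ⟨n, rfl⟩ := hg l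
      exact ⟨⟨e j • n, n, by simp⟩, by simp⟩
  have h2 : (LinearMap.ker ((g.restrictScalars K).domRestrict R)).map R.subtype =
      (LinearMap.range (Algebra.lsmul K K M (e j))).map (f.restrictScalars K) := by
    ext n
    simp only [Submodule.mem_map, LinearMap.mem_ker, mem_weight he]
    constructor
    · rintro ⟨⟨n, hn⟩, hn', rfl⟩
      obtain ⟨m, rfl⟩ := (h n).1 hn'
      refine ⟨m, hf ?_, rfl⟩
      rw [map_smul]
      exact (mem_weight he).1 hn
    · rintro ⟨m, hm, rfl⟩
      refine ⟨⟨f m, (mem_weight he).2 (by rw [← map_smul, hm])⟩, (h _).2 ⟨m, rfl⟩, rfl⟩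
  have h3 := LinearMap.finrank_range_add_finrank_ker ((g.restrictScalars K).domRestrict R)
  rw [h1, (Submodule.equivMapOfInjective _ R.injective_subtype _).finrank_eq, h2,
    (Submodule.equivMapOfInjective (f.restrictScalars K) hf _).finrank_eq.symm] at h3
  unfold mult
  rw [← hR]
  omega

theorem mult_eq_add_quotient [Module.Finite K M] {j : Q₀} (he : IsIdempotentElem (e j))
    (U : Submodule A M) : mult K e M j = mult K e U j + mult K e (M ⧸ U) j :=
  mult_exact he U.subtype U.injective_subtype U.mkQ U.mkQ_surjective
    (fun n => by simp)

theorem mult_le_of_surjective [Module.Finite K N] {j : Q₀} (he : IsIdempotentElem (e j))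
    (g : N →ₗ[A] L) (hg : Function.Surjective g) : mult K e L j ≤ mult K e N j := by
  rw [mult_exact he (LinearMap.ker g).subtype (Submodule.injective_subtype _) g hg
    (fun n => by simp)]
  exact Nat.le_add_left _ _

/-- An injective map is bijective on the weight spaces of equal dimension. -/
theorem exists_weight_preimage [Module.Finite K N] {j : Q₀} (he : IsIdempotentElem (e j))
    (f : M →ₗ[A] N) (hf : Function.Injective f) (h : mult K e N j ≤ mult K e M j)
    {n : N} (hn : e j • n = n) : ∃ m, e j • m = m ∧ f m = n := by
  have : Module.Finite K (N ⧸ LinearMap.range f) := finite_quotient _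
  have h1 := mult_exact (K := K) he f hf (LinearMap.range f).mkQ (Submodule.mkQ_surjective _)
    (fun n => by simp)
  have h2 : mult K e (N ⧸ LinearMap.range f) j = 0 := by omega
  have h3 := mult_eq_zero_iff.1 h2 ((LinearMap.range f).mkQ n)
  rw [← map_smul, hn] at h3
  obtain ⟨m, rfl⟩ : n ∈ LinearMap.range f := by simpa using h3
  exact ⟨e j • m, by rw [smul_smul, he.eq], by rw [map_smul, hn]⟩

/-- A surjective map is injective on the weight spaces of equal dimension. -/
theorem eq_zero_of_weight [Module.Finite K N] {j : Q₀} (he : IsIdempotentElem (e j))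
    (g : N →ₗ[A] L) (hg : Function.Surjective g) (h : mult K e N j ≤ mult K e L j)
    {n : N} (hn : e j • n = n) (h0 : g n = 0) : n = 0 := by
  have h1 := mult_exact (K := K) he (LinearMap.ker g).subtype (Submodule.injective_subtype _) g hg
    (fun n => by simp)
  have : Module.Finite K (LinearMap.ker g) := finite_submodule _
  have h2 : mult K e (LinearMap.ker g) j = 0 := by omega
  have h3 := mult_eq_zero_iff.1 h2 ⟨n, h0⟩
  rw [← hn]
  exact congrArg Subtype.val h3

/-- Weight spaces of dimension at most one are spanned by any nonzero element. -/
theorem exists_smul_eq_of_mult_le_one [Module.Finite K M] {j : Q₀}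
    (he : IsIdempotentElem (e j)) (h : mult K e M j ≤ 1) {m n : M} (hm : e j • m = m)
    (hm0 : m ≠ 0) (hn : e j • n = n) : ∃ c : K, c • m = n := by
  obtain ⟨v, hv⟩ := finrank_le_one_iff.1 h
  obtain ⟨c, hc⟩ := hv ⟨m, (mem_weight he).2 hm⟩
  obtain ⟨d, hd⟩ := hv ⟨n, (mem_weight he).2 hn⟩
  have hc' : c • (v : M) = m := congrArg Subtype.val hc
  have hd' : d • (v : M) = n := congrArg Subtype.val hd
  have hc0 : c ≠ 0 := by
    rintro rfl
    exact hm0 (by rw [← hc', zero_smul])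
  exact ⟨d * c⁻¹, by rw [← hc', smul_smul, mul_assoc, inv_mul_cancel₀ hc0, mul_one, hd']⟩

variable [Fintype Q₀]

theorem sum_smul_eq {A : Type v} [Ring A] {e : Q₀ → A} {M : Type x} [AddCommGroup M] [Module A M]
    (hc : CompleteOrthogonalIdempotents e) (m : M) : ∑ j, e j • m = m := by
  rw [← Finset.sum_smul, hc.complete, one_smul]

theorem eq_zero_of_forall_smul {A : Type v} [Ring A] {e : Q₀ → A} {M : Type x} [AddCommGroup M]
    [Module A M] (hc : CompleteOrthogonalIdempotents e) {m : M} (h : ∀ j, e j • m = 0) :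
    m = 0 := by
  rw [← sum_smul_eq hc m]
  exact Finset.sum_eq_zero fun j _ => h j

/-- A module is the sum of its weight spaces, so maps can be tested weight by weight. This is how
all isomorphisms below are obtained: one-sided injectivity or surjectivity together with equal
dimension vectors. -/
theorem surjective_of_mult_le [Module.Finite K N] (hc : CompleteOrthogonalIdempotents e)
    (f : M →ₗ[A] N) (hf : Function.Injective f) (h : ∀ j, mult K e N j ≤ mult K e M j) :
    Function.Surjective f := by
  intro n
  have h1 : ∀ j, ∃ m, f m = e j • n := fun j => by
    obtain ⟨m, -, hm⟩ := exists_weight_preimage (hc.idem j) f hf (h j) (n := e j • n)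
      (by rw [smul_smul, (hc.idem j).eq])
    exact ⟨m, hm⟩
  choose m hm using h1
  exact ⟨∑ j, m j, by rw [map_sum, Finset.sum_congr rfl fun j _ => hm j, sum_smul_eq hc]⟩

theorem injective_of_mult_le [Module.Finite K N] (hc : CompleteOrthogonalIdempotents e)
    (g : N →ₗ[A] L) (hg : Function.Surjective g) (h : ∀ j, mult K e N j ≤ mult K e L j) :
    Function.Injective g := by
  rw [injective_iff_map_eq_zero]
  intro n hn
  refine eq_zero_of_forall_smul hc fun j => eq_zero_of_weight (hc.idem j) g hg (h j) ?_ ?_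
  · rw [smul_smul, (hc.idem j).eq]
  · rw [map_smul, hn, smul_zero]

theorem eq_of_le_of_mult_le [Module.Finite K M] (hc : CompleteOrthogonalIdempotents e)
    {U V : Submodule A M} (hUV : U ≤ V) (h : ∀ j, mult K e V j ≤ mult K e U j) : U = V := by
  have := finite_submodule (K := K) V
  refine le_antisymm hUV fun v hv => ?_
  obtain ⟨u, hu⟩ := surjective_of_mult_le (K := K) hc (Submodule.inclusion hUV)
    (Submodule.inclusion_injective hUV) h ⟨v, hv⟩
  have : (u : M) = v := congrArg Subtype.val hu
  exact this ▸ u.2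

end Mult

/-! ### Filtrations with prescribed subquotients -/

section Filtered

variable {A : Type v} [Ring A] {Q₀ : Type w}
  {M : Type y} [AddCommGroup M] [Module A M] {M' : Type z} [AddCommGroup M'] [Module A M']

/-- `N ≤ N'` and the subquotient `N' / N` is isomorphic to `X`. -/
def Step (X : Type x) [AddCommGroup X] [Module A X] (N N' : Submodule A M) : Prop :=
  N ≤ N' ∧ ∃ f : N' →ₗ[A] X, Function.Surjective f ∧ ∀ m, f m = 0 ↔ (m : M) ∈ N

/-- `Filtered X N₀ N s`: there is a chain of submodules from `N₀` to `N` whose subquotients are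
the modules `X k`, for `k` in the multiset `s`. -/
inductive Filtered (X : Q₀ → Type x) [∀ k, AddCommGroup (X k)] [∀ k, Module A (X k)]
    (N₀ : Submodule A M) : Submodule A M → Multiset Q₀ → Prop
  | refl : Filtered X N₀ N₀ 0
  | step {N N' : Submodule A M} {s : Multiset Q₀} {k : Q₀} :
      Filtered X N₀ N s → Step (X k) N N' → Filtered X N₀ N' (k ::ₘ s)

variable {X : Q₀ → Type x} [∀ k, AddCommGroup (X k)] [∀ k, Module A (X k)]

theorem Filtered.le {N₀ N : Submodule A M} {s : Multiset Q₀} (h : Filtered X N₀ N s) :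
    N₀ ≤ N := by
  induction h with
  | refl => exact le_rfl
  | step _ hs ih => exact ih.trans hs.1

theorem exists_factor {N : Type*} {L : Type*} {X : Type*} [AddCommGroup N] [Module A N]
    [AddCommGroup L] [Module A L] [AddCommGroup X] [Module A X] (p : N →ₗ[A] L)
    (hp : Function.Surjective p) (f : N →ₗ[A] X) (h : ∀ n, p n = 0 → f n = 0) :
    ∃ g : L →ₗ[A] X, ∀ n, g (p n) = f n := by
  refine ⟨((LinearMap.ker p).liftQ f h).comp (p.quotKerEquivOfSurjective hp).symm.toLinearMap,
    fun n => ?_⟩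
  have : (p.quotKerEquivOfSurjective hp).symm (p n) = Submodule.Quotient.mk n := by
    rw [LinearEquiv.symm_apply_eq]
    rfl
  simp only [LinearMap.comp_apply, LinearEquiv.coe_coe, this]
  rfl

/-- By the modular law `(N ⊔ W) ⊓ N' = N`, so adding `W` does not change the subquotient. The map is
obtained by extending `f` by zero on `W` and descending from `N' × W` to the sum. -/
theorem Step.sup {X : Type x} [AddCommGroup X] [Module A X] {N N' W : Submodule A M}
    (h : Step X N N') (hW : N' ⊓ W ≤ N) : Step X (N ⊔ W) (N' ⊔ W) := by
  obtain ⟨hle, f, hf, hker⟩ := h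
  refine ⟨sup_le_sup_right hle W, ?_⟩
  let p : (N' × W) →ₗ[A] (N' ⊔ W : Submodule A M) :=
    (Submodule.inclusion le_sup_left).coprod (Submodule.inclusion le_sup_right)
  have hpv : ∀ q, (p q : M) = q.1 + q.2 := fun q => by simp [p]
  have hp : Function.Surjective p := by
    rintro ⟨m, hm⟩
    obtain ⟨a, ha, b, hb, rfl⟩ := Submodule.mem_sup.1 hm
    exact ⟨(⟨a, ha⟩, ⟨b, hb⟩), Subtype.ext (hpv _)⟩
  obtain ⟨g, hg⟩ := exists_factor p hp (f.comp (LinearMap.fst A N' W)) (fun q hq => by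
    have h0 : (q.1 : M) + q.2 = 0 := by rw [← hpv, hq]; rfl
    refine (hker _).2 (hW ⟨q.1.2, ?_⟩)
    change (q.1 : M) ∈ W
    rw [eq_neg_of_add_eq_zero_left h0]
    exact neg_mem q.2.2)
  refine ⟨g, fun b => ?_, fun m => ?_⟩
  · obtain ⟨a, rfl⟩ := hf b
    exact ⟨p (a, 0), by rw [hg]; rfl⟩
  · obtain ⟨q, rfl⟩ := hp m
    rw [hg, hpv]
    change f q.1 = 0 ↔ _
    rw [hker]
    constructor
    · intro h
      exact Submodule.add_mem_sup h q.2.2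
    · intro h
      obtain ⟨a, ha, b, hb, hab⟩ := Submodule.mem_sup.1 h
      have h1 : (q.1 : M) - a = b - q.2 := by
        rw [sub_eq_sub_iff_add_eq_add, ← hab, add_comm b]
      have h2 : (q.1 : M) - a ∈ N :=
        hW ⟨sub_mem q.1.2 (hle ha), h1 ▸ sub_mem hb q.2.2⟩
      simpa using add_mem h2 ha

theorem Filtered.sup {N₀ N W : Submodule A M} {s : Multiset Q₀} (h : Filtered X N₀ N s)
    (hW : N ⊓ W ≤ N₀) : Filtered X (N₀ ⊔ W) (N ⊔ W) s := by
  induction h with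
  | refl => exact .refl
  | step hN hs ih =>
    exact .step (ih ((inf_le_inf_right W hs.1).trans hW)) (hs.sup (hW.trans hN.le))

theorem Step.map {X : Type x} [AddCommGroup X] [Module A X] {N N' : Submodule A M}
    (h : Step X N N') (p : M →ₗ[A] M') (hp : LinearMap.ker p ≤ N) :
    Step X (N.map p) (N'.map p) := by
  obtain ⟨hle, f, hf, hker⟩ := h
  refine ⟨Submodule.map_mono hle, ?_⟩
  obtain ⟨g, hg⟩ := exists_factor (p.submoduleMap N') (p.submoduleMap_surjective N') f
    (fun n hn => (hker n).2 (hp (congrArg Subtype.val hn)))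
  refine ⟨g, fun b => ?_, fun m => ?_⟩
  · obtain ⟨a, rfl⟩ := hf b
    exact ⟨_, hg a⟩
  · obtain ⟨n, rfl⟩ := p.submoduleMap_surjective N' m
    rw [hg, hker]
    constructor
    · intro h
      exact ⟨n, h, rfl⟩
    · rintro ⟨a, ha, hab⟩
      have : (n : M) - a ∈ N := hp (by
        rw [LinearMap.mem_ker, map_sub, sub_eq_zero]
        exact hab.symm)
      simpa using add_mem this ha

theorem Step.nonempty_equiv {X : Type x} [AddCommGroup X] [Module A X] {N N' : Submodule A M}
    (h : Step X N N') : Nonempty ((N' ⧸ N.submoduleOf N') ≃ₗ[A] X) := by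
  obtain ⟨hle, f, hf, hker⟩ := h
  have : N.submoduleOf N' = LinearMap.ker f := by
    ext m
    rw [LinearMap.mem_ker, hker]
    rfl
  exact ⟨(Submodule.quotEquivOfEq _ _ this).trans (f.quotKerEquivOfSurjective hf)⟩

theorem step_of_equiv {X : Type x} [AddCommGroup X] [Module A X] {N N' : Submodule A M}
    (hle : N ≤ N') (φ : (N' ⧸ N.submoduleOf N') ≃ₗ[A] X) : Step X N N' := by
  refine ⟨hle, φ.toLinearMap.comp (Submodule.mkQ _),
    φ.surjective.comp (Submodule.mkQ_surjective _), fun m => ?_⟩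
  simp only [LinearMap.comp_apply, LinearEquiv.coe_coe, φ.map_eq_zero_iff, Submodule.mkQ_apply,
    Submodule.Quotient.mk_eq_zero]
  rfl

-- The inductive predicate `Filtered` keeps only the multiset of labels and allows induction on the
-- top step. The initial segment of length `n` of the given chain is treated by induction on `n`.
open Classical in
theorem GoodFiltration.filtered (F : GoodFiltration (A := A) X M) :
    ∃ s : Multiset Q₀, Filtered X (⊥ : Submodule A M) ⊤ s ∧ ∀ k, s.count k = F.count k := by
  have key : ∀ n (hn : n < F.length + 1), ∃ s : Multiset Q₀, Filtered X ⊥ (F.sub ⟨n, hn⟩) s ∧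
      ∀ k, s.count k = (Finset.univ.filter fun i : Fin F.length => i.val < n ∧ F.label i = k).card
      := by
    intro n
    induction n with
    | zero =>
      intro hn
      refine ⟨0, ?_, by simp⟩
      have : F.sub ⟨0, hn⟩ = ⊥ := F.bot
      rw [this]
      exact .refl
    | succ n ih =>
      intro hn
      have hn' : n < F.length := by omega
      obtain ⟨s, hs, hc⟩ := ih (by omega)
      refine ⟨F.label ⟨n, hn'⟩ ::ₘ s, .step hs ?_, fun k => ?_⟩
      · obtain ⟨φ⟩ := F.subquotient ⟨n, hn'⟩
        exact step_of_equiv (F.mono (by simp [Fin.le_def])) φ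
      · rw [Multiset.count_cons, hc]
        by_cases hk : k = F.label ⟨n, hn'⟩
        · rw [if_pos hk, ← Finset.card_insert_of_notMem (a := (⟨n, hn'⟩ : Fin F.length)) (by simp)]
          congr 1
          ext i
          simp only [Finset.mem_insert, Finset.mem_filter, Finset.mem_univ, true_and, Fin.ext_iff]
          constructor
          · rintro (h | h)
            · refine ⟨by omega, ?_⟩
              rw [hk]
              congr 1
              exact Fin.ext h
            · exact ⟨by omega, h.2⟩
          · rintro ⟨h1, h2⟩
            by_cases h : i.val = n
            · exact Or.inl h
            · exact Or.inr ⟨by omega, h2⟩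
        · rw [if_neg hk, add_zero]
          congr 1
          ext i
          simp only [Finset.mem_filter, Finset.mem_univ, true_and]
          constructor
          · rintro ⟨h1, h2⟩
            exact ⟨by omega, h2⟩
          · rintro ⟨h1, h2⟩
            refine ⟨?_, h2⟩
            by_contra h
            have : i = ⟨n, hn'⟩ := Fin.ext (by simp only; omega)
            exact hk (by rw [← h2, this])
  obtain ⟨s, hs, hc⟩ := key F.length (by omega)
  refine ⟨s, ?_, fun k => ?_⟩
  · have : F.sub ⟨F.length, by omega⟩ = ⊤ := F.top
    rwa [this] at hs
  · rw [hc, GoodFiltration.count, Nat.card_eq_fintype_card, Fintype.card_subtype]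
    simp

theorem Filtered.exists_chain [Nonempty Q₀] {N₀ N : Submodule A M} {s : Multiset Q₀}
    (h : Filtered X N₀ N s) : ∃ (r : ℕ) (sub : ℕ → Submodule A M) (label : ℕ → Q₀),
      sub 0 = N₀ ∧ sub r = N ∧ (∀ k < r, Step (X (label k)) (sub k) (sub (k + 1))) ∧
      (Multiset.range r).map label = s := by
  induction h with
  -- Chains are indexed by `ℕ` so that they can be prolonged with `Function.update`. Values past the
  -- length are irrelevant; the arbitrary label only fills them in.
  | refl => exact ⟨0, fun _ => N₀, fun _ => Classical.arbitrary _, rfl, rfl, by simp, by simp⟩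
  | @step N N' s k hN hs ih =>
    obtain ⟨r, sub, label, h0, hr, hstep, hl⟩ := ih
    refine ⟨r + 1, Function.update sub (r + 1) N', Function.update label r k, ?_, ?_, ?_, ?_⟩
    · rw [Function.update_of_ne (by omega), h0]
    · rw [Function.update_self]
    · intro j hj
      rw [Function.update_of_ne (by omega : j ≠ r + 1)]
      by_cases hjr : j = r
      · subst hjr
        rw [Function.update_self, Function.update_self, hr]
        exact hs
      · rw [Function.update_of_ne hjr, Function.update_of_ne (by omega)]
        exact hstep j (by omega)
    · rw [Multiset.range_succ, Multiset.map_cons, Function.update_self, ← hl]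
      congr 1
      refine Multiset.map_congr rfl fun j hj => ?_
      rw [Function.update_of_ne (Multiset.mem_range.1 hj).ne]

open Classical in
theorem Filtered.goodFiltration [Nonempty Q₀] {s : Multiset Q₀}
    (h : Filtered X (⊥ : Submodule A M) ⊤ s) :
    ∃ F : GoodFiltration (A := A) X M, ∀ k, F.count k = s.count k := by
  obtain ⟨r, sub, label, h0, hr, hstep, hl⟩ := h.exists_chain
  refine ⟨⟨r, fun k => sub k, fun k => label k, ?_, h0, hr, fun k => ?_⟩, fun k => ?_⟩
  · refine Fin.monotone_iff_le_succ.2 fun k => ?_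
    exact (hstep k k.2).1
  · exact (hstep k k.2).nonempty_equiv
  · rw [GoodFiltration.count, ← hl, Nat.card_eq_fintype_card, Fintype.card_subtype,
      Multiset.count_map]
    refine Finset.card_bij (fun i _ => i.val) ?_ ?_ ?_ |>.trans
      (rfl : ((Finset.range r).filter fun j => k = label j).card = _)
    · intro i hi
      simp only [Finset.mem_filter, Finset.mem_univ, true_and] at hi
      simp [hi]
    · intro i _ j _ hij
      exact Fin.ext hij
    · intro j hj
      simp only [Finset.mem_filter, Finset.mem_range] at hj
      exact ⟨⟨j, hj.1⟩, by simp [hj.2], rfl⟩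

section

variable {K : Type u} [Field K] [Algebra K A] {e : Q₀ → A} [Module K M] [IsScalarTower K A M]
  [∀ k, Module K (X k)] [∀ k, IsScalarTower K A (X k)]

theorem Filtered.mult_eq [Module.Finite K M] {j : Q₀} (he : IsIdempotentElem (e j))
    {N₀ N : Submodule A M} {s : Multiset Q₀} (h : Filtered X N₀ N s) :
    mult K e N j = mult K e N₀ j + (s.map fun k => mult K e (X k) j).sum := by
  induction h with
  | refl => simp
  | @step N N' s k hN hs ih =>
    obtain ⟨hle, f, hf, hker⟩ := hs
    have := finite_submodule (K := K) N'
    rw [mult_exact he (Submodule.inclusion hle) (Submodule.inclusion_injective hle) f hf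
      (fun n => ?_), ih, Multiset.map_cons, Multiset.sum_cons]
    · ring
    · rw [hker]
      constructor
      · intro h
        exact ⟨⟨n, h⟩, rfl⟩
      · rintro ⟨m, rfl⟩
        exact m.2

end

end Filtered

/-! ### The projectives `P(j)` are local -/

section Local

variable {A : Type v} [Ring A] {Q₀ : Type w} {e : Q₀ → A}

/-- The generator `e_j` of `P(j)`. -/
def gen (e : Q₀ → A) (j : Q₀) : P e j := ⟨e j, Submodule.mem_span_singleton_self _⟩

theorem mul_of_mem_P {j : Q₀} (he : IsIdempotentElem (e j)) {a : A} (ha : a ∈ P e j) :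
    a * e j = a := by
  obtain ⟨b, rfl⟩ := Submodule.mem_span_singleton.1 ha
  rw [smul_eq_mul, mul_assoc, he.eq]

theorem smul_gen {j : Q₀} (he : IsIdempotentElem (e j)) (m : P e j) : (m : A) • gen e j = m :=
  Subtype.ext (mul_of_mem_P he m.2)

theorem weight_gen {j : Q₀} (he : IsIdempotentElem (e j)) : e j • gen e j = gen e j :=
  Subtype.ext he.eq

theorem eq_top_of_gen_mem {j : Q₀} (he : IsIdempotentElem (e j)) {N : Submodule A (P e j)}
    (h : gen e j ∈ N) : N = ⊤ :=
  top_le_iff.1 fun m _ => smul_gen he m ▸ N.smul_mem _ h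

/-- The map `P(j) → M` sending `e_j` to `m`. -/
def fromP (e : Q₀ → A) (j : Q₀) {M : Type x} [AddCommGroup M] [Module A M] (m : M) :
    P e j →ₗ[A] M :=
  (LinearMap.toSpanSingleton A M m).comp (P e j).subtype

theorem fromP_apply {j : Q₀} {M : Type x} [AddCommGroup M] [Module A M] (m : M) (p : P e j) :
    fromP e j m p = (p : A) • m := rfl

theorem fromP_gen {j : Q₀} {M : Type x} [AddCommGroup M] [Module A M] {m : M}
    (hm : e j • m = m) : fromP e j m (gen e j) = m := hm

theorem fromP_surjective {j : Q₀} {M : Type x} [AddCommGroup M]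
    [Module A M] {m : M} (hm : e j • m = m) (h : ∀ n : M, ∃ a : A, a • m = n) :
    Function.Surjective (fromP e j m) := fun n => by
  obtain ⟨a, rfl⟩ := h n
  exact ⟨a • gen e j, by rw [map_smul, fromP_gen hm]⟩

variable [Fintype Q₀]

/-- Write `e j = f + g` along the decomposition. Since `f = f * e j = f * f + f * g`, the element `f
* g` lies in both summands and vanishes. So `f` and `g` are orthogonal idempotents and primitivity
applies. -/
theorem IsBasic.isCompl_eq_bot (hb : IsBasic e) {j : Q₀} {X Y : Submodule A (P e j)}
    (h : IsCompl X Y) : X = ⊤ ∨ Y = ⊤ := by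
  have he := hb.complete.idem j
  obtain ⟨f, hf, g, hg, hfg⟩ := Submodule.mem_sup.1
    (h.sup_eq_top ▸ Submodule.mem_top : gen e j ∈ X ⊔ Y)
  have hfg' : e j = (f : A) + g := (congrArg Subtype.val hfg).symm
  have key : ∀ (X Y : Submodule A (P e j)) (f g : P e j), Disjoint X Y → f ∈ X → g ∈ Y →
      e j = (f : A) + g → (f : A) * g = 0 ∧ IsIdempotentElem (f : A) := by
    intro X Y f g hd hf hg hfg
    have h1 : (f : A) = f * f + f * g := by
      conv_lhs => rw [← mul_of_mem_P he f.2, hfg, mul_add]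
    have h2 : (f : A) • g = f - (f : A) • f := Subtype.ext (eq_sub_of_add_eq' h1.symm)
    have h3 : (f : A) • g = 0 :=
      (Submodule.disjoint_def.1 hd) _ (h2 ▸ sub_mem hf (X.smul_mem _ hf)) (Y.smul_mem _ hg)
    have h4 : (f : A) * g = 0 := congrArg Subtype.val h3
    exact ⟨h4, by rw [h4, add_zero] at h1; exact h1.symm⟩
  obtain ⟨h1, h2⟩ := key X Y f g h.disjoint hf hg hfg'
  obtain ⟨h3, h4⟩ := key Y X g f h.disjoint.symm hg hf (by rw [hfg', add_comm])
  rcases hb.primitive j f g h2 h4 h1 h3 hfg' with h0 | h0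
  · right
    refine eq_top_of_gen_mem he ?_
    rw [← hfg, show f = 0 from Subtype.ext h0, zero_add]
    exact hg
  · left
    refine eq_top_of_gen_mem he ?_
    rw [← hfg, show g = 0 from Subtype.ext h0, add_zero]
    exact hf

/-- Fitting's lemma. Split the generator as `u + (e j - u)` with `u ∈ X` of weight `j` and `e j - u
∈ Y`, and let `ρ` be right multiplication by `u`. If `ρ` is nilpotent, the generator is a
telescoping sum of multiples of `e j - u`, so it lies in `Y`; otherwise `ρ` is surjective, with
image in `X`. -/
theorem IsBasic.eq_top_or_of_sup [IsArtinian A A] [IsNoetherian A A] (hb : IsBasic e) {j : Q₀}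
    {X Y : Submodule A (P e j)} (h : X ⊔ Y = ⊤) : X = ⊤ ∨ Y = ⊤ := by
  have he := hb.complete.idem j
  obtain ⟨f, hf, g, hg, hfg⟩ := Submodule.mem_sup.1 (h ▸ Submodule.mem_top : gen e j ∈ X ⊔ Y)
  obtain ⟨u, hu⟩ : ∃ u, u = e j • f := ⟨_, rfl⟩
  have huX : u ∈ X := hu ▸ X.smul_mem _ hf
  have hu1 : e j • u = u := by rw [hu, smul_smul, he.eq]
  have huY : gen e j - u ∈ Y := by
    have : gen e j - u = e j • g := by
      rw [hu, ← weight_gen he, ← hfg, smul_add, add_sub_cancel_left]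
    exact this ▸ Y.smul_mem _ hg
  set ρ : Module.End A (P e j) := fromP e j u with hρ
  have hρg : ρ (gen e j) = u := fromP_gen hu1
  obtain ⟨n, hn⟩ := Filter.eventually_atTop.1 (LinearMap.eventually_isCompl_ker_pow_range_pow ρ)
  -- The exponent `n + 1` guarantees at least one factor `ρ`, so that the range of the power lies in
  -- `X`.
  have hn1 := hn (n + 1) (by omega)
  have hrange : ∀ m, ρ m ∈ X := fun m => X.smul_mem _ huX
  rcases hb.isCompl_eq_bot hn1 with h1 | h1
  · right
    have hnil : (ρ ^ (n + 1)) (gen e j) = 0 := by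
      have : gen e j ∈ LinearMap.ker (ρ ^ (n + 1)) := h1 ▸ Submodule.mem_top
      exact this
    have hstep : ∀ k, (ρ ^ k) (gen e j) - (ρ ^ (k + 1)) (gen e j) ∈ Y := by
      intro k
      have : (ρ ^ k) (gen e j) - (ρ ^ (k + 1)) (gen e j) =
          (((ρ ^ k) (gen e j) : P e j) : A) • (gen e j - u) := by
        rw [pow_succ', Module.End.mul_apply, smul_sub, smul_gen he, hρ, fromP_apply]
      exact this ▸ Y.smul_mem _ huY
    have hall : ∀ k, gen e j - (ρ ^ k) (gen e j) ∈ Y := by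
      intro k
      induction k with
      | zero => simp
      | succ k ih => simpa using add_mem ih (hstep k)
    refine eq_top_of_gen_mem he ?_
    simpa [hnil] using hall (n + 1)
  · left
    have : LinearMap.range (ρ ^ (n + 1)) ≤ X := by
      rintro _ ⟨m, rfl⟩
      rw [pow_succ', Module.End.mul_apply]
      exact hrange _
    exact top_le_iff.1 (h1 ▸ this)

theorem gen_ne_zero (hb : IsBasic e) (j : Q₀) : gen e j ≠ 0 := fun h =>
  hb.ne_zero j (congrArg Subtype.val h)

variable [IsArtinian A A] [IsNoetherian A A]

theorem IsBasic.le_of_isCoatom (hb : IsBasic e) {j : Q₀} {R N : Submodule A (P e j)}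
    (hR : IsCoatom R) (hN : N ≠ ⊤) : N ≤ R := by
  by_contra h
  rcases hb.eq_top_or_of_sup (hR.2 _ (left_lt_sup.2 h)) with h1 | h1
  · exact hR.1 h1
  · exact hN h1

theorem IsBasic.isCoatom_rad (hb : IsBasic e) (j : Q₀) : IsCoatom (rad A (P e j)) := by
  have : Nontrivial (P e j) := ⟨⟨_, _, gen_ne_zero hb j⟩⟩
  obtain ⟨R, hR, -⟩ := (eq_top_or_exists_le_coatom (⊥ : Submodule A (P e j))).resolve_left
    bot_ne_top
  have : rad A (P e j) = R := le_antisymm (sInf_le hR)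
    (le_sInf fun N hN => hb.le_of_isCoatom hN hR.1)
  exact this ▸ hR

theorem IsBasic.le_rad (hb : IsBasic e) {j : Q₀} {N : Submodule A (P e j)} (hN : N ≠ ⊤) :
    N ≤ rad A (P e j) :=
  hb.le_of_isCoatom (hb.isCoatom_rad j) hN

theorem IsBasic.isSimpleModule_S (hb : IsBasic e) (j : Q₀) : IsSimpleModule A (S e j) :=
  isSimpleModule_iff_isCoatom.2 (hb.isCoatom_rad j)

end Local

/-! ### Simple tops and simple socles, expressed by elements -/

section Generated

variable {A : Type v} [Ring A] {Q₀ : Type w}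

/-- `M` is generated by a nonzero element of weight `o`. -/
def IsGenerated (e : Q₀ → A) (o : Q₀) (M : Type x) [AddCommGroup M] [Module A M] : Prop :=
  ∃ m : M, e o • m = m ∧ m ≠ 0 ∧ ∀ n : M, ∃ a : A, a • m = n

/-- Some nonzero element of weight `o` lies in all nonzero submodules of `M`. -/
def IsCogenerated (e : Q₀ → A) (o : Q₀) (M : Type x) [AddCommGroup M] [Module A M] : Prop :=
  ∃ m : M, e o • m = m ∧ m ≠ 0 ∧ ∀ n : M, n ≠ 0 → ∃ a : A, a • n = m

variable {e : Q₀ → A} {o : Q₀} {M : Type x} [AddCommGroup M] [Module A M]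
  {N : Type y} [AddCommGroup N] [Module A N]

theorem IsGenerated.of_surjective (h : IsGenerated e o M) [Nontrivial N] (f : M →ₗ[A] N)
    (hf : Function.Surjective f) : IsGenerated e o N := by
  obtain ⟨m, h1, h2, h3⟩ := h
  refine ⟨f m, by rw [← map_smul, h1], fun h0 => ?_, fun n => ?_⟩
  · obtain ⟨n, hn⟩ := exists_ne (0 : N)
    obtain ⟨m', rfl⟩ := hf n
    obtain ⟨a, rfl⟩ := h3 m'
    exact hn (by rw [map_smul, h0, smul_zero])
  · obtain ⟨m', rfl⟩ := hf n
    obtain ⟨a, rfl⟩ := h3 m'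
    exact ⟨a, (map_smul ..).symm⟩

theorem IsCogenerated.of_injective (h : IsCogenerated e o N) [Nontrivial M] (f : M →ₗ[A] N)
    (hf : Function.Injective f) : IsCogenerated e o M := by
  obtain ⟨z, h1, h2, h3⟩ := h
  obtain ⟨m, hm⟩ := exists_ne (0 : M)
  obtain ⟨a, ha⟩ := h3 (f m) ((map_ne_zero_iff f hf).2 hm)
  rw [← map_smul] at ha
  refine ⟨a • m, hf (by rw [map_smul, ha, h1]), ?_, fun n hn => ?_⟩
  · intro h0
    exact h2 (by rw [← ha, h0, map_zero])
  · obtain ⟨b, hb⟩ := h3 (f n) ((map_ne_zero_iff f hf).2 hn)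
    exact ⟨b, hf (by rw [map_smul, hb, ha])⟩

theorem IsCogenerated.exists_smul_ne_zero (h : IsCogenerated e o M) {m : M} (hm : m ≠ 0) :
    ∃ a : A, e o • a • m ≠ 0 := by
  obtain ⟨z, h1, h2, h3⟩ := h
  obtain ⟨a, rfl⟩ := h3 m hm
  exact ⟨a, by rwa [h1]⟩

/-- The distinguished element spans the least nonzero submodule, which is therefore the only simple
one. -/
theorem IsCogenerated.isSimpleModule_soc (h : IsCogenerated e o M) :
    IsSimpleModule A (soc A M) := by
  obtain ⟨z, -, h2, h3⟩ := h
  have hz : IsAtom (Submodule.span A {z}) := by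
    refine ⟨by simpa using h2, fun N hN => ?_⟩
    by_contra h0
    obtain ⟨n, hn, hn0⟩ := Submodule.exists_mem_ne_zero_of_ne_bot h0
    obtain ⟨a, ha⟩ := h3 n hn0
    exact hN.not_ge ((Submodule.span_singleton_le_iff_mem _ _).2 (ha ▸ N.smul_mem a hn))
  have : soc A M = Submodule.span A {z} := by
    refine le_antisymm (sSup_le fun N hN => ?_) (le_sSup (isSimpleModule_iff_isAtom.2 hz))
    have hN' : IsAtom N := isSimpleModule_iff_isAtom.1 hN
    obtain ⟨n, hn, hn0⟩ := Submodule.exists_mem_ne_zero_of_ne_bot hN'.1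
    obtain ⟨a, ha⟩ := h3 n hn0
    have hle : Submodule.span A {z} ≤ N :=
      (Submodule.span_singleton_le_iff_mem _ _).2 (ha ▸ N.smul_mem a hn)
    rcases hN'.le_iff.1 hle with h | h
    · exact absurd h hz.1
    · exact h.ge
  rw [this]
  exact isSimpleModule_iff_isAtom.2 hz

theorem soc_le [IsArtinian A M] (hs : IsSimpleModule A (soc A M)) {N : Submodule A M}
    (hN : N ≠ ⊥) : soc A M ≤ N := by
  obtain ⟨U, hU, hUN⟩ := (eq_bot_or_exists_atom_le N).resolve_left hN
  have hUs : U ≤ soc A M := le_sSup (isSimpleModule_iff_isAtom.2 hU)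
  rcases (isSimpleModule_iff_isAtom.1 hs).le_iff.1 hUs with h | h
  · exact absurd h hU.1
  · exact h ▸ hUN

/-- The last hypothesis puts an element of weight `o` into the socle; the socle lies in every
nonzero submodule. -/
theorem isCogenerated_of_isSimpleModule_soc [IsArtinian A M] (he : IsIdempotentElem (e o))
    (hs : IsSimpleModule A (soc A M)) (h : ∀ m : M, m ≠ 0 → ∃ a : A, e o • a • m ≠ 0) :
    IsCogenerated e o M := by
  obtain ⟨x, hx, hx0⟩ :=
    Submodule.exists_mem_ne_zero_of_ne_bot (isSimpleModule_iff_isAtom.1 hs).1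
  obtain ⟨a, ha⟩ := h x hx0
  refine ⟨e o • a • x, by rw [smul_smul, he.eq], ha, fun n hn => ?_⟩
  have : e o • a • x ∈ Submodule.span A {n} :=
    soc_le hs (by simpa using hn) (Submodule.smul_mem _ _ (Submodule.smul_mem _ _ hx))
  exact Submodule.mem_span_singleton.1 this

theorem isGenerated_of_isSimpleModule_top [IsNoetherian A M] (he : IsIdempotentElem (e o))
    (hs : IsSimpleModule A (Top A M))
    (h : ∀ N : Submodule A M, N ≠ ⊤ → ∃ m, e o • m ∉ N) : IsGenerated e o M := by
  have hco := isSimpleModule_iff_isCoatom.1 hs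
  obtain ⟨m, hm⟩ := h _ hco.1
  refine ⟨e o • m, by rw [smul_smul, he.eq], fun h0 => hm (h0 ▸ zero_mem _), fun n => ?_⟩
  have : Submodule.span A {e o • m} = ⊤ := by
    by_contra hne
    obtain ⟨R, hR, hle⟩ := (eq_top_or_exists_le_coatom _).resolve_left hne
    have h1 : rad A M ≤ R := sInf_le hR
    rcases hco.le_iff.1 h1 with h2 | h2
    · exact hR.1 h2
    · exact hm (h2 ▸ hle (Submodule.mem_span_singleton_self _))
  exact Submodule.mem_span_singleton.1 (this ▸ Submodule.mem_top)

variable [Fintype Q₀] [IsArtinian A A] [IsNoetherian A A]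

/-- A map from a local projective onto a simple module identifies that module with the top. -/
theorem IsBasic.nonempty_equiv_S (hb : IsBasic e) [IsSimpleModule A M] (f : P e o →ₗ[A] M)
    (hf : f ≠ 0) : Nonempty (M ≃ₗ[A] S e o) := by
  have hs : Function.Surjective f := LinearMap.surjective_of_ne_zero hf
  have h1 : IsCoatom (LinearMap.ker f) := LinearMap.isCoatom_ker_of_surjective hs
  have h2 : LinearMap.ker f = rad A (P e o) :=
    le_antisymm (hb.le_rad h1.1) (sInf_le h1)
  exact ⟨((Submodule.quotEquivOfEq _ _ h2.symm).trans (f.quotKerEquivOfSurjective hs)).symm⟩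

theorem IsBasic.nonempty_equiv_S_of_weight (hb : IsBasic e) [IsSimpleModule A M] {m : M}
    (hm : e o • m ≠ 0) : Nonempty (M ≃ₗ[A] S e o) := by
  have h : e o • e o • m = e o • m := by rw [smul_smul, (hb.complete.idem o).eq]
  refine hb.nonempty_equiv_S (fromP e o (e o • m)) fun h0 => hm ?_
  rw [← fromP_gen h, h0, LinearMap.zero_apply]

theorem IsBasic.nonempty_soc_equiv (hb : IsBasic e) (h : IsCogenerated e o M) [IsArtinian A M] :
    Nonempty (soc A M ≃ₗ[A] S e o) := by
  have hs := h.isSimpleModule_soc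
  obtain ⟨z, h1, h2, h3⟩ := h
  have hz : z ∈ soc A M := by
    obtain ⟨x, hx, hx0⟩ :=
      Submodule.exists_mem_ne_zero_of_ne_bot (isSimpleModule_iff_isAtom.1 hs).1
    obtain ⟨a, rfl⟩ := h3 x hx0
    exact Submodule.smul_mem _ _ hx
  refine hb.nonempty_equiv_S_of_weight (m := (⟨z, hz⟩ : soc A M)) fun h0 => h2 ?_
  rw [← h1]
  exact congrArg Subtype.val h0

/-- `M` is a quotient of the local module `P(o)`. Maximal submodules of `M` pull back to the radical
of `P(o)`, so the image of that radical is the only one. -/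
theorem IsBasic.isSimpleModule_top (hb : IsBasic e) (h : IsGenerated e o M) :
    IsSimpleModule A (Top A M) := by
  obtain ⟨m, h1, h2, h3⟩ := h
  obtain ⟨f, hf⟩ : ∃ f, f = fromP e o m := ⟨_, rfl⟩
  have hs : Function.Surjective f := hf ▸ fromP_surjective h1 h3
  have hker : LinearMap.ker f ≤ rad A (P e o) := by
    refine hb.le_rad fun h0 => h2 ?_
    have : gen e o ∈ LinearMap.ker f := h0 ▸ Submodule.mem_top
    rw [← fromP_gen h1, ← hf]
    exact this
  have hcomap : ∀ N : Submodule A M, IsCoatom N → N.comap f = rad A (P e o) := by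
    intro N hN
    have : IsCoatom (N.comap f) := (Submodule.isCoatom_comap_iff hs).2 hN
    exact le_antisymm (hb.le_rad this.1) (sInf_le this)
  have hmap : IsCoatom ((rad A (P e o)).map f) := by
    rw [← Submodule.isCoatom_comap_iff hs, Submodule.comap_map_eq, sup_eq_left.2 hker]
    exact hb.isCoatom_rad o
  have : rad A M = (rad A (P e o)).map f := by
    refine le_antisymm (sInf_le hmap) (le_sInf fun N hN => ?_)
    rw [Submodule.map_le_iff_le_comap, hcomap N hN]
  rw [isSimpleModule_iff_isCoatom, this]
  exact hmap

theorem IsBasic.nonempty_top_equiv (hb : IsBasic e) (h : IsGenerated e o M) [IsNoetherian A M] :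
    Nonempty (Top A M ≃ₗ[A] S e o) := by
  have hs := hb.isSimpleModule_top h
  obtain ⟨m, h1, h2, h3⟩ := h
  refine hb.nonempty_equiv_S_of_weight (m := (rad A M).mkQ m) fun h0 => ?_
  have hco := isSimpleModule_iff_isCoatom.1 hs
  rw [← map_smul, h1] at h0
  refine hco.1 (top_le_iff.1 fun n _ => ?_)
  obtain ⟨a, rfl⟩ := h3 n
  exact Submodule.smul_mem _ _ (by simpa using h0)

theorem IsBasic.isCogenerated_of_equiv (hb : IsBasic e) [IsArtinian A M]
    (φ : soc A M ≃ₗ[A] S e o) : IsCogenerated e o M := by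
  have := hb.isSimpleModule_S o
  have hs : IsSimpleModule A (soc A M) := IsSimpleModule.congr φ
  obtain ⟨g, hg⟩ : ∃ g, g = (rad A (P e o)).mkQ (gen e o) := ⟨_, rfl⟩
  have hg1 : e o • g = g := by rw [hg, ← map_smul, weight_gen (hb.complete.idem o)]
  have hg0 : g ≠ 0 := by
    intro h0
    rw [hg, Submodule.mkQ_apply, Submodule.Quotient.mk_eq_zero] at h0
    exact (hb.isCoatom_rad o).1 (eq_top_of_gen_mem (hb.complete.idem o) h0)
  refine ⟨φ.symm g, ?_, ?_, fun n hn => ?_⟩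
  · rw [← Submodule.coe_smul, ← map_smul, hg1]
  · simpa using hg0
  · have : ((φ.symm g : soc A M) : M) ∈ Submodule.span A {n} :=
      soc_le hs (by simpa using hn) (φ.symm g).2
    exact Submodule.mem_span_singleton.1 this

theorem IsBasic.isGenerated_of_equiv (hb : IsBasic e) [IsNoetherian A M]
    (φ : Top A M ≃ₗ[A] S e o) : IsGenerated e o M := by
  have := hb.isSimpleModule_S o
  have he := hb.complete.idem o
  have hs : IsSimpleModule A (Top A M) := IsSimpleModule.congr φ
  have hco := isSimpleModule_iff_isCoatom.1 hs
  obtain ⟨m, hm⟩ := (rad A M).mkQ_surjective (φ.symm ((rad A (P e o)).mkQ (gen e o)))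
  have hm' : e o • m ∉ rad A M := by
    intro h0
    have h1 : (rad A M).mkQ (e o • m) = 0 := (Submodule.Quotient.mk_eq_zero _).2 h0
    rw [map_smul, hm, ← map_smul, ← map_smul, weight_gen he, LinearEquiv.map_eq_zero_iff,
      Submodule.mkQ_apply, Submodule.Quotient.mk_eq_zero] at h1
    exact (hb.isCoatom_rad o).1 (eq_top_of_gen_mem he h1)
  refine ⟨e o • m, by rw [smul_smul, he.eq], fun h0 => hm' (h0 ▸ zero_mem _), fun n => ?_⟩
  have : Submodule.span A {e o • m} = ⊤ := by
    by_contra hne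
    obtain ⟨R, hR, hle⟩ := (eq_top_or_exists_le_coatom _).resolve_left hne
    have h1 : rad A M ≤ R := sInf_le hR
    rcases hco.le_iff.1 h1 with h2 | h2
    · exact hR.1 h2
    · exact hm' (h2 ▸ hle (Submodule.mem_span_singleton_self _))
  exact Submodule.mem_span_singleton.1 (this ▸ Submodule.mem_top)

end Generated

/-! ### Restricting weights: trace, cotrace and the ideal `J(i)` -/

section Trace

variable {A : Type v} [Ring A] {Q₀ : Type w} (e : Q₀ → A)
  {M : Type x} [AddCommGroup M] [Module A M] {M' : Type y} [AddCommGroup M'] [Module A M']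

/-- The submodule of `N` generated by its elements of weights outside `Λ`. -/
def trace (Λ : Set Q₀) (N : Submodule A M) : Submodule A M :=
  Submodule.span A {m | ∃ l ∉ Λ, ∃ n ∈ N, e l • n = m}

variable {e} {Λ : Set Q₀}

theorem trace_le {N U : Submodule A M} :
    trace e Λ N ≤ U ↔ ∀ l ∉ Λ, ∀ n ∈ N, e l • n ∈ U := by
  rw [trace, Submodule.span_le]
  constructor
  · intro h l hl n hn
    exact h ⟨l, hl, n, hn, rfl⟩
  · rintro h _ ⟨l, hl, n, hn, rfl⟩
    exact h l hl n hn

theorem smul_mem_trace {N : Submodule A M} {l : Q₀} (hl : l ∉ Λ) {n : M} (hn : n ∈ N) :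
    e l • n ∈ trace e Λ N :=
  Submodule.subset_span ⟨l, hl, n, hn, rfl⟩

theorem trace_le_self (N : Submodule A M) : trace e Λ N ≤ N :=
  trace_le.2 fun _ _ _ hn => N.smul_mem _ hn

theorem trace_mono {N N' : Submodule A M} (h : N ≤ N') : trace e Λ N ≤ trace e Λ N' :=
  trace_le.2 fun _ hl _ hn => smul_mem_trace hl (h hn)

theorem trace_anti {Λ' : Set Q₀} (h : Λ ⊆ Λ') (N : Submodule A M) :
    trace e Λ' N ≤ trace e Λ N :=
  trace_le.2 fun _ hl _ hn => smul_mem_trace (fun hl' => hl (h hl')) hn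

theorem weight_quotient_trace {l : Q₀} (hl : l ∉ Λ) (m : M ⧸ trace e Λ (⊤ : Submodule A M)) :
    e l • m = 0 := by
  obtain ⟨m, rfl⟩ := Submodule.mkQ_surjective _ m
  rw [← map_smul, Submodule.mkQ_apply, Submodule.Quotient.mk_eq_zero]
  exact smul_mem_trace hl trivial

theorem trace_top_map_le {f : M →ₗ[A] M'} :
    (trace e Λ (⊤ : Submodule A M)).map f ≤ trace e Λ ⊤ := by
  rw [Submodule.map_le_iff_le_comap]
  refine trace_le.2 fun l hl n _ => ?_
  rw [Submodule.mem_comap, map_smul]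
  exact smul_mem_trace hl trivial

/-- The submodule of the elements that generate a submodule with weights in `Λ`. -/
def cotrace (e : Q₀ → A) (Λ : Set Q₀) (M : Type x) [AddCommGroup M] [Module A M] :
    Submodule A M where
  carrier := {m | ∀ l ∉ Λ, ∀ a : A, e l • a • m = 0}
  add_mem' := fun hm hn l hl a => by rw [smul_add, smul_add, hm l hl a, hn l hl a, add_zero]
  zero_mem' := fun l _ a => by rw [smul_zero, smul_zero]
  smul_mem' := fun b m hm l hl a => by rw [smul_smul a b]; exact hm l hl (a * b)

theorem weight_cotrace {l : Q₀} (hl : l ∉ Λ) (m : cotrace e Λ M) : e l • m = 0 := by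
  refine Subtype.ext ?_
  simpa using m.2 l hl 1

theorem map_mem_cotrace (f : M →ₗ[A] M') {m : M} (hm : m ∈ cotrace e Λ M) :
    f m ∈ cotrace e Λ M' := fun l hl a => by
  rw [← map_smul, ← map_smul, hm l hl a, map_zero]

theorem cotrace_mono {Λ' : Set Q₀} (h : Λ ⊆ Λ') : cotrace e Λ M ≤ cotrace e Λ' M :=
  fun _ hm l hl a => hm l (fun hl' => hl (h hl')) a

theorem J_smul [PartialOrder Q₀] [Fintype Q₀] {i : Q₀}
    (h : ∀ l, ¬ l ≤ i → ∀ m : M, e l • m = 0) {a : A} (ha : a ∈ J e i) (m : M) : a • m = 0 := by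
  classical
  -- The annihilator of `M` is the kernel of a ring homomorphism, hence two-sided, so it is enough
  -- that it contains the generator of `J(i)`.
  have hle : TwoSidedIdeal.span {∑ j with ¬ j ≤ i, e j} ≤
      TwoSidedIdeal.ker (Module.toAddMonoidEnd A M) := by
    rw [TwoSidedIdeal.span_le]
    rintro _ rfl
    rw [SetLike.mem_coe, TwoSidedIdeal.mem_ker]
    ext m
    change (∑ j with ¬ j ≤ i, e j) • m = 0
    rw [Finset.sum_smul]
    refine Finset.sum_eq_zero fun j hj => h j ?_ m
    simpa using hj
  have h1 : a ∈ TwoSidedIdeal.ker (Module.toAddMonoidEnd A M) := by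
    refine hle ?_
    convert TwoSidedIdeal.mem_asIdeal.1 ha
  rw [TwoSidedIdeal.mem_ker] at h1
  exact DFunLike.congr_fun h1 m

theorem vertex_mem_J [PartialOrder Q₀] [Fintype Q₀] (hc : CompleteOrthogonalIdempotents e)
    {i l : Q₀} (hl : ¬ l ≤ i) : e l ∈ J e i := by
  classical
  have h1 : (∑ j with ¬ j ≤ i, e j) ∈ J e i := by
    unfold J
    rw [TwoSidedIdeal.mem_asIdeal]
    refine TwoSidedIdeal.subset_span ?_
    rw [Set.mem_singleton_iff]
  have h2 := (J e i).mul_mem_left (e l) h1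
  rwa [Finset.mul_sum, Finset.sum_eq_single l, (hc.idem l).eq] at h2
  · intro b _ hbl
    exact hc.ortho hbl.symm
  · intro h
    exact absurd (by simpa using hl) h

end Trace

/-! ### Standard modules as quotients by a trace -/

section Standard

variable {K : Type u} [Field K] {A : Type v} [Ring A] [Algebra K A]
  {Q₀ : Type w} [PartialOrder Q₀] {e : Q₀ → A}

/-- A quotient has no weight outside `Set.Iic i` exactly when the kernel contains all elements of
these weights, so the smallest such kernel is the submodule they generate. -/
theorem standardKernel_eq [Module.Finite K A] (i : Q₀) :
    standardKernel K e i = trace e (Set.Iic i) ⊤ := by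
  have h1 := finite_submodule (K := K) (P e i)
  refine le_antisymm (sInf_le fun j hj => ?_) (le_sInf fun U hU => trace_le.2 fun l hl n _ => ?_)
  · have := finite_quotient (K := K) (trace e (Set.Iic i) (⊤ : Submodule A (P e i)))
    exact mult_eq_zero_iff.2 (weight_quotient_trace hj)
  · have := finite_quotient (K := K) U
    have h2 := mult_eq_zero_iff.1 (hU l hl) (U.mkQ n)
    rwa [← map_smul, Submodule.mkQ_apply, Submodule.Quotient.mk_eq_zero] at h2

theorem weight_standard [Module.Finite K A] {i l : Q₀} (hl : ¬ l ≤ i) (m : Standard K e i) :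
    e l • m = 0 := by
  have h1 : standardKernel K e i = trace e (Set.Iic i) ⊤ := standardKernel_eq i
  obtain ⟨m, rfl⟩ := Submodule.mkQ_surjective _ m
  rw [← map_smul, Submodule.mkQ_apply, Submodule.Quotient.mk_eq_zero, h1]
  exact smul_mem_trace (by simpa using hl) trivial

theorem finite_standard [Module.Finite K A] (i : Q₀) : Module.Finite K (Standard K e i) :=
  have := finite_submodule (K := K) (P e i)
  finite_quotient _

variable (K) in
/-- The generator of `Δ(i)`. -/
noncomputable def standardGen (e : Q₀ → A) (i : Q₀) : Standard K e i :=
  (standardKernel K e i).mkQ (gen e i)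

theorem weight_standardGen {i : Q₀} (he : IsIdempotentElem (e i)) :
    e i • standardGen K e i = standardGen K e i := by
  rw [standardGen, ← map_smul, weight_gen he]

theorem exists_smul_standardGen {i : Q₀} (he : IsIdempotentElem (e i)) (m : Standard K e i) :
    ∃ a : A, a • standardGen K e i = m := by
  obtain ⟨m, rfl⟩ := Submodule.mkQ_surjective _ m
  exact ⟨m, by rw [standardGen, ← map_smul, smul_gen he]⟩

theorem smul_standardGen_eq_zero {i : Q₀} (he : IsIdempotentElem (e i)) (m : P e i) :
    (m : A) • standardGen K e i = 0 ↔ m ∈ standardKernel K e i := by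
  rw [standardGen, ← map_smul, smul_gen he, Submodule.mkQ_apply, Submodule.Quotient.mk_eq_zero]

theorem exists_fromStandard [Module.Finite K A] {i : Q₀} {M : Type x} [AddCommGroup M]
    [Module A M] {m : M} (hm : e i • m = m) (h : m ∈ cotrace e (Set.Iic i) M) :
    ∃ f : Standard K e i →ₗ[A] M, f (standardGen K e i) = m := by
  refine ⟨(standardKernel K e i).liftQ (fromP e i m) ?_, ?_⟩
  · rw [standardKernel_eq]
    refine trace_le.2 fun l hl n _ => ?_
    rw [LinearMap.mem_ker, map_smul, fromP_apply]
    exact h l hl _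
  · exact fromP_gen hm

end Standard

/-! ### Injective and costandard modules by duality -/

section Dual

variable {K : Type u} [Field K] {A : Type v} [Ring A] [Algebra K A]
  {Q₀ : Type w} {e : Q₀ → A}
  {M : Type x} [AddCommGroup M] [Module K M] [Module A M] [IsScalarTower K A M]

theorem finite_regularDual [Module.Finite K A] : Module.Finite K (RegularDual K A) :=
  inferInstanceAs (Module.Finite K (A →ₗ[K] K))

theorem RegularDual.ext {φ ψ : RegularDual K A} (h : ∀ a, φ a = ψ a) : φ = ψ := DFunLike.ext _ _ h

/-- The map `M → I(j)` given by a functional on `e_j M`. -/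
noncomputable def toI {j : Q₀} (he : IsIdempotentElem (e j)) (φ : M →ₗ[K] K) : M →ₗ[A] I K e j where
  toFun m := ⟨(φ.comp ((Algebra.lsmul K K M (e j) : M →ₗ[K] M).comp
    ((LinearMap.toSpanSingleton A M m).restrictScalars K)) : A →ₗ[K] K), fun a =>
      show φ (e j • (e j * a) • m) = φ (e j • a • m) by
        rw [smul_smul, smul_smul, ← mul_assoc, he.eq]⟩
  map_add' m n := Subtype.ext (RegularDual.ext fun a =>
    show φ (e j • a • (m + n)) = φ (e j • a • m) + φ (e j • a • n) by
      rw [smul_add, smul_add, map_add])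
  map_smul' b m := Subtype.ext (RegularDual.ext fun a =>
    show φ (e j • a • b • m) = φ (e j • (a * b) • m) by rw [smul_smul a b])

theorem toI_apply {j : Q₀} (he : IsIdempotentElem (e j)) (φ : M →ₗ[K] K) (m : M) (a : A) :
    (toI he φ m : RegularDual K A) a = φ (e j • a • m) := rfl

theorem toI_eq_zero {j : Q₀} (he : IsIdempotentElem (e j)) {φ : M →ₗ[K] K} {m : M} :
    toI he φ m = 0 ↔ ∀ a : A, φ (e j • a • m) = 0 := by
  constructor
  · intro h a
    rw [← toI_apply he, h]
    rfl
  · intro h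
    exact Subtype.ext (RegularDual.ext h)

/-- Evaluating `e j • a • φ` at `1` gives `φ (e j * a) = φ a`. Thus every nonzero submodule of
`I(j)` has weight `j`. -/
theorem I_eq_zero {j : Q₀} {φ : I K e j} (h : ∀ a : A, e j • a • φ = 0) : φ = 0 := by
  refine Subtype.ext (RegularDual.ext fun a => ?_)
  have h1 : (e j • a • φ : RegularDual K A) 1 = 0 := by
    rw [← Submodule.coe_smul, ← Submodule.coe_smul, h a]
    rfl
  rw [RegularDual.smul_apply, RegularDual.smul_apply, one_mul, φ.2 a] at h1
  exact h1

theorem finite_I [Module.Finite K A] (j : Q₀) : Module.Finite K (I K e j) :=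
  have := finite_regularDual (K := K) (A := A)
  finite_submodule _

/-- Take a functional that is nonzero on the distinguished element `z`. The kernel of the induced
map does not contain `z`, hence is zero. -/
theorem exists_injective_toI {j : Q₀} (he : IsIdempotentElem (e j)) (h : IsCogenerated e j M) :
    ∃ f : M →ₗ[A] I K e j, Function.Injective f := by
  obtain ⟨z, h1, h2, h3⟩ := h
  obtain ⟨φ, hφ⟩ : ∃ φ : Module.Dual K M, φ z ≠ 0 := by
    by_contra! h
    exact h2 ((Module.forall_dual_apply_eq_zero_iff K z).1 h)
  refine ⟨toI he φ, (injective_iff_map_eq_zero _).2 fun m hm => ?_⟩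
  by_contra hm0
  obtain ⟨a, ha⟩ := h3 m hm0
  have := (toI_eq_zero he).1 hm a
  rw [ha, h1] at this
  exact hφ this

theorem costandard_eq [Module.Finite K A] [PartialOrder Q₀] (i : Q₀) :
    costandard K e i = cotrace e (Set.Iic i) (I K e i) := by
  have h1 := finite_I (K := K) (e := e) i
  refine le_antisymm (sSup_le fun U hU φ hφ l hl a => ?_) (le_sSup fun j hj => ?_)
  · have := finite_submodule (K := K) U
    exact congrArg Subtype.val (mult_eq_zero_iff.1 (hU l hl) (⟨a • φ, U.smul_mem a hφ⟩ : U))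
  · have := finite_submodule (K := K) (cotrace e (Set.Iic i) (I K e i))
    exact mult_eq_zero_iff.2 (weight_cotrace hj)

/-- The weight spaces of `I(j)` and of its submodules with prescribed weights. -/
theorem mult_cotrace [Module.Finite K A] {j k : Q₀} (hj : IsIdempotentElem (e j))
    (hk : IsIdempotentElem (e k)) (Λ : Set Q₀) :
    mult K e (cotrace e Λ (I K e j)) k =
      mult K e (P e k ⧸ trace e Λ (⊤ : Submodule A (P e k))) j := by
  set Q := P e k ⧸ trace e Λ (⊤ : Submodule A (P e k)) with hQ
  set g : Q := (trace e Λ (⊤ : Submodule A (P e k))).mkQ (gen e k) with hg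
  have hg1 : e k • g = g := by rw [hg, ← map_smul, weight_gen hk]
  have hgen : ∀ q : Q, ∃ a : A, a • g = q := fun q => by
    obtain ⟨m, rfl⟩ := Submodule.mkQ_surjective _ q
    exact ⟨m, by rw [hg, ← map_smul, smul_gen hk]⟩
  set R := LinearMap.range (Algebra.lsmul K K Q (e j)) with hR
  set C := LinearMap.range (Algebra.lsmul K K (cotrace e Λ (I K e j)) (e k)) with hC
  have hfinA := finite_submodule (K := K) (P e k)
  have hfinQ : Module.Finite K Q := finite_quotient _
  -- A functional `ψ` on the weight space `R` of `Q` corresponds to the element `a ↦ ψ (e j • a •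
  -- g)` of `I(j)`. It has weight `k` because `g` has. To use `toI`, `ψ` is extended to `Q`; the
  -- extension does not matter, as only values on `R` enter.
  let el : A → R := fun a => ⟨e j • a • g, a • g, rfl⟩
  have hel : ∀ (ψ : Module.Dual K R), ∃ c : C, ∀ a, ((c : cotrace e Λ (I K e j)) : I K e j).1 a
      = ψ (el a) := by
    intro ψ
    obtain ⟨φ, hφ⟩ := LinearMap.exists_extend ψ
    have hφ' : ∀ r : R, φ r = ψ r := fun r => LinearMap.congr_fun hφ r
    have hc : toI hj φ g ∈ cotrace e Λ (I K e j) := map_mem_cotrace _ fun l hl a =>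
      weight_quotient_trace hl _
    refine ⟨⟨⟨toI hj φ g, hc⟩, (mem_weight hk).2 (Subtype.ext ?_)⟩, fun a => hφ' (el a)⟩
    change e k • toI hj φ g = _
    rw [← map_smul, hg1]
  have helin : ∀ (c : K) (a b : A), el (c • a + b) = c • el a + el b := fun c a b =>
    Subtype.ext (by
      change e j • (c • a + b) • g = c • (e j • a • g) + e j • b • g
      rw [add_smul, smul_add, smul_assoc, smul_comm (e j) c])
  have hsurj : ∀ r : R, ∃ a, el a = r := by
    rintro ⟨_, q, rfl⟩
    obtain ⟨a, rfl⟩ := hgen q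
    exact ⟨a, rfl⟩
  have hdet : ∀ c d : C, (∀ a, ((c : cotrace e Λ (I K e j)) : I K e j).1 a =
      ((d : cotrace e Λ (I K e j)) : I K e j).1 a) → c = d := fun c d h =>
    Subtype.ext (Subtype.ext (Subtype.ext (RegularDual.ext h)))
  choose Φ hΦ using hel
  let Ψ : Module.Dual K R →ₗ[K] C :=
    { toFun := Φ
      map_add' := fun ψ ψ' => hdet _ _ fun a => by
        rw [hΦ]
        change _ = ((Φ ψ : cotrace e Λ (I K e j)) : I K e j).1 a +
          ((Φ ψ' : cotrace e Λ (I K e j)) : I K e j).1 a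
        rw [hΦ, hΦ]
        rfl
      map_smul' := fun c ψ => hdet _ _ fun a => by
        rw [hΦ]
        change _ = c • ((Φ ψ : cotrace e Λ (I K e j)) : I K e j).1 a
        rw [hΦ]
        rfl }
  have hinj : Function.Injective Ψ := by
    intro ψ ψ' h
    ext r
    obtain ⟨a, rfl⟩ := hsurj r
    rw [← hΦ, ← hΦ]
    have h' : Φ ψ = Φ ψ' := h
    rw [h']
  have hsur : Function.Surjective Ψ := by
    intro c
    obtain ⟨⟨⟨φ, hφI⟩, hφ⟩, hφk⟩ := c
    have hk' : ∀ a, φ (a * e k) = φ a := fun a => by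
      have := congrArg (fun t : cotrace e Λ (I K e j) => (t : I K e j).1 a)
        ((mem_weight hk).1 hφk)
      exact this
    -- For surjectivity: an element `φ` of weight `k` satisfies `φ (a * e k) = φ a`, so it is
    -- determined by its restriction to `P(k)`. That restriction kills the trace because `φ` lies in
    -- the cotrace, and it descends to `Q`.
    let φ₁ : P e k →ₗ[K] K :=
      LinearMap.comp (show A →ₗ[K] K from φ) ((P e k).subtype.restrictScalars K)
    have hle : (trace e Λ (⊤ : Submodule A (P e k))).restrictScalars K ≤ LinearMap.ker φ₁ := by
      intro t ht
      -- The statement for all multiples `b • t` is what survives scalar multiplication in the span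
      -- induction.
      have : ∀ b : A, φ₁ (b • t) = 0 := by
        refine Submodule.span_induction (p := fun t _ => ∀ b : A, φ₁ (b • t) = 0)
          ?_ ?_ ?_ ?_ ht
        · rintro _ ⟨l, hl, n, -, rfl⟩ b
          have h1 := congrArg (fun t : I K e j => t.1 b) (hφ l hl n)
          change φ (b * e l * (n : A)) = 0 at h1
          change φ (b * (e l * (n : A))) = 0
          rw [← mul_assoc]
          exact h1
        · intro b
          rw [smul_zero, map_zero]
        · intro s t _ _ hs ht b
          rw [smul_add, map_add, hs, ht, add_zero]
        · intro a t _ ht b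
          rw [smul_smul]
          exact ht _
      rw [LinearMap.mem_ker, ← one_smul A t]
      exact this 1
    let φ₂ : Q →ₗ[K] K :=
      ((trace e Λ (⊤ : Submodule A (P e k))).restrictScalars K).liftQ φ₁ hle
    refine ⟨φ₂.comp R.subtype, hdet _ _ fun a => ?_⟩
    change ((Φ _ : cotrace e Λ (I K e j)) : I K e j).1 a = φ a
    rw [hΦ]
    change φ (e j * (a * e k)) = φ a
    rw [hφI, hk']
  have := (LinearEquiv.ofBijective Ψ ⟨hinj, hsur⟩).finrank_eq
  rw [Subspace.dual_finrank_eq] at this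
  exact this.symm

end Dual

section Noetherian

variable (K : Type u) [Field K] {A : Type v} [Ring A] [Algebra K A]
  (M : Type x) [AddCommGroup M] [Module K M] [Module A M] [IsScalarTower K A M]

theorem isNoetherian_of_finite [Module.Finite K M] : IsNoetherian A M :=
  isNoetherian_of_tower K inferInstance

theorem isArtinian_of_finite [Module.Finite K M] : IsArtinian A M :=
  isArtinian_of_tower K inferInstance

end Noetherian

/-! ### Counting labels and common upper bounds -/

section Multiset

variable {Q₀ : Type w} [PartialOrder Q₀]

open Classical in
theorem countP_le_eq (s : Multiset Q₀) (m : Q₀) :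
    s.countP (m ≤ ·) = s.count m + s.countP (m < ·) := by
  induction s using Multiset.induction with
  | empty => simp
  | cons a s ih =>
    rw [Multiset.countP_cons, Multiset.count_cons, Multiset.countP_cons, ih]
    by_cases h1 : m = a
    · subst h1
      simp
      omega
    · by_cases h2 : m ≤ a
      · have h3 : m < a := lt_of_le_of_ne h2 h1
        simp [h1, h2, h3]
        omega
      · have h3 : ¬ m < a := fun h => h2 h.le
        simp [h1, h2, h3]

-- Downward induction from the maximal vertices: the count at `m` is the number of labels `≥ m`
-- minus the number of labels `> m`. It serves to recover the labels of a filtration from a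
-- dimension vector.
open Classical in
theorem multiset_eq_of_countP_le [Finite Q₀] {s t : Multiset Q₀}
    (h : ∀ m, s.countP (m ≤ ·) = t.countP (m ≤ ·)) : s = t := by
  ext m
  induction m using (Finite.to_wellFoundedGT (α := Q₀)).induction with
  | ind m ih =>
    have h1 : s.filter (m < ·) = t.filter (m < ·) := by
      ext a
      rw [Multiset.count_filter, Multiset.count_filter]
      split_ifs with ha
      · exact ih a ha
      · rfl
    have h2 := h m
    rw [countP_le_eq, countP_le_eq, Multiset.countP_eq_card_filter (p := (m < ·)), h1,
      ← Multiset.countP_eq_card_filter] at h2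
    omega

/-- The number of common upper bounds of `j` and `k` in `Λ`. -/
noncomputable def upperCount (Λ : Set Q₀) (j k : Q₀) : ℕ := {m | m ∈ Λ ∧ j ≤ m ∧ k ≤ m}.ncard

theorem upperCount_comm (Λ : Set Q₀) (j k : Q₀) : upperCount Λ j k = upperCount Λ k j := by
  unfold upperCount
  congr 1
  ext m
  simp only [Set.mem_ofPred_eq]
  tauto

end Multiset

/-! ### Quasi-hereditary algebras: weights and truncation of filtrations -/

section

variable {K : Type u} [Field K] {A : Type v} [Ring A] [Algebra K A]
  {Q₀ : Type w} [PartialOrder Q₀] [Fintype Q₀] {e : Q₀ → A}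

/-- `N` is generated by lifts of the generators of its standard subquotients, and these lifts can be
chosen with weights in `s`. -/
theorem Filtered.le_of_weights {M : Type x} [AddCommGroup M] [Module A M]
    (hc : CompleteOrthogonalIdempotents e)
    {N V : Submodule A M} {s : Multiset Q₀} (h : Filtered (Standard K e) ⊥ N s)
    (hV : ∀ l ∈ s, ∀ n ∈ N, e l • n ∈ V) : N ≤ V := by
  induction h with
  | refl => exact bot_le
  | @step N N' s k hN hs ih =>
    obtain ⟨hle, f, hf, hker⟩ := hs
    have h1 : N ≤ V := ih fun l hl n hn => hV l (Multiset.mem_cons_of_mem hl) n (hle hn)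
    intro m hm
    obtain ⟨g, hg⟩ := hf (standardGen K e k)
    obtain ⟨a, ha⟩ := exists_smul_standardGen (hc.idem k) (f ⟨m, hm⟩)
    have h2 : f (⟨m, hm⟩ - a • e k • g) = 0 := by
      rw [map_sub, map_smul, map_smul, hg, weight_standardGen (hc.idem k), ha, sub_self]
    have h3 : m - a • e k • (g : M) ∈ N := (hker _).1 h2
    have h4 := add_mem (h1 h3) (V.smul_mem a (hV k (Multiset.mem_cons_self ..) g g.2))
    simpa using h4

open Classical in
theorem IsQuasiHereditary.exists_filtered (hQ : IsQuasiHereditary K e) (k : Q₀) :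
    ∃ s : Multiset Q₀, Filtered (Standard K e) (⊥ : Submodule A (P e k)) ⊤ s ∧
      (∀ j ∈ s, k ≤ j) ∧ s.count k = 1 := by
  obtain ⟨F, h1, h2⟩ := hQ.projective k
  obtain ⟨s, hs, hc⟩ := F.filtered
  refine ⟨s, hs, fun j hj => ?_, by rw [hc, h2]⟩
  by_contra h
  have := h1 j h
  rw [← hc, Multiset.count_eq_zero] at this
  exact this hj

end

section QuasiHereditary

variable {K : Type u} [Field K] {A : Type v} [Ring A] [Algebra K A] [Module.Finite K A]
  {Q₀ : Type w} [PartialOrder Q₀] [Fintype Q₀] {e : Q₀ → A}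

theorem standardGen_ne_zero (hQ : IsQuasiHereditary K e) (i : Q₀) : standardGen K e i ≠ 0 := by
  intro h
  have h1 := hQ.standard_self i
  have := finite_standard (K := K) (e := e) i
  have h2 : mult K e (Standard K e i) i = 0 := mult_eq_zero_iff.2 fun m => by
    obtain ⟨a, rfl⟩ := exists_smul_standardGen (hQ.complete.idem i) m
    rw [h, smul_zero, smul_zero]
  omega

theorem standardKernel_le_rad (hQ : IsQuasiHereditary K e) (i : Q₀) :
    standardKernel K e i ≤ rad A (P e i) := by
  have := isNoetherian_of_finite K (A := A) A
  have := isArtinian_of_finite K (A := A) A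
  refine hQ.le_rad fun h => standardGen_ne_zero hQ i ?_
  exact (Submodule.Quotient.mk_eq_zero _).2 (h ▸ Submodule.mem_top)

theorem exists_weight_S (hQ : IsQuasiHereditary K e) (i : Q₀) :
    ∃ m : S e i, e i • m = m ∧ m ≠ 0 := by
  have := isNoetherian_of_finite K (A := A) A
  have := isArtinian_of_finite K (A := A) A
  refine ⟨(rad A (P e i)).mkQ (gen e i), ?_, fun h0 => ?_⟩
  · rw [← map_smul, weight_gen (hQ.complete.idem i)]
  · have h1 : gen e i ∈ rad A (P e i) := (Submodule.Quotient.mk_eq_zero _).1 h0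
    exact (hQ.isCoatom_rad i).1 (eq_top_of_gen_mem (hQ.complete.idem i) h1)

theorem le_of_weight_S (hQ : IsQuasiHereditary K e) {i l : Q₀} {m : S e i} (hm : e l • m ≠ 0) :
    l ≤ i := by
  by_contra hl
  apply hm
  obtain ⟨m, rfl⟩ := Submodule.mkQ_surjective _ m
  have h1 : e l • m ∈ standardKernel K e i := by
    rw [standardKernel_eq]
    exact smul_mem_trace (Λ := Set.Iic i) (by simpa using hl) Submodule.mem_top
  rw [← map_smul]
  exact (Submodule.Quotient.mk_eq_zero _).2 (standardKernel_le_rad hQ i h1)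

/-- `S(i)` is a quotient of `Δ(i)`, so it has weight `i` and otherwise only smaller weights.
Antisymmetry of the order then separates the simples. -/
theorem S_injective (hQ : IsQuasiHereditary K e) {i l : Q₀} (φ : S e i ≃ₗ[A] S e l) : i = l := by
  have key : ∀ {i l : Q₀}, (S e i ≃ₗ[A] S e l) → i ≤ l := by
    intro i l φ
    obtain ⟨m, h1, h2⟩ := exists_weight_S hQ i
    refine le_of_weight_S hQ (m := φ m) ?_
    rw [← map_smul, h1]
    exact (LinearEquiv.map_ne_zero_iff φ).2 h2
  exact le_antisymm (key φ) (key φ.symm)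

theorem weight_S (hQ : IsQuasiHereditary K e) {i l : Q₀} (h : l ≠ i) (m : S e i) :
    e l • m = 0 := by
  have := isNoetherian_of_finite K (A := A) A
  have := isArtinian_of_finite K (A := A) A
  by_contra hm
  have := hQ.isSimpleModule_S i
  obtain ⟨φ⟩ := hQ.nonempty_equiv_S_of_weight hm
  exact h (S_injective hQ φ).symm

theorem weight_of_isSimpleModule (hQ : IsQuasiHereditary K e) {M : Type x} [AddCommGroup M]
    [Module A M] [IsSimpleModule A M] {o l : Q₀} {m : M} (hm : e o • m ≠ 0) (hl : l ≠ o) (n : M) :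
    e l • n = 0 := by
  have := isNoetherian_of_finite K (A := A) A
  have := isArtinian_of_finite K (A := A) A
  obtain ⟨φ⟩ := hQ.nonempty_equiv_S_of_weight hm
  rw [← LinearEquiv.map_eq_zero_iff φ, map_smul]
  exact weight_S hQ hl _

/-- The kernel of `P(k) → Δ(k)` is generated by its elements of weights `> k`, because a
`Δ`-filtration of `P(k)` has `Δ(k)` on top and only larger labels below. -/
theorem standardKernel_le (hQ : IsQuasiHereditary K e) {k : Q₀} {V : Submodule A (P e k)}
    (hV : ∀ l, k < l → ∀ n ∈ standardKernel K e k, e l • n ∈ V) : standardKernel K e k ≤ V := by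
  classical
  have := isNoetherian_of_finite K (A := A) A
  have := isArtinian_of_finite K (A := A) A
  obtain ⟨s, hs, hle, hcount⟩ := hQ.exists_filtered k
  generalize htop : (⊤ : Submodule A (P e k)) = T at hs
  cases hs with
  | refl => simp at hcount
  | @step N _ s k' hN hs =>
    subst htop
    obtain ⟨-, f, hf, hker⟩ := hs
    let f' : P e k →ₗ[A] Standard K e k' := f.comp Submodule.topEquiv.symm.toLinearMap
    have hf' : Function.Surjective f' := hf.comp Submodule.topEquiv.symm.surjective
    have hker' : ∀ m, f' m = 0 ↔ m ∈ N := fun m => hker _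
    -- The top subquotient `Δ(k')` makes `S(k')` a quotient of the local module `P(k)`, whose only
    -- simple quotient is `S(k)`.
    have hk : k' = k := by
      let q : Standard K e k' →ₗ[A] S e k' := Submodule.factor (standardKernel_le_rad hQ k')
      have hq : Function.Surjective q := Submodule.factor_surjective (standardKernel_le_rad hQ k')
      have := hQ.isSimpleModule_S k'
      obtain ⟨φ⟩ := hQ.nonempty_equiv_S (q.comp f') (fun h0 => by
        have hn := IsSimpleModule.nontrivial A (S e k')
        obtain ⟨m, hm⟩ := exists_ne (0 : S e k')
        obtain ⟨p, rfl⟩ := (hq.comp hf') m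
        exact hm (LinearMap.congr_fun h0 p))
      exact S_injective hQ φ
    subst hk
    -- One inclusion holds since `Δ(k')` has no weights `≰ k'`. Equality follows because both
    -- submodules have a quotient isomorphic to `Δ(k')`, hence equal dimension vectors.
    have hU : standardKernel K e k' = N := by
      have := finite_submodule (K := K) (P e k')
      have h1 : standardKernel K e k' ≤ N := by
        rw [standardKernel_eq]
        refine trace_le.2 fun l hl n _ => (hker' _).1 ?_
        rw [map_smul]
        exact weight_standard hl _
      refine eq_of_le_of_mult_le (K := K) hQ.complete h1 fun j => ?_
      have h2 := mult_eq_add_quotient (K := K) (hQ.complete.idem j) (standardKernel K e k')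
      have h3 := mult_exact (K := K) (hQ.complete.idem j) N.subtype N.injective_subtype f' hf'
        (fun n => by rw [hker']; simp)
      change _ = _ + mult K e (Standard K e k') j at h2
      omega
    rw [hU] at hV ⊢
    refine hN.le_of_weights hQ.complete fun l hl n hn => hV l (lt_of_le_of_ne ?_ ?_) n hn
    · exact hle l (Multiset.mem_cons_of_mem hl)
    · rintro rfl
      rw [Multiset.count_cons_self] at hcount
      have := Multiset.count_pos.2 hl
      omega

open Classical in
/-- Factoring out the trace of the vertices outside a lower set removes precisely the standard
subquotients at these vertices. -/
theorem Filtered.trace (hQ : IsQuasiHereditary K e) {M : Type x} [AddCommGroup M] [Module A M]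
    {Λ : Set Q₀} (hΛ : IsLowerSet Λ) {N : Submodule A M} {s : Multiset Q₀}
    (h : Filtered (Standard K e) ⊥ N s) :
    Filtered (Standard K e) (trace e Λ N) N (s.filter (· ∈ Λ)) := by
  induction h with
  | refl =>
    have : OneQH.trace e Λ (⊥ : Submodule A M) = ⊥ := le_bot_iff.1 (trace_le_self _)
    rw [this]
    exact .refl
  | @step N N' s k hN hs ih =>
    obtain ⟨hle, f, hf, hker⟩ := id hs
    by_cases hk : k ∈ Λ
    -- For `k ∈ Λ` the subquotient `Δ(k)` has all its weights in the lower set `Λ`, so elements of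
    -- other weights already lie in `N`.
    · have h1 : OneQH.trace e Λ N' = OneQH.trace e Λ N := by
        refine le_antisymm (trace_le.2 fun l hl n hn => ?_) (trace_mono hle)
        have h2 : e l • n ∈ N := by
          refine (hker (e l • ⟨n, hn⟩)).1 ?_
          rw [map_smul]
          exact weight_standard (fun hlk => hl (hΛ hlk hk)) _
        have h3 := smul_mem_trace (e := e) hl h2
        rwa [smul_smul, (hQ.complete.idem l).eq] at h3
      rw [h1, Multiset.filter_cons_of_pos _ hk]
      exact .step ih hs
    · rw [Multiset.filter_cons_of_neg _ hk]
      obtain ⟨g, hg⟩ := hf (standardGen K e k)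
      obtain ⟨x, hx⟩ : ∃ x, x = e k • g := ⟨_, rfl⟩
      have hx1 : e k • x = x := by rw [hx, smul_smul, (hQ.complete.idem k).eq]
      have hfx : f x = standardGen K e k := by
        rw [hx, map_smul, hg, weight_standardGen (hQ.complete.idem k)]
      -- For `k ∉ Λ`, with `x` a lift of the generator: relations of `Δ(k)` are generated in weights
      -- `> k`, which are outside the lower set `Λ` too. So applying a relation to `x` gives an
      -- element of the trace of `N`.
      have hU : ∀ p ∈ standardKernel K e k, (p : A) • (x : M) ∈ OneQH.trace e Λ N := by
        have hle' : standardKernel K e k ≤ (OneQH.trace e Λ N).comap (fromP e k (x : M)) := by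
          refine standardKernel_le hQ fun l hl n hn => ?_
          rw [Submodule.mem_comap, map_smul]
          refine smul_mem_trace (fun h' => hk (hΛ hl.le h')) ?_
          rw [fromP_apply]
          refine (hker ((n : A) • x)).1 ?_
          rw [map_smul, hfx, smul_standardGen_eq_zero (hQ.complete.idem k)]
          exact hn
        exact fun p hp => hle' hp
      have hxt : (x : M) ∈ OneQH.trace e Λ N' := by
        have := smul_mem_trace (e := e) hk x.2
        rwa [← Submodule.coe_smul, hx1] at this
      have hdec : ∀ n ∈ N', ∃ a : P e k, n - (a : A) • (x : M) ∈ N := by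
        intro n hn
        obtain ⟨a, ha⟩ := exists_smul_standardGen (hQ.complete.idem k) (f ⟨n, hn⟩)
        refine ⟨a • gen e k, (hker (⟨n, hn⟩ - ((a • gen e k : P e k) : A) • x)).1 ?_⟩
        rw [map_sub, map_smul, hfx]
        change _ - (a * e k) • standardGen K e k = 0
        rw [mul_smul, weight_standardGen (hQ.complete.idem k), ha, sub_self]
      have hsup : N' = N ⊔ OneQH.trace e Λ N' := by
        refine le_antisymm (fun n hn => ?_) (sup_le hle (trace_le_self _))
        obtain ⟨a, ha⟩ := hdec n hn
        have := Submodule.add_mem_sup ha (Submodule.smul_mem (OneQH.trace e Λ N') (a : A) hxt)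
        simpa using this
      have htr : OneQH.trace e Λ N' ≤ OneQH.trace e Λ N ⊔ Submodule.span A {(x : M)} := by
        refine trace_le.2 fun l hl n hn => ?_
        obtain ⟨a, ha⟩ := hdec n hn
        have h1 := Submodule.add_mem_sup (smul_mem_trace (e := e) hl ha)
          (Submodule.smul_mem (Submodule.span A {(x : M)}) (e l * (a : A))
            (Submodule.mem_span_singleton_self _))
        rwa [smul_sub, smul_smul, sub_add_cancel] at h1
      -- The trace of `N'` is contained in the trace of `N` plus the multiples of `x`, and a
      -- multiple of `x` that lies in `N` comes from a relation of `Δ(k)`. With `hsup`, the quotient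
      -- of `N'` by its trace is that of `N`, so the label `k` disappears.
      have hinf : N ⊓ OneQH.trace e Λ N' ≤ OneQH.trace e Λ N := by
        rintro n ⟨hn, hn'⟩
        obtain ⟨t, ht, b, hb, rfl⟩ := Submodule.mem_sup.1 (htr hn')
        obtain ⟨a, rfl⟩ := Submodule.mem_span_singleton.1 hb
        refine add_mem ht ?_
        have h1 : a • (x : M) ∈ N := by
          have := sub_mem hn (trace_le_self _ ht)
          rwa [add_sub_cancel_left] at this
        have h2 : ((a • gen e k : P e k) : A) • (x : M) = a • (x : M) := by
          change (a * e k) • (x : M) = _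
          rw [mul_smul, ← Submodule.coe_smul (e k), hx1]
        rw [← h2]
        refine hU _ ?_
        rw [← smul_standardGen_eq_zero (hQ.complete.idem k), ← hfx, ← map_smul]
        exact (hker _).2 (h2.symm ▸ h1 : ((a • gen e k : P e k) : A) • (x : M) ∈ N)
      have h1 := ih.sup hinf
      rwa [sup_eq_right.2 (trace_mono hle), ← hsup] at h1

end QuasiHereditary

section

variable {K : Type u} [Field K] {A : Type v} [Ring A] [Algebra K A] {Q₀ : Type w} {e : Q₀ → A}
  {M : Type y} [AddCommGroup M] [Module A M] [Module K M] [IsScalarTower K A M]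

theorem mult_top (j : Q₀) : mult K e (⊤ : Submodule A M) j = mult K e M j :=
  mult_congr Submodule.topEquiv j

theorem mult_bot (j : Q₀) : mult K e (⊥ : Submodule A M) j = 0 :=
  (mult_eq_zero_iff (K := K) (e := e) (M := (⊥ : Submodule A M))).2 fun _ => Subsingleton.elim _ _

end

section

variable {K : Type u} [Field K] {A : Type v} [Ring A] [Algebra K A]
  {Q₀ : Type w} [PartialOrder Q₀] {e : Q₀ → A}
  {X : Q₀ → Type x} [∀ k, AddCommGroup (X k)] [∀ k, Module A (X k)]
  [∀ k, Module K (X k)] [∀ k, IsScalarTower K A (X k)]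
  {M : Type y} [AddCommGroup M] [Module A M] [Module K M] [IsScalarTower K A M]

open Classical in
theorem Filtered.mult_eq_countP [Module.Finite K M]
    (hX : ∀ m j, mult K e (X m) j = if j ≤ m then 1 else 0) {j : Q₀}
    (he : IsIdempotentElem (e j)) {N₀ N : Submodule A M} {s : Multiset Q₀}
    (h : Filtered X N₀ N s) : mult K e N j = mult K e N₀ j + s.countP (j ≤ ·) := by
  rw [h.mult_eq he]
  congr 1
  simp only [hX]
  clear h
  induction s using Multiset.induction with
  | empty => simp
  | cons a s ih =>
    rw [Multiset.map_cons, Multiset.sum_cons, ih, Multiset.countP_cons, add_comm]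

end

section

variable {K : Type u} [Field K] {A : Type v} [Ring A] [Algebra K A] [Module.Finite K A]
  {Q₀ : Type w} [PartialOrder Q₀] {e : Q₀ → A}

theorem finite_costandard (i : Q₀) : Module.Finite K (Costandard K e i) :=
  have := finite_I (K := K) (e := e) i
  finite_submodule _

theorem weight_costandard {i l : Q₀} (hl : ¬ l ≤ i) (m : Costandard K e i) : e l • m = 0 := by
  have h : (m : I K e i) ∈ cotrace e (Set.Iic i) (I K e i) :=
    costandard_eq (K := K) (e := e) i ▸ m.2
  refine Subtype.ext ?_
  simpa using h l hl 1

end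

/-! ### 1-quasi-hereditary algebras: dimension vectors, embeddings and covers -/

section OneQuasiHereditary

variable {K : Type u} [Field K] {A : Type v} [Ring A] [Algebra K A] [Module.Finite K A]
  {Q₀ : Type w} [PartialOrder Q₀] [Fintype Q₀] {e : Q₀ → A}

open Classical in
theorem mult_standard_eq (hA : IsOneQuasiHereditary K e) (m j : Q₀) :
    mult K e (Standard K e m) j = if j ≤ m then 1 else 0 := by
  split_ifs with h
  · exact hA.mult_standard m j h
  · have := finite_standard (K := K) (e := e) m
    exact mult_eq_zero_iff.2 (weight_standard h)

-- The axioms provide, for each label, possibly a different filtration. All `Δ`-filtrations of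
-- `P(k)` have the same labels, since the dimension vector determines them; so every `Δ(m)` with `m
-- ≥ k` occurs exactly once in a single filtration.
open Classical in
theorem filtered_P (hA : IsOneQuasiHereditary K e) (k : Q₀) :
    Filtered (Standard K e) (⊥ : Submodule A (P e k)) ⊤ (Finset.univ.filter (k ≤ ·)).val := by
  have := finite_submodule (K := K) (P e k)
  obtain ⟨s, hs, hle, -⟩ := hA.exists_filtered k
  have : s = (Finset.univ.filter (k ≤ ·)).val := by
    ext m
    by_cases hm : k ≤ m
    · rw [Multiset.count_eq_one_of_mem (Finset.nodup _) (by simpa using hm)]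
      obtain ⟨F, hF⟩ := hA.mult_projective m k hm
      obtain ⟨t, ht, hc⟩ := F.filtered
      have hst : s = t := multiset_eq_of_countP_le fun j => by
        have h1 := hs.mult_eq_countP (mult_standard_eq hA) (hA.complete.idem j)
        have h2 := ht.mult_eq_countP (mult_standard_eq hA) (hA.complete.idem j)
        omega
      rw [hst, hc, hF]
    · rw [Multiset.count_eq_zero_of_notMem (fun h => hm (hle m h)),
        Multiset.count_eq_zero_of_notMem (by simpa using hm)]
  exact this ▸ hs

open Classical in
theorem filtered_P_trace (hA : IsOneQuasiHereditary K e) {Λ : Set Q₀} (hΛ : IsLowerSet Λ)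
    (k : Q₀) : Filtered (Standard K e) (trace e Λ (⊤ : Submodule A (P e k))) ⊤
      (Finset.univ.filter fun m => k ≤ m ∧ m ∈ Λ).val := by
  have h := (filtered_P hA k).trace hA.toIsQuasiHereditary hΛ
  rwa [← Finset.filter_val, Finset.filter_filter] at h

/-- The quotient is filtered by the `Δ(m)` with `k ≤ m` and `m ∈ Λ`, and such a `Δ(m)` contributes
one dimension at `j` exactly when `j ≤ m`. -/
theorem mult_quotient_trace (hA : IsOneQuasiHereditary K e) {Λ : Set Q₀} (hΛ : IsLowerSet Λ)
    (k j : Q₀) :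
    mult K e (P e k ⧸ trace e Λ (⊤ : Submodule A (P e k))) j = upperCount Λ k j := by
  classical
  have := finite_submodule (K := K) (P e k)
  have h1 := (filtered_P_trace hA hΛ k).mult_eq_countP (mult_standard_eq hA) (hA.complete.idem j)
  have h2 := mult_eq_add_quotient (K := K) (hA.complete.idem j)
    (trace e Λ (⊤ : Submodule A (P e k)))
  rw [mult_top] at h1
  rw [Multiset.countP_eq_card_filter, ← Finset.filter_val, Finset.card_val,
    Finset.filter_filter] at h1
  have h3 : upperCount Λ k j = (Finset.univ.filter fun m => (k ≤ m ∧ m ∈ Λ) ∧ j ≤ m).card := by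
    rw [upperCount, ← Set.ncard_coe_finset]
    congr 1
    ext m
    simp
    tauto
  omega

theorem mult_P (hA : IsOneQuasiHereditary K e) (k j : Q₀) :
    mult K e (P e k) j = upperCount Set.univ k j := by
  rw [← mult_quotient_trace hA isLowerSet_univ k j]
  have : trace e Set.univ (⊤ : Submodule A (P e k)) = ⊥ :=
    le_bot_iff.1 (trace_le.2 fun l hl => absurd trivial hl)
  exact mult_congr (Submodule.quotEquivOfEqBot _ this).symm j

theorem mult_cotrace_I (hA : IsOneQuasiHereditary K e) {Λ : Set Q₀} (hΛ : IsLowerSet Λ)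
    (k j : Q₀) : mult K e (cotrace e Λ (I K e k)) j = upperCount Λ k j := by
  rw [mult_cotrace (hA.complete.idem k) (hA.complete.idem j), mult_quotient_trace hA hΛ,
    upperCount_comm]

theorem mult_I (hA : IsOneQuasiHereditary K e) (k j : Q₀) :
    mult K e (I K e k) j = upperCount Set.univ k j := by
  rw [← mult_cotrace_I hA isLowerSet_univ]
  have : cotrace e Set.univ (I K e k) = ⊤ :=
    top_le_iff.1 fun m _ l hl => absurd trivial hl
  rw [this, mult_top]

-- `∇(m)` is a cotrace in `I(m)`, so its dimensions count common upper bounds of `m` and `j` below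
-- `m`, and only `m` itself can be one.
open Classical in
theorem mult_costandard_eq (hA : IsOneQuasiHereditary K e) (m j : Q₀) :
    mult K e (Costandard K e m) j = if j ≤ m then 1 else 0 := by
  have h1 : mult K e (Costandard K e m) j = upperCount (Set.Iic m) m j := by
    rw [← mult_cotrace_I hA (isLowerSet_Iic m)]
    exact mult_congr (LinearEquiv.ofEq _ _ (costandard_eq m)) j
  rw [h1, upperCount]
  split_ifs with h
  · rw [Set.ncard_eq_one]
    refine ⟨m, Set.ext fun a => ?_⟩
    simp only [Set.mem_Iic, Set.mem_ofPred_eq, Set.mem_singleton_iff]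
    exact ⟨fun ha => le_antisymm ha.1 ha.2.1, fun ha => by subst ha; exact ⟨le_rfl, le_rfl, h⟩⟩
  · rw [Set.ncard_eq_zero]
    refine Set.eq_empty_of_forall_notMem fun a ha => h ?_
    simp only [Set.mem_Iic, Set.mem_ofPred_eq] at ha
    exact ha.2.2.trans ha.1

theorem isCogenerated_P (hA : IsOneQuasiHereditary K e) {o : Q₀} (ho : IsBot o) (j : Q₀) :
    IsCogenerated e o (P e j) := by
  have := isNoetherian_of_finite K (A := A) A
  have := isArtinian_of_finite K (A := A) A
  obtain ⟨φ⟩ := hA.soc_projective o ho j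
  exact hA.isCogenerated_of_equiv φ

theorem isGenerated_I (hA : IsOneQuasiHereditary K e) {o : Q₀} (ho : IsBot o) (j : Q₀) :
    IsGenerated e o (I K e j) := by
  have := isNoetherian_of_finite K (A := A) A
  have := isArtinian_of_finite K (A := A) A
  have := finite_I (K := K) (e := e) j
  have := isNoetherian_of_finite K (A := A) (I K e j)
  obtain ⟨φ⟩ := hA.top_injective o ho j
  exact hA.isGenerated_of_equiv φ

theorem nontrivial_standard (hA : IsOneQuasiHereditary K e) (i : Q₀) :
    Nontrivial (Standard K e i) :=
  ⟨⟨_, _, standardGen_ne_zero hA.toIsQuasiHereditary i⟩⟩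

theorem nontrivial_costandard (hA : IsOneQuasiHereditary K e) (i : Q₀) :
    Nontrivial (Costandard K e i) := by
  classical
  by_contra h
  rw [not_nontrivial_iff_subsingleton] at h
  have := finite_costandard (K := K) (e := e) i
  have h1 := mult_costandard_eq hA i i
  rw [if_pos le_rfl, mult_eq_zero_iff.2 fun m => Subsingleton.elim _ _] at h1
  exact zero_ne_one h1

/-- For the largest vertex `t` one has `Δ(t) = P(t)`, with simple socle, and every `Δ(i)` embeds
there. -/
theorem isCogenerated_standard (hA : IsOneQuasiHereditary K e) {o : Q₀} (ho : IsBot o) (i : Q₀) :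
    IsCogenerated e o (Standard K e i) := by
  obtain ⟨t, ht⟩ := hA.exists_largest
  obtain ⟨f, hf⟩ := hA.standard_embeds t ht i
  have h1 : standardKernel K e t = ⊥ := by
    rw [standardKernel_eq]
    exact le_bot_iff.1 (trace_le.2 fun l hl => absurd (ht l) hl)
  have := nontrivial_standard hA i
  have := nontrivial_standard hA t
  exact ((isCogenerated_P hA ho t).of_injective
    (Submodule.quotEquivOfEqBot _ h1).toLinearMap (LinearEquiv.injective _)).of_injective f hf

theorem isGenerated_costandard (hA : IsOneQuasiHereditary K e) {o : Q₀} (ho : IsBot o) (i : Q₀) :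
    IsGenerated e o (Costandard K e i) := by
  obtain ⟨t, ht⟩ := hA.exists_largest
  obtain ⟨f, hf⟩ := hA.costandard_covers t ht i
  have h1 : costandard K e t = ⊤ := by
    rw [costandard_eq]
    exact top_le_iff.1 fun m _ l hl => absurd (ht l) hl
  have := nontrivial_costandard hA i
  have := nontrivial_costandard hA t
  exact ((isGenerated_I hA ho t).of_surjective
    (LinearEquiv.ofTop _ h1).symm.toLinearMap (LinearEquiv.surjective _)).of_surjective f hf

theorem exists_nonzero_weight_standard (hA : IsOneQuasiHereditary K e) {i j : Q₀} (h : j ≤ i) :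
    ∃ m : Standard K e i, e j • m = m ∧ m ≠ 0 := by
  have := finite_standard (K := K) (e := e) i
  have h1 := hA.mult_standard i j h
  by_contra! h2
  rw [mult_eq_zero_iff.2 fun m => h2 (e j • m)
    (by rw [smul_smul, (hA.complete.idem j).eq])] at h1
  exact zero_ne_one h1

/-- An element of weight `j` of a standard module generates a submodule with weights `≤ j`. -/
theorem mem_cotrace_of_weight (hA : IsOneQuasiHereditary K e) {i j : Q₀} {m : Standard K e i}
    (hm : e j • m = m) : m ∈ cotrace e (Set.Iic j) (Standard K e i) := by
  obtain ⟨t, ht⟩ := hA.exists_largest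
  obtain ⟨f, hf⟩ := hA.standard_embeds t ht i
  obtain ⟨g, hg⟩ := hA.standard_embeds t ht j
  have := finite_standard (K := K) (e := e) t
  -- Inside `Δ(t)` the weight `j` is one-dimensional, so the image of `m` is a multiple of the image
  -- of the generator of `Δ(j)`.
  obtain ⟨c, hc⟩ := exists_smul_eq_of_mult_le_one (K := K) (hA.complete.idem j)
    (hA.mult_standard t j (ht j)).le (m := g (standardGen K e j)) (n := f m)
    (by rw [← map_smul, weight_standardGen (hA.complete.idem j)])
    ((map_ne_zero_iff g hg).2 (standardGen_ne_zero hA.toIsQuasiHereditary j))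
    (by rw [← map_smul, hm])
  intro l hl a
  refine (map_eq_zero_iff f hf).1 ?_
  rw [map_smul, map_smul, ← hc, smul_comm a c, smul_comm (e l) c, ← map_smul, ← map_smul,
    weight_standard hl, map_zero, smul_zero]

/-- Send the generator of `Δ(j)` to a nonzero element of weight `j`. Up to a scalar, the composite
with `Δ(i) → Δ(t)` is the given embedding of `Δ(j)`, so relations satisfied by the image already
hold in `Δ(j)`. -/
theorem exists_injective_standard (hA : IsOneQuasiHereditary K e) {i j : Q₀} (h : j ≤ i) :
    ∃ f : Standard K e j →ₗ[A] Standard K e i, Function.Injective f := by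
  obtain ⟨t, ht⟩ := hA.exists_largest
  obtain ⟨f, hf⟩ := hA.standard_embeds t ht i
  obtain ⟨g, hg⟩ := hA.standard_embeds t ht j
  have := finite_standard (K := K) (e := e) t
  obtain ⟨m, hm, hm0⟩ := exists_nonzero_weight_standard hA h
  have hj := hA.complete.idem j
  obtain ⟨c, hc⟩ := exists_smul_eq_of_mult_le_one (K := K) hj
    (hA.mult_standard t j (ht j)).le (m := f m) (n := g (standardGen K e j))
    (by rw [← map_smul, hm])
    ((map_ne_zero_iff f hf).2 hm0)
    (by rw [← map_smul, weight_standardGen hj])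
  obtain ⟨φ, hφ⟩ := exists_fromStandard (K := K) hm (mem_cotrace_of_weight hA hm)
  refine ⟨φ, (injective_iff_map_eq_zero _).2 fun n hn => ?_⟩
  obtain ⟨a, rfl⟩ := exists_smul_standardGen hj n
  refine (map_eq_zero_iff g hg).1 ?_
  rw [map_smul, hφ] at hn
  rw [map_smul, ← hc, smul_comm a c, ← map_smul, hn, map_zero, smul_zero]

/-- The kernel of `∇(t) → ∇(i)` has no weight `≤ i`, both modules being one-dimensional there. So it
is killed in `∇(j)`, and `∇(t) → ∇(j)` factors. -/
theorem exists_surjective_costandard (hA : IsOneQuasiHereditary K e) {i j : Q₀} (h : j ≤ i) :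
    ∃ f : Costandard K e i →ₗ[A] Costandard K e j, Function.Surjective f := by
  classical
  obtain ⟨t, ht⟩ := hA.exists_largest
  obtain ⟨f, hf⟩ := hA.costandard_covers t ht i
  obtain ⟨g, hg⟩ := hA.costandard_covers t ht j
  have := finite_costandard (K := K) (e := e) t
  have key : ∀ m, f m = 0 → g m = 0 := by
    intro m hm
    refine eq_zero_of_forall_smul hA.complete fun k => ?_
    by_cases hk : k ≤ j
    · rw [← map_smul, eq_zero_of_weight (K := K) (hA.complete.idem k) f hf
        (by rw [mult_costandard_eq hA, mult_costandard_eq hA, if_pos (ht k), if_pos (hk.trans h)])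
        (n := e k • m) (by rw [smul_smul, (hA.complete.idem k).eq])
        (by rw [map_smul, hm, smul_zero]), map_zero]
    · exact weight_costandard hk _
  obtain ⟨φ, hφ⟩ := exists_factor f hf g key
  refine ⟨φ, fun b => ?_⟩
  obtain ⟨a, rfl⟩ := hg b
  exact ⟨f a, hφ a⟩

/-- The simple socle `S(o)` embeds `P(o)` into `I(o)`, and the two dimension vectors agree. This
isomorphism converts statements on injectives into statements on projectives. -/
theorem nonempty_P_equiv_I (hA : IsOneQuasiHereditary K e) {o : Q₀} (ho : IsBot o) :
    Nonempty (P e o ≃ₗ[A] I K e o) := by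
  obtain ⟨f, hf⟩ := exists_injective_toI (K := K) (hA.complete.idem o) (isCogenerated_P hA ho o)
  have := finite_I (K := K) (e := e) o
  exact ⟨LinearEquiv.ofBijective f ⟨hf, surjective_of_mult_le (K := K) hA.complete f hf fun j => by
    rw [mult_I hA, mult_P hA]⟩⟩

theorem exists_injective_P (hA : IsOneQuasiHereditary K e) {o : Q₀} (ho : IsBot o) (l : Q₀) :
    ∃ f : P e l →ₗ[A] P e o, Function.Injective f := by
  obtain ⟨φ⟩ := nonempty_P_equiv_I hA ho
  obtain ⟨f, hf⟩ := exists_injective_toI (K := K) (hA.complete.idem o) (isCogenerated_P hA ho l)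
  exact ⟨φ.symm.toLinearMap.comp f, φ.symm.injective.comp hf⟩

theorem exists_surjective_I (hA : IsOneQuasiHereditary K e) {o : Q₀} (ho : IsBot o) (l : Q₀) :
    ∃ f : I K e o →ₗ[A] I K e l, Function.Surjective f := by
  obtain ⟨φ⟩ := nonempty_P_equiv_I hA ho
  obtain ⟨m, hm, -, h⟩ := isGenerated_I hA ho l
  exact ⟨(fromP e o m).comp φ.symm.toLinearMap, (fromP_surjective hm h).comp φ.symm.surjective⟩

/-- Submodules of `P(o)` isomorphic to `P(l)` contain all elements of weight `m ≥ l`. -/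
theorem weight_mem_of_injective (hA : IsOneQuasiHereditary K e)
    {o l m : Q₀} (hlm : l ≤ m) (f : P e l →ₗ[A] P e o) (hf : Function.Injective f) (p : P e o) :
    e m • p ∈ LinearMap.range f := by
  have := finite_submodule (K := K) (P e o)
  obtain ⟨q, -, hq⟩ := exists_weight_preimage (K := K) (hA.complete.idem m) f hf
    (by
      rw [mult_P hA, mult_P hA]
      -- An upper bound of `m` is automatically one of `l` and of `o`, so both modules have the same
      -- dimension at `m`.
      refine Set.ncard_le_ncard fun a ha => ?_
      exact ⟨trivial, hlm.trans ha.2.2, ha.2.2⟩)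
    (n := e m • p) (by rw [smul_smul, (hA.complete.idem m).eq])
  exact ⟨q, hq⟩

/-- Surjections `I(o) → I(l)` are injective on the elements of weight `m ≥ l`. -/
theorem weight_eq_zero_of_surjective (hA : IsOneQuasiHereditary K e)
    {o l m : Q₀} (hlm : l ≤ m) (f : I K e o →ₗ[A] I K e l) (hf : Function.Surjective f)
    {φ : I K e o} (hφ : f φ = 0) : e m • φ = 0 := by
  have := finite_I (K := K) (e := e) o
  refine eq_zero_of_weight (K := K) (hA.complete.idem m) f hf ?_
    (by rw [smul_smul, (hA.complete.idem m).eq]) (by rw [map_smul, hφ, smul_zero])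
  rw [mult_I hA, mult_I hA]
  refine Set.ncard_le_ncard fun a ha => ?_
  exact ⟨trivial, hlm.trans ha.2.2, ha.2.2⟩

/-- A copy of `P(l)` is generated by an element of weight `l`, and conversely contains every element
of weight `l` in `P(o)`. The trace is independent of any choice of embeddings. -/
theorem sumP_eq (hA : IsOneQuasiHereditary K e) {o : Q₀} (ho : IsBot o) (i : Q₀) :
    sumP e o i = trace e (Set.Iic i) ⊤ := by
  refine le_antisymm (sSup_le ?_) (trace_le.2 fun l hl p _ => ?_)
  · rintro N ⟨l, hl, ⟨φ⟩⟩ n hn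
    obtain ⟨p, hp⟩ := φ.symm.surjective ⟨n, hn⟩
    have h1 : n = (p : A) • e l • ((φ.symm (gen e l) : N) : P e o) := by
      have h2 : φ.symm p = (p : A) • e l • φ.symm (gen e l) := by
        rw [← map_smul, ← map_smul, weight_gen (hA.complete.idem l),
          smul_gen (hA.complete.idem l)]
      rw [← Submodule.coe_smul, ← Submodule.coe_smul, ← h2, hp]
    rw [h1]
    exact Submodule.smul_mem _ _ (smul_mem_trace (Λ := Set.Iic i) (by simpa using hl)
      Submodule.mem_top)
  · obtain ⟨f, hf⟩ := exists_injective_P hA ho l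
    have h1 : LinearMap.range f ≤ sumP e o i :=
      le_sSup ⟨l, by simpa using hl, ⟨(LinearEquiv.ofInjective f hf).symm⟩⟩
    exact h1 (weight_mem_of_injective hA le_rfl f hf p)

/-- A surjection `I(o) → I(l)` is injective on weight `l`, and an element of `I(l)` vanishes if none
of its multiples has a component of weight `l`. So the kernel consists of the elements whose
multiples have none. -/
theorem interKer_eq (hA : IsOneQuasiHereditary K e) {o : Q₀} (ho : IsBot o) (i : Q₀) :
    interKer K e o i = cotrace e (Set.Iic i) (I K e o) := by
  refine le_antisymm (fun φ hφ l hl a => ?_) (le_sInf ?_)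
  · obtain ⟨f, hf⟩ := exists_surjective_I hA ho l
    have h1 : interKer K e o i ≤ LinearMap.ker f :=
      sInf_le ⟨l, by simpa using hl, f, hf, rfl⟩
    exact weight_eq_zero_of_surjective hA le_rfl f hf (h1 (Submodule.smul_mem _ a hφ))
  · rintro N ⟨l, hl, f, hf, rfl⟩ φ hφ
    refine I_eq_zero fun a => ?_
    rw [← map_smul, ← map_smul, hφ l (by simpa using hl), map_zero]

end OneQuasiHereditary

/-! ### Detecting subquotients in filtrations -/

section

variable {K : Type u} [Field K] {A : Type v} [Ring A] [Algebra K A]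
  {Q₀ : Type w} [PartialOrder Q₀] {e : Q₀ → A}

theorem exists_weight_costandard {k : Q₀} {b : Costandard K e k} (hb : b ≠ 0) :
    ∃ a : A, e k • a • b ≠ 0 := by
  by_contra! h
  exact hb (Subtype.ext (I_eq_zero fun a => congrArg Subtype.val (h a)))

/-- A quotient of `Δ(j)` has no nonzero map to `∇(k)` for `k ≠ j`: a nonzero image of the generator
has weight `j`, giving `j ≤ k`, and some multiple of it has weight `k`, giving `k ≤ j`. -/
theorem weight_map_eq_zero [Module.Finite K A] {M : Type x} [AddCommGroup M] [Module A M]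
    {j k : Q₀} (hkj : k ≠ j) {m : M} (hm : e j • m = m)
    (hm' : m ∈ cotrace e (Set.Iic j) M) (f : Submodule.span A {m} →ₗ[A] Costandard K e k) :
    f ⟨m, Submodule.mem_span_singleton_self m⟩ = 0 := by
  obtain ⟨b, hb⟩ : ∃ b, b = f ⟨m, Submodule.mem_span_singleton_self m⟩ := ⟨_, rfl⟩
  rw [← hb]
  by_contra h0
  obtain ⟨a, ha⟩ := exists_weight_costandard h0
  have h1 : k ≤ j := by
    by_contra h
    refine ha ?_
    rw [hb, ← map_smul, ← map_smul]
    convert map_zero f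
    exact Subtype.ext (hm' k h a)
  have h2 : j ≤ k := by
    by_contra h
    refine h0 ?_
    have : e j • b = b := by
      rw [hb, ← map_smul]
      congr 1
      exact Subtype.ext hm
    rw [← this]
    exact weight_costandard h b
  exact hkj (le_antisymm h1 h2)

/-- A nonzero element generating a factor module of `Δ(j)` detects a subquotient `∇(j)`. -/
theorem Filtered.mem_of_weight [Module.Finite K A] {M : Type x} [AddCommGroup M] [Module A M]
    {N : Submodule A M} {s : Multiset Q₀} (h : Filtered (Costandard K e) ⊥ N s) {j : Q₀} {m : M}
    (hmN : m ∈ N) (hm : e j • m = m) (hm' : m ∈ cotrace e (Set.Iic j) M) (hm0 : m ≠ 0) :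
    j ∈ s := by
  induction h with
  | refl => exact absurd hmN hm0
  | @step N N' s k hN hs ih =>
    by_cases hkj : k = j
    · exact hkj ▸ Multiset.mem_cons_self _ _
    · obtain ⟨hle, f, hf, hker⟩ := hs
      refine Multiset.mem_cons_of_mem (ih ((hker ⟨m, hmN⟩).1 ?_))
      exact weight_map_eq_zero hkj hm hm' (f.comp (Submodule.inclusion
        ((Submodule.span_singleton_le_iff_mem _ _).2 hmN)))

end

/-! ### Socles and tops of filtered modules -/

section Filtrations

variable {K : Type u} [Field K] {A : Type v} [Ring A] [Algebra K A] [Module.Finite K A]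
  {Q₀ : Type w} [PartialOrder Q₀] [Fintype Q₀] {e : Q₀ → A}
  {M : Type x} [AddCommGroup M] [Module A M]
  {N : Submodule A M} {s : Multiset Q₀} {o : Q₀}

/-- In the first subquotient `Δ(k)` where `m` is nonzero, the simple socle `S(o)` can be reached.
Hence only `S(o)` occurs in the socle of a `Δ`-filtered module. -/
theorem Filtered.exists_smul_ne_zero (hA : IsOneQuasiHereditary K e) (ho : IsBot o)
    (h : Filtered (Standard K e) ⊥ N s) {m : M} (hm : m ∈ N) (hm0 : m ≠ 0) :
    ∃ a : A, e o • a • m ≠ 0 := by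
  induction h with
  | refl => exact absurd hm hm0
  | @step N N' s k hN hs ih =>
    obtain ⟨hle, f, hf, hker⟩ := hs
    by_cases hm1 : m ∈ N
    · exact ih hm1
    · have h1 : f ⟨m, hm⟩ ≠ 0 := fun h0 => hm1 ((hker _).1 h0)
      obtain ⟨a, ha⟩ := (isCogenerated_standard hA ho k).exists_smul_ne_zero h1
      refine ⟨a, fun h0 => ha ?_⟩
      rw [← map_smul, ← map_smul]
      exact (hker _).2 (by
        rw [Submodule.coe_smul, Submodule.coe_smul, h0]
        exact zero_mem _)

/-- Each `∇(k)` is generated in weight `o`, and generators can be lifted with that weight. Hence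
only `S(o)` occurs in the top of a `∇`-filtered module. -/
theorem Filtered.le_of_weight_bot (hA : IsOneQuasiHereditary K e) (ho : IsBot o)
    (h : Filtered (Costandard K e) ⊥ N s) {V : Submodule A M} (hV : ∀ n ∈ N, e o • n ∈ V) :
    N ≤ V := by
  induction h with
  | refl => exact bot_le
  | @step N N' s k hN hs ih =>
    obtain ⟨hle, f, hf, hker⟩ := hs
    have h1 : N ≤ V := ih fun n hn => hV n (hle hn)
    intro m hm
    obtain ⟨y, hy, -, hy'⟩ := isGenerated_costandard hA ho k
    obtain ⟨g, hg⟩ := hf y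
    obtain ⟨a, ha⟩ := hy' (f ⟨m, hm⟩)
    have h2 : f (⟨m, hm⟩ - a • e o • g) = 0 := by
      rw [map_sub, map_smul, map_smul, hg, hy, ha, sub_self]
    have h3 : m - a • e o • (g : M) ∈ N := (hker _).1 h2
    simpa using add_mem (h1 h3) (V.smul_mem a (hV g g.2))

theorem Filtered.exists_path_standard (hA : IsOneQuasiHereditary K e) (ho : IsBot o)
    (h : Filtered (Standard K e) ⊥ N s) {i : Q₀} (hi : i ∈ s) :
    ∃ m ∈ N, e i • m = m ∧ ∃ a : A, e o • a • m ≠ 0 := by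
  induction h with
  | refl => simp at hi
  | @step N N' s k hN hs ih =>
    obtain ⟨hle, f, hf, hker⟩ := hs
    rcases Multiset.mem_cons.1 hi with rfl | hi
    · obtain ⟨g, hg⟩ := hf (standardGen K e i)
      obtain ⟨a, ha⟩ := (isCogenerated_standard hA ho i).exists_smul_ne_zero
        (standardGen_ne_zero hA.toIsQuasiHereditary i)
      have hi := hA.complete.idem i
      refine ⟨_, (e i • g).2, ?_, a, fun h0 => ha ?_⟩
      · rw [Submodule.coe_smul, smul_smul, hi.eq]
      · have h1 : f (e o • a • e i • g) = 0 := (hker _).2 (by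
          rw [Submodule.coe_smul, Submodule.coe_smul, h0]
          exact zero_mem _)
        rwa [map_smul, map_smul, map_smul, hg, weight_standardGen hi] at h1
    · obtain ⟨m, hm, h⟩ := ih hi
      exact ⟨m, hle hm, h⟩

theorem Filtered.exists_path_costandard (hA : IsOneQuasiHereditary K e) (ho : IsBot o)
    (h : Filtered (Costandard K e) ⊥ N s) {i : Q₀} (hi : i ∈ s) :
    ∃ m ∈ N, e o • m = m ∧ ∃ a : A, e i • a • m ≠ 0 := by
  induction h with
  | refl => simp at hi
  | @step N N' s k hN hs ih =>
    obtain ⟨hle, f, hf, hker⟩ := hs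
    rcases Multiset.mem_cons.1 hi with rfl | hi
    · obtain ⟨y, hy, hy0, hy'⟩ := isGenerated_costandard hA ho i
      obtain ⟨g, hg⟩ := hf y
      obtain ⟨a, ha⟩ := exists_weight_costandard hy0
      refine ⟨_, (e o • g).2, ?_, a, fun h0 => ha ?_⟩
      · rw [Submodule.coe_smul, smul_smul, (hA.complete.idem o).eq]
      · have h1 : f (e i • a • e o • g) = 0 := (hker _).2 (by
          rw [Submodule.coe_smul, Submodule.coe_smul, h0]
          exact zero_mem _)
        rwa [map_smul, map_smul, map_smul, hg, hy] at h1
    · obtain ⟨m, hm, h⟩ := ih hi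
      exact ⟨m, hle hm, h⟩

/-- A nonzero map to `∇(j)` detects a subquotient `Δ(j)`. -/
theorem Filtered.mem_of_map (hA : IsOneQuasiHereditary K e)
    (h : Filtered (Standard K e) ⊥ N s) {j : Q₀} (g : M →ₗ[A] Costandard K e j) {m : M}
    (hm : m ∈ N) (hg : g m ≠ 0) : j ∈ s := by
  induction h generalizing m with
  | refl => exact absurd (by rw [(Submodule.mem_bot A).1 hm, map_zero]) hg
  | @step N N' s k hN hs ih =>
    obtain ⟨hle, f, hf, hker⟩ := hs
    -- If `g` vanishes on `N`, it induces a nonzero map from `Δ(k)` to `∇(j)`. The image of the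
    -- generator has weight `k`, so `k ≤ j`, and has a multiple of weight `j`, so `j ≤ k`.
    by_cases hn : ∃ n ∈ N, g n ≠ 0
    · obtain ⟨n, hn, hgn⟩ := hn
      exact Multiset.mem_cons_of_mem (ih hn hgn)
    · push Not at hn
      have hk := hA.complete.idem k
      obtain ⟨x, hx⟩ := hf (standardGen K e k)
      obtain ⟨a, ha⟩ := exists_smul_standardGen hk (f ⟨m, hm⟩)
      have h1 : f (⟨m, hm⟩ - a • e k • x) = 0 := by
        rw [map_sub, map_smul, map_smul, hx, weight_standardGen hk, ha, sub_self]
      have h2 := hn _ ((hker _).1 h1)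
      have h3 : g m = a • e k • g x := by
        rw [Submodule.coe_sub, map_sub, sub_eq_zero] at h2
        rw [← map_smul, ← map_smul]
        exact h2
      have h4 : e k • g x ≠ 0 := fun h0 => hg (by rw [h3, h0, smul_zero])
      have hkj : k ≤ j := by
        by_contra hkj
        exact h4 (weight_costandard hkj _)
      obtain ⟨b, hb⟩ := exists_weight_costandard h4
      have hjk : j ≤ k := by
        by_contra hjk
        refine hb ?_
        have h5 : f (e j • b • e k • x) = 0 := by
          rw [map_smul]
          exact weight_standard hjk _
        have h6 := hn _ ((hker _).1 h5)
        simpa using h6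
      rw [le_antisymm hjk hkj]
      exact Multiset.mem_cons_self _ _

-- Elements of weight `o` generating only weights `≤ o` are invisible in every `∇(k)` with `k ≠ o`.
-- So they are all seen in the single `∇(o)`, where the weight `o` is one-dimensional.
open Classical in
theorem Filtered.exists_smul_eq (hA : IsOneQuasiHereditary K e) [Module K M] [IsScalarTower K A M]
    (h : Filtered (Costandard K e) ⊥ N s) (hs : s.count o ≤ 1) {m n : M}
    (hmN : m ∈ N) (hm : e o • m = m) (hm' : m ∈ cotrace e (Set.Iic o) M) (hm0 : m ≠ 0)
    (hnN : n ∈ N) (hn : e o • n = n) (hn' : n ∈ cotrace e (Set.Iic o) M) :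
    ∃ c : K, c • m = n := by
  induction h with
  | refl => exact absurd hmN hm0
  | @step N N' s k hN hs' ih =>
    obtain ⟨hle, f, hf, hker⟩ := hs'
    by_cases hko : k = o
    · subst hko
      have hks : k ∉ s := by
        rw [Multiset.count_cons_self] at hs
        rw [← Multiset.count_eq_zero]
        omega
      -- As `∇(k)` no longer occurs in `N`, the map `f` is injective on the elements in question.
      have hz : ∀ z : N', e k • (z : M) = z → (z : M) ∈ cotrace e (Set.Iic k) M → f z = 0 →
          z = 0 := by
        intro z h1 h2 h3
        by_contra h4
        exact hks (hN.mem_of_weight ((hker z).1 h3) h1 h2 fun h => h4 (Subtype.ext h))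
      have := finite_costandard (K := K) (e := e) k
      have hfm : f ⟨m, hmN⟩ ≠ 0 := fun h0 =>
        hm0 (congrArg Subtype.val (hz ⟨m, hmN⟩ hm hm' h0))
      classical
      obtain ⟨c, hc⟩ := exists_smul_eq_of_mult_le_one (K := K) (hA.complete.idem k)
        (by rw [mult_costandard_eq hA, if_pos le_rfl]) (m := f ⟨m, hmN⟩) (n := f ⟨n, hnN⟩)
        (by rw [← map_smul]; exact congrArg f (Subtype.ext hm)) hfm
        (by rw [← map_smul]; exact congrArg f (Subtype.ext hn))
      have h1 : f (⟨n, hnN⟩ - (c • (1 : A)) • ⟨m, hmN⟩) = 0 := by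
        rw [map_sub, map_smul, smul_assoc, one_smul, hc, sub_self]
      have h2 := hz _ ?_ ?_ h1
      · refine ⟨c, ?_⟩
        have h3 := congrArg Subtype.val h2
        change n - (c • (1 : A)) • m = 0 at h3
        rw [smul_assoc, one_smul] at h3
        exact (sub_eq_zero.1 h3).symm
      · change e k • (n - (c • (1 : A)) • m) = n - (c • (1 : A)) • m
        rw [smul_assoc, one_smul, smul_sub, hn, smul_comm (e k) c, hm]
      · exact sub_mem hn' (Submodule.smul_mem _ _ hm')
    · rw [Multiset.count_cons_of_ne (Ne.symm hko)] at hs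
      have hf0 : ∀ z (hz : z ∈ N'), e o • z = z → z ∈ cotrace e (Set.Iic o) M → z ∈ N := by
        intro z hz h1 h2
        exact (hker ⟨z, hz⟩).1 (weight_map_eq_zero hko h1 h2 (f.comp (Submodule.inclusion
          ((Submodule.span_singleton_le_iff_mem _ _).2 hz))))
      exact ih hs (hf0 m hmN hm hm') (hf0 n hnN hn hn')

-- Every nonzero submodule contains a simple one, which by `hM` has weight `o`. Its elements of
-- weight `o` are of the kind governed by `Filtered.exists_smul_eq`, so any two of them are
-- proportional and lie in every nonzero submodule.
open Classical in
theorem isCogenerated_of_count (hA : IsOneQuasiHereditary K e) (ho : IsBot o) [Module K M]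
    [IsScalarTower K A M] [Module.Finite K M] [Nontrivial M]
    (hM : ∀ m : M, m ≠ 0 → ∃ a : A, e o • a • m ≠ 0)
    (h : Filtered (Costandard K e) (⊥ : Submodule A M) ⊤ s) (hs : s.count o ≤ 1) :
    IsCogenerated e o M := by
  have := isArtinian_of_finite K (A := A) M
  have key : ∀ n : M, n ≠ 0 → ∃ a : A, e o • a • n = a • n ∧ a • n ≠ 0 ∧
      a • n ∈ cotrace e (Set.Iic o) M := by
    intro n hn
    obtain ⟨U, hU, hUn⟩ := (eq_bot_or_exists_atom_le (Submodule.span A {n})).resolve_left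
      (by simpa using hn)
    have := isSimpleModule_iff_isAtom.2 hU
    obtain ⟨u, hu, hu0⟩ := Submodule.exists_mem_ne_zero_of_ne_bot hU.1
    obtain ⟨b, hb⟩ := hM u hu0
    have hmem : e o • b • u ∈ U := U.smul_mem _ (U.smul_mem _ hu)
    obtain ⟨a, ha⟩ := Submodule.mem_span_singleton.1 (hUn hmem)
    refine ⟨a, ?_, ha ▸ hb, fun l hl c => ?_⟩
    · rw [ha, smul_smul, (hA.complete.idem o).eq]
    · rw [ha]
      have hlo : l ≠ o := by
        rintro rfl
        exact hl le_rfl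
      exact congrArg Subtype.val (weight_of_isSimpleModule hA.toIsQuasiHereditary (M := U)
        (m := ⟨b • u, U.smul_mem _ hu⟩) (fun h0 => hb (congrArg Subtype.val h0)) hlo
        ⟨c • e o • b • u, U.smul_mem _ hmem⟩)
  obtain ⟨x, hx⟩ := exists_ne (0 : M)
  obtain ⟨a, h1, h2, h3⟩ := key x hx
  refine ⟨a • x, h1, h2, fun n hn => ?_⟩
  obtain ⟨b, h4, h5, h6⟩ := key n hn
  obtain ⟨c, hc⟩ := h.exists_smul_eq hA hs trivial h4 h6 h5 trivial h1 h3
  exact ⟨c • b, by rw [smul_assoc, hc]⟩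

-- Modulo the submodule generated by all weights other than `o`, only a subquotient `Δ(o)`
-- contributes, so the quotient is cyclic, say generated by `x`. Then `e o • x` generates `M`: a
-- maximal submodule containing it has a simple quotient of weight `o` by `hM`, hence contains all
-- other weights and also `x`, which is absurd.
open Classical in
theorem isGenerated_of_count (hA : IsOneQuasiHereditary K e) [IsNoetherian A M]
    [Nontrivial M] (hM : ∀ V : Submodule A M, (∀ m, e o • m ∈ V) → V = ⊤)
    (h : Filtered (Standard K e) (⊥ : Submodule A M) ⊤ s) (hs : s.count o ≤ 1) :
    IsGenerated e o M := by
  have key : ∀ (W N : Submodule A M), (∀ l ≠ o, ∀ m : M, e l • m ∈ W) →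
      ∀ s, Filtered (Standard K e) ⊥ N s → s.count o ≤ 1 →
      ∃ x, N ≤ W ⊔ Submodule.span A {x} := by
    intro W N hW s h hs
    induction h with
    | refl => exact ⟨0, bot_le⟩
    | @step N N' s k hN hs' ih =>
      obtain ⟨hle, f, hf, hker⟩ := hs'
      have hk := hA.complete.idem k
      obtain ⟨g, hg⟩ := hf (standardGen K e k)
      have hdec : ∀ m (hm : m ∈ N'), ∃ a : A, m - a • e k • (g : M) ∈ N := by
        intro m hm
        obtain ⟨a, ha⟩ := exists_smul_standardGen hk (f ⟨m, hm⟩)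
        refine ⟨a, (hker (⟨m, hm⟩ - a • e k • g)).1 ?_⟩
        rw [map_sub, map_smul, map_smul, hg, weight_standardGen hk, ha, sub_self]
      by_cases hko : k = o
      · subst hko
        have hks : k ∉ s := by
          rw [Multiset.count_cons_self] at hs
          rw [← Multiset.count_eq_zero]
          omega
        have hNW : N ≤ W := hN.le_of_weights hA.complete fun l hl n _ =>
          hW l (fun h => hks (h ▸ hl)) n
        refine ⟨e k • g, fun m hm => ?_⟩
        obtain ⟨a, ha⟩ := hdec m hm
        have := Submodule.add_mem_sup (hNW ha)
          (Submodule.smul_mem _ a (Submodule.mem_span_singleton_self (e k • (g : M))))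
        simpa using this
      · rw [Multiset.count_cons_of_ne (Ne.symm hko)] at hs
        obtain ⟨x, hx⟩ := ih hs
        refine ⟨x, fun m hm => ?_⟩
        obtain ⟨a, ha⟩ := hdec m hm
        have := add_mem (hx ha) (Submodule.mem_sup_left (Submodule.smul_mem _ a (hW k hko g)))
        simpa using this
  obtain ⟨x, hx⟩ := key (trace e {o} ⊤) ⊤
    (fun l hl m => smul_mem_trace (by simpa using hl) trivial) s h hs
  have htop : Submodule.span A {e o • x} = ⊤ := by
    by_contra hne
    obtain ⟨C, hC, hle⟩ := (eq_top_or_exists_le_coatom _).resolve_left hne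
    have := isSimpleModule_iff_isCoatom.2 hC
    obtain ⟨m, hm⟩ : ∃ m, e o • m ∉ C := by
      by_contra! h0
      exact hC.1 (hM C h0)
    have hl : ∀ l ≠ o, ∀ n, e l • n ∈ C := by
      intro l hl n
      have h1 := weight_of_isSimpleModule hA.toIsQuasiHereditary (M := M ⧸ C) (m := C.mkQ m)
        (by
          rw [← map_smul]
          exact fun h0 => hm ((Submodule.Quotient.mk_eq_zero _).1 h0)) hl (C.mkQ n)
      rw [← map_smul] at h1
      exact (Submodule.Quotient.mk_eq_zero _).1 h1
    have hxC : x ∈ C := by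
      rw [← sum_smul_eq hA.complete x]
      refine sum_mem fun j _ => ?_
      by_cases hj : j = o
      · exact hj ▸ hle (Submodule.mem_span_singleton_self _)
      · exact hl j hj x
    refine hC.1 (top_le_iff.1 (hx.trans (sup_le (trace_le.2 fun l hl' n _ => ?_) ?_)))
    · exact hl l (by simpa using hl') n
    · exact (Submodule.span_singleton_le_iff_mem _ _).2 hxC
  refine ⟨e o • x, by rw [smul_smul, (hA.complete.idem o).eq], fun h0 => ?_, fun n =>
    Submodule.mem_span_singleton.1 (htop ▸ Submodule.mem_top)⟩
  rw [h0, Submodule.span_zero_singleton] at htop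
  exact bot_ne_top htop

end Filtrations

/-! ### The tilting summand and its dimension at the smallest vertex -/

namespace IsTiltingSummand

variable {K : Type u} [Field K] {A : Type v} [Ring A] [Algebra K A]
  {Q₀ : Type w} [PartialOrder Q₀] {e : Q₀ → A} {i : Q₀}
  {M : Type x} [AddCommGroup M] [Module K M] [Module A M] [IsScalarTower K A M]

theorem nontrivial (hT : IsTiltingSummand K e i M) : Nontrivial M := hT.indecomposable.1

theorem weight_eq_zero [Module.Finite K M] (hT : IsTiltingSummand K e i M) (l : Q₀) (hl : ¬ l ≤ i)
    (m : M) : e l • m = 0 :=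
  mult_eq_zero_iff.1 (hT.mult_eq_zero l hl) m

theorem exists_standard (hT : IsTiltingSummand K e i M) :
    ∃ s : Multiset Q₀, Filtered (Standard K e) (⊥ : Submodule A M) ⊤ s ∧ i ∈ s := by
  classical
  obtain ⟨F, -, hF⟩ := hT.delta
  obtain ⟨s, hs, hc⟩ := F.filtered
  refine ⟨s, hs, Multiset.count_pos.1 ?_⟩
  rw [hc, hF]
  exact one_pos

theorem exists_costandard (hT : IsTiltingSummand K e i M) :
    ∃ s : Multiset Q₀, Filtered (Costandard K e) (⊥ : Submodule A M) ⊤ s ∧ i ∈ s := by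
  classical
  obtain ⟨F, -, hF⟩ := hT.nabla
  obtain ⟨s, hs, hc⟩ := F.filtered
  refine ⟨s, hs, Multiset.count_pos.1 ?_⟩
  rw [hc, hF]
  exact one_pos

theorem isGenerated_of_equiv [Fintype Q₀] {o : Q₀} (hA : IsOneQuasiHereditary K e)
    (hT : IsTiltingSummand K e i M) (φ : M ≃ₗ[A] (P e o ⧸ sumP e o i)) : IsGenerated e o M := by
  have := hT.nontrivial
  have hoo := hA.complete.idem o
  have h1 : IsGenerated e o (P e o) :=
    ⟨gen e o, weight_gen hoo, gen_ne_zero hA.toIsBasic o, fun n => ⟨n, smul_gen hoo n⟩⟩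
  exact h1.of_surjective (φ.symm.toLinearMap.comp (sumP e o i).mkQ)
    (φ.symm.surjective.comp (Submodule.mkQ_surjective _))

end IsTiltingSummand

section Tilting

variable {K : Type u} [Field K] {A : Type v} [Ring A] [Algebra K A] [Module.Finite K A]
  {Q₀ : Type w} [PartialOrder Q₀] [Fintype Q₀] {e : Q₀ → A} {o i : Q₀}
  {M : Type x} [AddCommGroup M] [Module A M]

theorem mult_quotient_sumP (hA : IsOneQuasiHereditary K e) (ho : IsBot o) (i j : Q₀) :
    mult K e (P e o ⧸ sumP e o i) j = upperCount (Set.Iic i) o j := by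
  rw [sumP_eq hA ho, mult_quotient_trace hA (isLowerSet_Iic i)]

theorem mult_interKer (hA : IsOneQuasiHereditary K e) (ho : IsBot o) (i j : Q₀) :
    mult K e (interKer K e o i) j = upperCount (Set.Iic i) o j := by
  rw [interKer_eq hA ho, mult_cotrace_I hA (isLowerSet_Iic i)]

theorem weight_quotient_sumP (hA : IsOneQuasiHereditary K e) (ho : IsBot o) {i l : Q₀}
    (hl : ¬ l ≤ i) (m : P e o ⧸ sumP e o i) : e l • m = 0 := by
  have h1 := sumP_eq hA ho i
  obtain ⟨m, rfl⟩ := Submodule.mkQ_surjective _ m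
  rw [← map_smul, Submodule.mkQ_apply, Submodule.Quotient.mk_eq_zero, h1]
  exact smul_mem_trace (Λ := Set.Iic i) (by simpa using hl) Submodule.mem_top

theorem exists_fromP_quotient (hA : IsOneQuasiHereditary K e) (ho : IsBot o)
    (hw : ∀ l, ¬ l ≤ i → ∀ m : M, e l • m = 0) {m : M} (hm : e o • m = m) :
    ∃ f : (P e o ⧸ sumP e o i) →ₗ[A] M, f ((sumP e o i).mkQ (gen e o)) = m := by
  refine ⟨(sumP e o i).liftQ (fromP e o m) ?_, fromP_gen hm⟩
  rw [sumP_eq hA ho]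
  refine trace_le.2 fun l hl n _ => ?_
  rw [LinearMap.mem_ker, map_smul]
  exact hw l (by simpa using hl) _

theorem exists_toInterKer (hA : IsOneQuasiHereditary K e) (ho : IsBot o)
    (hw : ∀ l, ¬ l ≤ i → ∀ m : M, e l • m = 0) (f : M →ₗ[A] I K e o) :
    ∃ g : M →ₗ[A] interKer K e o i, ∀ m, (g m : I K e o) = f m := by
  refine ⟨f.codRestrict (interKer K e o i) fun m => ?_, fun m => rfl⟩
  rw [interKer_eq hA ho]
  intro l hl a
  rw [← map_smul, ← map_smul, hw l (by simpa using hl), map_zero]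

/-- If `T` has a path from weight `i` to weight `o`, then each `∇(j)` with `j ≤ i` occurs. -/
theorem mem_of_path_standard (hA : IsOneQuasiHereditary K e) (ho : IsBot o)
    (hw : ∀ l, ¬ l ≤ i → ∀ m : M, e l • m = 0) {m : M} (hm : e i • m = m) {a : A}
    (ha : e o • a • m ≠ 0) {s : Multiset Q₀}
    (hs : Filtered (Costandard K e) (⊥ : Submodule A M) ⊤ s) {j : Q₀} (hj : j ≤ i) : j ∈ s := by
  obtain ⟨f, hf⟩ := exists_fromStandard (K := K) hm fun l hl a => hw l (by simpa using hl) _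
  -- A nonzero kernel would contain the generator `z` of the socle. The weight `o` of `Δ(i)` is
  -- one-dimensional, so `e o • a` applied to the generator is a multiple of `z`, contradicting
  -- `ha`.
  have hinj : Function.Injective f := by
    rw [injective_iff_map_eq_zero]
    intro n hn
    by_contra hn0
    obtain ⟨z, hz, hz0, hz'⟩ := isCogenerated_standard hA ho i
    obtain ⟨b, hb⟩ := hz' n hn0
    have hfz : f z = 0 := by rw [← hb, map_smul, hn, smul_zero]
    have := finite_standard (K := K) (e := e) i
    have hoo := hA.complete.idem o
    obtain ⟨c, hc⟩ := exists_smul_eq_of_mult_le_one (K := K) hoo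
      (hA.mult_standard i o (ho i)).le hz hz0 (n := e o • a • standardGen K e i)
      (by rw [smul_smul, hoo.eq])
    apply ha
    rw [← hf, ← map_smul, ← map_smul, ← hc, ← one_smul A z, ← smul_assoc, map_smul, hfz,
      smul_zero]
  obtain ⟨x, hx, hx0⟩ := exists_nonzero_weight_standard hA hj
  exact hs.mem_of_weight (m := f x) trivial (by rw [← map_smul, hx])
    (map_mem_cotrace f (mem_cotrace_of_weight hA hx)) ((map_ne_zero_iff f hinj).2 hx0)

theorem exists_surjective_of_isGenerated (hA : IsOneQuasiHereditary K e) (ho : IsBot o)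
    (hw : ∀ l, ¬ l ≤ i → ∀ m : M, e l • m = 0) (h : IsGenerated e o M) :
    ∃ f : (P e o ⧸ sumP e o i) →ₗ[A] M, Function.Surjective f := by
  obtain ⟨m, hm, -, h⟩ := h
  obtain ⟨f, hf⟩ := exists_fromP_quotient hA ho hw hm
  refine ⟨f, fun n => ?_⟩
  obtain ⟨a, rfl⟩ := h n
  exact ⟨a • (sumP e o i).mkQ (gen e o), by rw [map_smul, hf]⟩

variable [Module K M] [IsScalarTower K A M]

theorem exists_injective_of_isCogenerated (hA : IsOneQuasiHereditary K e) (ho : IsBot o)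
    (hw : ∀ l, ¬ l ≤ i → ∀ m : M, e l • m = 0) (h : IsCogenerated e o M) :
    ∃ f : M →ₗ[A] interKer K e o i, Function.Injective f := by
  obtain ⟨f, hf⟩ := exists_injective_toI (K := K) (hA.complete.idem o) h
  obtain ⟨g, hg⟩ := exists_toInterKer hA ho hw f
  exact ⟨g, fun a b hab => hf (by rw [← hg, ← hg, hab])⟩

namespace IsTiltingSummand

theorem exists_path_standard (hA : IsOneQuasiHereditary K e) (ho : IsBot o)
    (hT : IsTiltingSummand K e i M) : ∃ m : M, e i • m = m ∧ ∃ a : A, e o • a • m ≠ 0 := by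
  obtain ⟨s, hs, hi⟩ := hT.exists_standard
  obtain ⟨m, -, h⟩ := hs.exists_path_standard hA ho hi
  exact ⟨m, h⟩

theorem exists_path_costandard (hA : IsOneQuasiHereditary K e) (ho : IsBot o)
    (hT : IsTiltingSummand K e i M) : ∃ m : M, e o • m = m ∧ ∃ a : A, e i • a • m ≠ 0 := by
  obtain ⟨s, hs, hi⟩ := hT.exists_costandard
  obtain ⟨m, -, h⟩ := hs.exists_path_costandard hA ho hi
  exact ⟨m, h⟩

theorem isCogenerated_of_equiv (hA : IsOneQuasiHereditary K e) (ho : IsBot o)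
    (hT : IsTiltingSummand K e i M) (φ : M ≃ₗ[A] interKer K e o i) : IsCogenerated e o M := by
  have := hT.nontrivial
  obtain ⟨ψ⟩ := nonempty_P_equiv_I hA ho
  exact (isCogenerated_P hA ho o).of_injective
    (ψ.symm.toLinearMap.comp ((interKer K e o i).subtype.comp φ.toLinearMap))
    (ψ.symm.injective.comp (Subtype.val_injective.comp φ.injective))

end IsTiltingSummand

variable [Module.Finite K M]

/-- If `T` has a path from weight `o` to weight `i`, then each `Δ(j)` with `j ≤ i` occurs. -/
theorem mem_of_path_costandard (hA : IsOneQuasiHereditary K e) (ho : IsBot o)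
    (hw : ∀ l, ¬ l ≤ i → ∀ m : M, e l • m = 0) {m : M} (hm : e o • m = m) {a : A}
    (ha : e i • a • m ≠ 0) {s : Multiset Q₀}
    (hs : Filtered (Standard K e) (⊥ : Submodule A M) ⊤ s) {j : Q₀} (hj : j ≤ i) : j ∈ s := by
  obtain ⟨φ, hφ⟩ : ∃ φ : Module.Dual K M, φ (e i • a • m) ≠ 0 := by
    by_contra! h
    exact ha ((Module.forall_dual_apply_eq_zero_iff K _).1 h)
  obtain ⟨f, hf⟩ : ∃ f : M →ₗ[A] Costandard K e i, ∀ n, (f n : I K e i) =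
      toI (hA.complete.idem i) φ n := by
    refine ⟨(toI (hA.complete.idem i) φ).codRestrict (costandard K e i) fun n => ?_, fun n => rfl⟩
    rw [costandard_eq]
    intro l hl b
    rw [← map_smul, ← map_smul, hw l (by simpa using hl), map_zero]
  have hfm : f m ≠ 0 := by
    intro h0
    have h1 := hf m
    rw [h0, Submodule.coe_zero] at h1
    exact hφ ((toI_eq_zero (hA.complete.idem i)).1 h1.symm a)
  -- `∇(i)` is generated by its one-dimensional weight `o`, and `f m` is a nonzero element there.
  have hsurj : Function.Surjective f := by
    classical
    obtain ⟨y, hy, -, hy'⟩ := isGenerated_costandard hA ho i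
    have := finite_costandard (K := K) (e := e) i
    obtain ⟨c, hc⟩ := exists_smul_eq_of_mult_le_one (K := K) (hA.complete.idem o)
      (by rw [mult_costandard_eq hA, if_pos (ho i)]) (m := f m) (n := y)
      (by rw [← map_smul, hm]) hfm hy
    intro n
    obtain ⟨b, rfl⟩ := hy' n
    exact ⟨b • c • m, by rw [map_smul, ← hc, ← smul_one_smul A c m, map_smul, smul_one_smul]⟩
  obtain ⟨g, hg⟩ := exists_surjective_costandard hA hj
  have := nontrivial_costandard hA j
  obtain ⟨b, hb⟩ := exists_ne (0 : Costandard K e j)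
  obtain ⟨n, rfl⟩ := (hg.comp hsurj) b
  exact hs.mem_of_map hA (g.comp f) (m := n) trivial hb

-- As `o` is least, `countP (o ≤ ·)` is the full cardinality. A multiset containing every `j ≤ i`
-- and having no more elements than there are such `j` contains each exactly once.
open Classical in
theorem eq_of_countP_le {s : Multiset Q₀} (ho : IsBot o) (hs : ∀ j ≤ i, j ∈ s)
    (h : s.countP (o ≤ ·) ≤ upperCount (Set.Iic i) o o) :
    s = (Finset.univ.filter (· ≤ i)).val := by
  symm
  refine Multiset.eq_of_le_of_card_le ((Multiset.le_iff_subset (Finset.nodup _)).2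
    fun j hj => hs j (by simpa using hj)) ?_
  have h1 : s.countP (o ≤ ·) = s.card := Multiset.countP_eq_card.2 fun j _ => ho j
  have h2 : upperCount (Set.Iic i) o o = (Finset.univ.filter (· ≤ i)).card := by
    rw [upperCount, ← Set.ncard_coe_finset]
    congr 1
    ext m
    simp [ho m]
  rw [← h1]
  exact h.trans h2.le

open Classical in
theorem countP_filter_le (ho : IsBot o) (k : Q₀) :
    (Finset.univ.filter (· ≤ i)).val.countP (k ≤ ·) = upperCount (Set.Iic i) o k := by
  rw [Multiset.countP_eq_card_filter, ← Finset.filter_val, Finset.card_val, Finset.filter_filter,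
    upperCount, ← Set.ncard_coe_finset]
  congr 1
  ext m
  simp [ho m]

namespace IsTiltingSummand

/-- The bound at `o` leaves room for each `Δ(j)` and each `∇(j)`, `j ≤ i`, exactly once, while the
two paths force all of them to occur. The multiplicity one of `∇(o)` yields the simple socle, that
of `Δ(o)` the simple top, and the labels give the dimension vector. -/
theorem of_mult_le (hA : IsOneQuasiHereditary K e) (ho : IsBot o)
    (hT : IsTiltingSummand K e i M) (h : mult K e M o ≤ upperCount (Set.Iic i) o o) :
    IsCogenerated e o M ∧ IsGenerated e o M ∧
      ∀ k, mult K e M k = upperCount (Set.Iic i) o k := by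
  classical
  have := hT.nontrivial
  have := isNoetherian_of_finite K (A := A) M
  obtain ⟨s, hs, hi⟩ := hT.exists_standard
  obtain ⟨t, ht, hi'⟩ := hT.exists_costandard
  obtain ⟨m, hm, a, ha⟩ := hT.exists_path_standard hA ho
  obtain ⟨n, hn, b, hb⟩ := hT.exists_path_costandard hA ho
  have hsm : ∀ k, mult K e M k = s.countP (k ≤ ·) := fun k => by
    rw [← mult_top, hs.mult_eq_countP (mult_standard_eq hA) (hA.complete.idem k), mult_bot,
      zero_add]
  have htm : ∀ k, mult K e M k = t.countP (k ≤ ·) := fun k => by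
    rw [← mult_top, ht.mult_eq_countP (mult_costandard_eq hA) (hA.complete.idem k), mult_bot,
      zero_add]
  have hs' := eq_of_countP_le ho
    (fun j hj => mem_of_path_costandard hA ho hT.weight_eq_zero hn hb hs hj) (hsm o ▸ h)
  have ht' := eq_of_countP_le ho
    (fun j hj => mem_of_path_standard hA ho hT.weight_eq_zero hm ha ht hj) (htm o ▸ h)
  refine ⟨isCogenerated_of_count hA ho (fun m hm => hs.exists_smul_ne_zero hA ho trivial hm) ht
    (ht' ▸ Multiset.nodup_iff_count_le_one.1 (Finset.nodup _) o),
    isGenerated_of_count hA (fun V hV => top_le_iff.1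
      (ht.le_of_weight_bot hA ho fun n _ => hV n)) hs
    (hs' ▸ Multiset.nodup_iff_count_le_one.1 (Finset.nodup _) o), fun k => ?_⟩
  rw [hsm k, hs', countP_filter_le ho]

/-- A simple socle `S(o)` embeds `T` into `I(o)`, and the weights of `T` force the image into the
intersection of kernels, whose dimension at `o` is the bound. -/
theorem of_isCogenerated (hA : IsOneQuasiHereditary K e) (ho : IsBot o)
    (hT : IsTiltingSummand K e i M) (h : IsCogenerated e o M) :
    mult K e M o ≤ upperCount (Set.Iic i) o o := by
  obtain ⟨f, hf⟩ := exists_injective_of_isCogenerated hA ho hT.weight_eq_zero h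
  have := finite_I (K := K) (e := e) o
  have := finite_submodule (K := K) (interKer K e o i)
  rw [← mult_interKer hA ho]
  exact mult_le_of_injective f hf o

theorem of_isGenerated (hA : IsOneQuasiHereditary K e) (ho : IsBot o)
    (hT : IsTiltingSummand K e i M) (h : IsGenerated e o M) :
    mult K e M o ≤ upperCount (Set.Iic i) o o := by
  obtain ⟨f, hf⟩ := exists_surjective_of_isGenerated hA ho hT.weight_eq_zero h
  have := finite_submodule (K := K) (P e o)
  have := finite_quotient (K := K) (sumP e o i)
  rw [← mult_quotient_sumP hA ho]
  exact mult_le_of_surjective (hA.complete.idem o) f hf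

theorem nonempty_equiv_interKer (hA : IsOneQuasiHereditary K e) (ho : IsBot o)
    (hT : IsTiltingSummand K e i M) (h : mult K e M o ≤ upperCount (Set.Iic i) o o) :
    Nonempty (M ≃ₗ[A] interKer K e o i) := by
  obtain ⟨h1, -, h2⟩ := hT.of_mult_le hA ho h
  obtain ⟨f, hf⟩ := exists_injective_of_isCogenerated hA ho hT.weight_eq_zero h1
  have := finite_I (K := K) (e := e) o
  have := finite_submodule (K := K) (interKer K e o i)
  exact ⟨LinearEquiv.ofBijective f ⟨hf, surjective_of_mult_le (K := K) hA.complete f hf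
    fun j => by rw [mult_interKer hA ho, h2]⟩⟩

theorem nonempty_equiv_quotient (hA : IsOneQuasiHereditary K e) (ho : IsBot o)
    (hT : IsTiltingSummand K e i M) (h : mult K e M o ≤ upperCount (Set.Iic i) o o) :
    Nonempty (M ≃ₗ[A] (P e o ⧸ sumP e o i)) := by
  obtain ⟨-, h1, h2⟩ := hT.of_mult_le hA ho h
  obtain ⟨f, hf⟩ := exists_surjective_of_isGenerated hA ho hT.weight_eq_zero h1
  have := finite_submodule (K := K) (P e o)
  have := finite_quotient (K := K) (sumP e o i)
  exact ⟨(LinearEquiv.ofBijective f ⟨injective_of_mult_le (K := K) hA.complete f hf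
    fun j => by rw [mult_quotient_sumP hA ho, h2], hf⟩).symm⟩

theorem isCogenerated_iff (hA : IsOneQuasiHereditary K e) (ho : IsBot o)
    (hT : IsTiltingSummand K e i M) : IsCogenerated e o M ↔ IsSimpleModule A (soc A M) := by
  refine ⟨fun h => h.isSimpleModule_soc, fun h => ?_⟩
  have := isArtinian_of_finite K (A := A) M
  obtain ⟨s, hs, -⟩ := hT.exists_standard
  exact isCogenerated_of_isSimpleModule_soc (hA.complete.idem o) h
    fun m hm => hs.exists_smul_ne_zero hA ho trivial hm

theorem isGenerated_iff (hA : IsOneQuasiHereditary K e) (ho : IsBot o)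
    (hT : IsTiltingSummand K e i M) : IsGenerated e o M ↔ IsSimpleModule A (Top A M) := by
  have := isNoetherian_of_finite K (A := A) A
  have := isArtinian_of_finite K (A := A) A
  have := isNoetherian_of_finite K (A := A) M
  refine ⟨fun h => hA.isSimpleModule_top h, fun h => ?_⟩
  obtain ⟨s, hs, -⟩ := hT.exists_costandard
  refine isGenerated_of_isSimpleModule_top (hA.complete.idem o) h fun N hN => ?_
  by_contra! h0
  exact hN (top_le_iff.1 (hs.le_of_weight_bot hA ho fun n _ => h0 n))

/-- If `P(o) / ∑ P(l)` has simple socle, then it is isomorphic to `T(i)`. -/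
theorem nonempty_equiv_of_isCogenerated (hA : IsOneQuasiHereditary K e) (ho : IsBot o)
    (hT : IsTiltingSummand K e i M) (h : IsCogenerated e o (P e o ⧸ sumP e o i)) :
    Nonempty (M ≃ₗ[A] (P e o ⧸ sumP e o i)) := by
  have hfin1 := finite_submodule (K := K) (P e o)
  have hfin2 := finite_quotient (K := K) (sumP e o i)
  have hfin3 := finite_I (K := K) (e := e) o
  have hfin4 := finite_submodule (K := K) (interKer K e o i)
  obtain ⟨f, hf⟩ := exists_injective_of_isCogenerated (K := K) hA ho
    (fun l hl => weight_quotient_sumP hA ho hl) h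
  -- The simple socle embeds the quotient into the intersection of kernels, which has the same
  -- dimension vector. This identification provides maps from `T` back to the quotient.
  let ψ : (P e o ⧸ sumP e o i) ≃ₗ[A] interKer K e o i :=
    LinearEquiv.ofBijective f ⟨hf, surjective_of_mult_le (K := K) hA.complete f hf
      fun j => by rw [mult_interKer hA ho, mult_quotient_sumP hA ho]⟩
  obtain ⟨m, hm, a, ha⟩ := hT.exists_path_standard hA ho
  obtain ⟨n, hn, b, hb⟩ := hT.exists_path_costandard hA ho
  obtain ⟨α, hα⟩ := exists_fromP_quotient hA ho hT.weight_eq_zero hn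
  obtain ⟨χ, hχ⟩ : ∃ χ : Module.Dual K M, χ (e o • a • m) ≠ 0 := by
    by_contra! h
    exact ha ((Module.forall_dual_apply_eq_zero_iff K _).1 h)
  obtain ⟨β', hβ'⟩ := exists_toInterKer hA ho hT.weight_eq_zero (toI (hA.complete.idem o) χ)
  let β : M →ₗ[A] (P e o ⧸ sumP e o i) := ψ.symm.toLinearMap.comp β'
  have hβm : β m ≠ 0 := by
    intro h0
    have h1 : β' m = 0 := ψ.symm.map_eq_zero_iff.1 h0
    have h2 := hβ' m
    rw [h1, Submodule.coe_zero] at h2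
    exact hχ ((toI_eq_zero _).1 h2.symm a)
  have hi := hA.complete.idem i
  -- The element `g` of weight `i` maps to a nonzero element of `T`, where weight `i` is
  -- one-dimensional. So `m` is a multiple of `α g`, and `β m ≠ 0` forces `β (α g) ≠ 0`.
  obtain ⟨g, hg⟩ : ∃ g, g = e i • b • (sumP e o i).mkQ (gen e o) := ⟨_, rfl⟩
  have hg1 : e i • g = g := by rw [hg, smul_smul, hi.eq]
  have hαg : α g = e i • b • n := by rw [hg, map_smul, map_smul, hα]
  obtain ⟨c, hc⟩ := exists_smul_eq_of_mult_le_one (K := K) hi hT.mult_self.le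
    (m := α g) (n := m) (by rw [hαg, smul_smul, hi.eq]) (hαg ▸ hb) hm
  have hβα : β (α g) ≠ 0 := by
    intro h0
    apply hβm
    rw [← hc, ← smul_one_smul A c, map_smul, h0, smul_zero]
  have hg0 : g ≠ 0 := by
    rintro rfl
    rw [map_zero, map_zero] at hβα
    exact hβα rfl
  have hmult : mult K e (P e o ⧸ sumP e o i) i ≤ 1 := by
    rw [mult_quotient_sumP hA ho, upperCount]
    refine (Set.ncard_le_one (Set.toFinite _)).2 fun x hx y hy => ?_
    exact (le_antisymm hx.1 hx.2.2).trans (le_antisymm hy.1 hy.2.2).symm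
  obtain ⟨d, hd⟩ := exists_smul_eq_of_mult_le_one (K := K) hi hmult
    (m := β (α g)) (n := g) (by rw [← map_smul, ← map_smul, hg1]) hβα hg1
  -- Weight `i` is one-dimensional in the quotient as well, so `β ∘ α` rescales `g` by a nonzero
  -- scalar, hence acts invertibly on the socle element `z`, a multiple of `g`. A nonzero kernel
  -- would contain `z`.
  have hinj : ∀ p, β (α p) = 0 → p = 0 := by
    intro p hp
    by_contra hp0
    obtain ⟨z, hz, hz0, hz'⟩ := h
    obtain ⟨r, hr⟩ := hz' p hp0
    obtain ⟨q, hq⟩ := hz' g hg0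
    have h1 : β (α z) = 0 := by rw [← hr, map_smul, map_smul, hp, smul_zero]
    apply hz0
    have h2 : q • β (α g) = 0 := by rw [← map_smul, ← map_smul, hq, h1]
    rw [← hq, ← hd, smul_comm q d, h2, smul_zero]
  have hαinj : Function.Injective α := (injective_iff_map_eq_zero _).2 fun p hp =>
    hinj p (by rw [hp, map_zero])
  have hsurj : Function.Surjective (β.comp α) :=
    surjective_of_mult_le (K := K) hA.complete (β.comp α)
      ((injective_iff_map_eq_zero _).2 hinj) fun _ => le_rfl
  -- Being injective, `β ∘ α` is bijective by dimensions, so `α` splits off its image from the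
  -- indecomposable module `T`.
  have hcompl : IsCompl (LinearMap.range α) (LinearMap.ker β) := by
    refine IsCompl.of_eq (eq_bot_iff.2 ?_) (eq_top_iff.2 fun t _ => ?_)
    · rintro _ ⟨⟨p, rfl⟩, hp⟩
      rw [Submodule.mem_bot, hinj p hp, map_zero]
    · obtain ⟨p, hp⟩ := hsurj (β t)
      have h1 : t - α p ∈ LinearMap.ker β := by
        rw [LinearMap.mem_ker, map_sub, sub_eq_zero]
        exact hp.symm
      have := Submodule.add_mem_sup (LinearMap.mem_range_self α p) h1
      simpa using this
  rcases hT.indecomposable.2 _ _ hcompl with h1 | h1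
  · refine absurd ?_ hg0
    refine hinj g ?_
    have : α g ∈ (⊥ : Submodule A M) := h1 ▸ LinearMap.mem_range_self α g
    rw [(Submodule.mem_bot A).1 this, map_zero]
  · refine ⟨(LinearEquiv.ofBijective α ⟨hαinj, LinearMap.range_eq_top.1 ?_⟩).symm⟩
    have := hcompl.sup_eq_top
    rwa [h1, sup_bot_eq] at this

end IsTiltingSummand

end Tilting

/-! ### Modules over the factor algebra `A(i)` -/

section Restriction

variable {K : Type u} [Field K] {A : Type v} [Ring A] [Algebra K A]
  {Q₀ : Type w} [PartialOrder Q₀] [Fintype Q₀] {e : Q₀ → A} {i : Q₀}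

noncomputable instance : Module A (RegularDual K (FactorAlgebra e i)) :=
  Module.compHom _ (Ideal.Quotient.mk (J e i))

instance : IsScalarTower A (FactorAlgebra e i) (RegularDual K (FactorAlgebra e i)) :=
  ⟨fun a b φ => by
    obtain ⟨b, rfl⟩ := Ideal.Quotient.mk_surjective b
    exact mul_smul (Ideal.Quotient.mk (J e i) a) (Ideal.Quotient.mk (J e i) b) φ⟩

variable {M : Type x} [AddCommGroup M] [Module A M] [Module (FactorAlgebra e i) M]
  [IsScalarTower A (FactorAlgebra e i) M]
  {N : Type y} [AddCommGroup N] [Module A N] [Module (FactorAlgebra e i) N]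
  [IsScalarTower A (FactorAlgebra e i) N]

theorem mk_smul (a : A) (m : M) : Ideal.Quotient.mk (J e i) a • m = a • m := by
  have : Ideal.Quotient.mk (J e i) a = a • (1 : FactorAlgebra e i) := by
    rw [← (Ideal.Quotient.mk (J e i)).map_one]
    exact congrArg _ (mul_one a).symm
  rw [this, smul_assoc, one_smul]

theorem factorVertex_smul (j : Set.Iic i) (m : M) : factorVertex e i j • m = e j • m :=
  mk_smul _ m

theorem weight_factor (hc : CompleteOrthogonalIdempotents e) {l : Q₀} (hl : ¬ l ≤ i) (m : M) :
    e l • m = 0 := by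
  rw [← mk_smul (e := e) (i := i), Ideal.Quotient.eq_zero_iff_mem.2 (vertex_mem_J hc hl), zero_smul]

/-- An `A`-submodule of an `A(i)`-module is an `A(i)`-submodule. -/
def extendSubmodule (N : Submodule A M) : Submodule (FactorAlgebra e i) M where
  carrier := N
  add_mem' := N.add_mem
  zero_mem' := N.zero_mem
  smul_mem' b m hm := by
    obtain ⟨a, rfl⟩ := Ideal.Quotient.mk_surjective b
    rw [mk_smul]
    exact N.smul_mem a hm

/-- An `A`-linear map between `A(i)`-modules is `A(i)`-linear. -/
def extendMap (f : M →ₗ[A] N) : M →ₗ[FactorAlgebra e i] N where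
  toFun := f
  map_add' := f.map_add
  map_smul' b m := by
    obtain ⟨a, rfl⟩ := Ideal.Quotient.mk_surjective b
    rw [mk_smul, map_smul, RingHom.id_apply, mk_smul]

theorem isGenerated_factor_iff {o : Set.Iic i} :
    IsGenerated (factorVertex e i) o M ↔ IsGenerated e (o : Q₀) M := by
  unfold IsGenerated
  simp only [factorVertex_smul]
  refine exists_congr fun m => and_congr_right fun _ => and_congr_right fun _ =>
    forall_congr' fun n => ?_
  constructor
  · rintro ⟨b, hb⟩
    obtain ⟨a, rfl⟩ := Ideal.Quotient.mk_surjective b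
    exact ⟨a, by rw [← hb, mk_smul]⟩
  · rintro ⟨a, ha⟩
    exact ⟨Ideal.Quotient.mk (J e i) a, by rw [mk_smul, ha]⟩

theorem isCogenerated_factor_iff {o : Set.Iic i} :
    IsCogenerated (factorVertex e i) o M ↔ IsCogenerated e (o : Q₀) M := by
  unfold IsCogenerated
  simp only [factorVertex_smul]
  refine exists_congr fun m => and_congr_right fun _ => and_congr_right fun _ =>
    forall_congr' fun n => imp_congr_right fun _ => ?_
  constructor
  · rintro ⟨b, hb⟩
    obtain ⟨a, rfl⟩ := Ideal.Quotient.mk_surjective b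
    exact ⟨a, by rw [← hb, mk_smul]⟩
  · rintro ⟨a, ha⟩
    exact ⟨Ideal.Quotient.mk (J e i) a, by rw [mk_smul, ha]⟩

theorem mult_factor [Module K M] [IsScalarTower K A M] [IsScalarTower K (FactorAlgebra e i) M]
    (j : Set.Iic i) : mult K (factorVertex e i) M j = mult K e M (j : Q₀) := by
  have h : Algebra.lsmul K K M (factorVertex e i j) = Algebra.lsmul K K M (e j) :=
    LinearMap.ext fun m => factorVertex_smul j m
  rw [mult, mult, h]

end Restriction

/-! ### Projective and standard modules of `A(i)` -/

section Projective

variable {K : Type u} [Field K] {A : Type v} [Ring A] [Algebra K A]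
  {Q₀ : Type w} [PartialOrder Q₀] [Fintype Q₀] {e : Q₀ → A} {i : Q₀}

/-- The canonical map from `P(j)` to the corresponding projective `A(i)`-module. -/
noncomputable def projFactor (e : Q₀ → A) {i : Q₀} (j : Set.Iic i) :
    P e (j : Q₀) →ₗ[A] P (factorVertex e i) j where
  toFun p := ⟨Ideal.Quotient.mk (J e i) p, by
    obtain ⟨a, ha⟩ := Submodule.mem_span_singleton.1 p.2
    rw [← ha]
    exact Submodule.mem_span_singleton.2 ⟨Ideal.Quotient.mk (J e i) a, rfl⟩⟩
  map_add' _ _ := rfl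
  map_smul' _ _ := rfl

theorem projFactor_gen (j : Set.Iic i) : projFactor e j (gen e j) = gen (factorVertex e i) j := rfl

theorem projFactor_surjective (j : Set.Iic i) : Function.Surjective (projFactor e j) := by
  rintro ⟨p, hp⟩
  obtain ⟨b, rfl⟩ := Submodule.mem_span_singleton.1 hp
  obtain ⟨a, rfl⟩ := Ideal.Quotient.mk_surjective b
  exact ⟨a • gen e j, rfl⟩

/-- The quotient of `P(j)` by the trace has no weights `≰ i`, so `J(i)` annihilates it. Applied to
the class of the generator, this gives `P(j) ∩ J(i) ⊆` trace; the converse holds as `A(i)`-modules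
have no such weights. -/
theorem projFactor_eq_zero (hc : CompleteOrthogonalIdempotents e) {j : Set.Iic i}
    {p : P e (j : Q₀)} : projFactor e j p = 0 ↔ p ∈ trace e (Set.Iic i) ⊤ := by
  have h0 : projFactor e j p = 0 ↔ (p : A) ∈ J e i := by
    rw [← Ideal.Quotient.eq_zero_iff_mem]
    exact Subtype.ext_iff
  constructor
  · intro h
    have h1 := J_smul (e := e) (i := i)
      (M := P e (j : Q₀) ⧸ trace e (Set.Iic i) (⊤ : Submodule A (P e (j : Q₀))))
      (fun l hl m => weight_quotient_trace (Λ := Set.Iic i) (by simpa using hl) m) (h0.1 h)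
      ((trace e (Set.Iic i) ⊤).mkQ (gen e j))
    rw [← map_smul, smul_gen (hc.idem j)] at h1
    exact (Submodule.Quotient.mk_eq_zero _).1 h1
  · have : trace e (Set.Iic i) ⊤ ≤ LinearMap.ker (projFactor e j) :=
      trace_le.2 fun l hl n _ => by
        rw [LinearMap.mem_ker, map_smul]
        exact weight_factor (i := i) hc (by simpa using hl) _
    exact fun h => this h

theorem complete_factor (hc : CompleteOrthogonalIdempotents e) (i : Q₀) :
    CompleteOrthogonalIdempotents (factorVertex e i) where
  idem j := (hc.idem j).map (Ideal.Quotient.mk (J e i))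
  ortho j k hjk := by
    have h := hc.ortho (i := (j : Q₀)) (j := k) fun h => hjk (Subtype.ext h)
    change Ideal.Quotient.mk (J e i) (e j) * Ideal.Quotient.mk (J e i) (e k) = 0
    rw [← map_mul, h, map_zero]
  complete := by
    have h1 : ∑ j, Ideal.Quotient.mk (J e i) (e j) = 1 := by
      rw [← map_sum, hc.complete, map_one]
    rw [← h1]
    refine (Finset.sum_map Finset.univ (Function.Embedding.subtype (· ∈ Set.Iic i))
      (fun j => Ideal.Quotient.mk (J e i) (e j))).symm.trans ?_
    refine Finset.sum_subset (Finset.subset_univ _) fun j _ hj => ?_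
    refine Ideal.Quotient.eq_zero_iff_mem.2 (vertex_mem_J hc fun h => hj ?_)
    exact Finset.mem_map.2 ⟨⟨j, h⟩, Finset.mem_univ _, rfl⟩

variable [Module.Finite K A]

theorem finite_factor : Module.Finite K (FactorAlgebra e i) := finite_quotient _

theorem gen_factor_ne_zero (hQ : IsQuasiHereditary K e) (j : Set.Iic i) :
    gen (factorVertex e i) j ≠ 0 := by
  intro h
  rw [← projFactor_gen, projFactor_eq_zero hQ.complete] at h
  refine standardGen_ne_zero hQ j ((Submodule.Quotient.mk_eq_zero _).2 ?_)
  rw [standardKernel_eq]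
  exact trace_anti (Set.Iic_subset_Iic.2 j.2) _ h

theorem isBasic_factor (hQ : IsQuasiHereditary K e) (i : Q₀) :
    IsBasic (factorVertex e i) where
  complete := complete_factor hQ.complete i
  ne_zero j h := gen_factor_ne_zero hQ j (Subtype.ext h)
  primitive j f g hf hg hfg hgf hsum := by
    have := isNoetherian_of_finite K (A := A) A
    have := isArtinian_of_finite K (A := A) A
    let π : P e (j : Q₀) →ₗ[A] FactorAlgebra e i :=
      (J e i).mkQ.comp (P e (j : Q₀)).subtype
    -- For primitivity: the left ideals of `f` and `g` pull back to submodules of `P(j)` whose sum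
    -- is everything, and `P(j)` is local. If the pullback for `f` is everything, then `e j = b * f`
    -- in `A(i)`, so `g = e j * g = 0`.
    have key : ∀ {f g : FactorAlgebra e i}, IsIdempotentElem g → f * g = 0 →
        factorVertex e i j = f + g →
        ((Submodule.span (FactorAlgebra e i) {f}).restrictScalars A).comap π = ⊤ → g = 0 := by
      intro f g hg hfg hsum h
      have h1 : factorVertex e i j ∈ Submodule.span (FactorAlgebra e i) {f} := by
        have : gen e (j : Q₀) ∈
            ((Submodule.span (FactorAlgebra e i) {f}).restrictScalars A).comap π :=
          h ▸ Submodule.mem_top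
        exact this
      obtain ⟨b, hb⟩ := Submodule.mem_span_singleton.1 h1
      calc g = factorVertex e i j * g := by rw [hsum, add_mul, hfg, hg.eq, zero_add]
        _ = 0 := by rw [← hb, smul_eq_mul, mul_assoc, hfg, mul_zero]
    have hsup : ((Submodule.span (FactorAlgebra e i) {f}).restrictScalars A).comap π ⊔
        ((Submodule.span (FactorAlgebra e i) {g}).restrictScalars A).comap π = ⊤ := by
      refine eq_top_of_gen_mem (hQ.complete.idem j) ?_
      obtain ⟨a, rfl⟩ := Ideal.Quotient.mk_surjective f
      have hπ : ∀ a : A, π (a • gen e (j : Q₀)) =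
        Ideal.Quotient.mk (J e i) a * factorVertex e i j := fun a => rfl
      have h1 : π (a • gen e (j : Q₀)) = Ideal.Quotient.mk (J e i) a := by
        rw [hπ, hsum, mul_add, hfg, hf.eq, add_zero]
      have h2 : π (gen e (j : Q₀) - a • gen e (j : Q₀)) = g := by
        rw [map_sub, h1, sub_eq_iff_eq_add']
        exact hsum
      have h3 := Submodule.add_mem_sup (S := ((Submodule.span (FactorAlgebra e i)
          {Ideal.Quotient.mk (J e i) a}).restrictScalars A).comap π)
        (T := ((Submodule.span (FactorAlgebra e i) {g}).restrictScalars A).comap π)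
        (s := a • gen e (j : Q₀)) (t := gen e (j : Q₀) - a • gen e (j : Q₀))
        (by
          rw [Submodule.mem_comap, h1]
          exact Submodule.mem_span_singleton_self _)
        (by
          rw [Submodule.mem_comap, h2]
          exact Submodule.mem_span_singleton_self _)
      simpa using h3
    rcases hQ.eq_top_or_of_sup hsup with h | h
    · exact Or.inr (key hg hfg hsum h)
    · exact Or.inl (key hf hgf (by rw [hsum, add_comm]) h)
  basic j k := by
    rintro ⟨φ⟩
    have := isNoetherian_of_finite K (A := A) A
    have := isArtinian_of_finite K (A := A) A
    have := finite_factor (K := K) (e := e) (i := i)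
    have := finite_submodule (K := K) (P (factorVertex e i) j)
    have := isNoetherian_of_finite K (A := A) (P (factorVertex e i) j)
    have h : ∀ j : Set.Iic i, IsGenerated (factorVertex e i) j (P (factorVertex e i) j) :=
      fun j => ⟨_, weight_gen ((complete_factor hQ.complete i).idem j),
        gen_factor_ne_zero hQ j, fun n => ⟨n, smul_gen ((complete_factor hQ.complete i).idem j) n⟩⟩
    have : Nontrivial (P (factorVertex e i) j) := ⟨⟨_, _, gen_factor_ne_zero hQ j⟩⟩
    have hk := (h k).of_surjective φ.symm.toLinearMap φ.symm.surjective
    -- Isomorphic projectives over `A(i)` have isomorphic tops over `A`, and these are the pairwise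
    -- distinct `S(j)`.
    obtain ⟨α⟩ := hQ.nonempty_top_equiv (isGenerated_factor_iff.1 (h j))
    obtain ⟨β⟩ := hQ.nonempty_top_equiv (isGenerated_factor_iff.1 hk)
    exact Subtype.ext (S_injective hQ (α.symm.trans β))

/-- For `j ≤ i` the weights `≰ i` are among the weights `≰ j`, so the kernel of `P(j) → Δ(j)`
already contains the kernel of the passage to `A(i)`. -/
theorem nonempty_standard_equiv (hc : CompleteOrthogonalIdempotents e) (j : Set.Iic i) :
    Nonempty (Standard K e (j : Q₀) ≃ₗ[A] Standard K (factorVertex e i) j) := by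
  have := finite_factor (K := K) (e := e) (i := i)
  let U := standardKernel K (factorVertex e i) j
  let q : P e (j : Q₀) →ₗ[A] Standard K (factorVertex e i) j :=
    (U.mkQ.restrictScalars A).comp (projFactor e j)
  have hq : Function.Surjective q := U.mkQ_surjective.comp (projFactor_surjective j)
  have hker : standardKernel K e (j : Q₀) = LinearMap.ker q := by
    have hq0 : ∀ p, p ∈ LinearMap.ker q ↔ projFactor e j p ∈ trace (factorVertex e i)
        (Set.Iic j) ⊤ := fun p => by
      rw [← standardKernel_eq (K := K) j]
      exact Submodule.Quotient.mk_eq_zero _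
    rw [standardKernel_eq]
    have hle : trace e (Set.Iic i) (⊤ : Submodule A (P e (j : Q₀))) ≤
        trace e (Set.Iic (j : Q₀)) ⊤ := trace_anti (Set.Iic_subset_Iic.2 j.2) _
    refine le_antisymm (trace_le.2 fun l hl n _ => ?_) fun p hp => ?_
    · rw [hq0, map_smul]
      by_cases hli : l ≤ i
      · have h1 := smul_mem_trace (e := factorVertex e i) (Λ := Set.Iic j) (l := ⟨l, hli⟩)
          (N := ⊤) (n := projFactor e j n) hl Submodule.mem_top
        rwa [factorVertex_smul] at h1
      · rw [weight_factor (i := i) hc hli]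
        exact zero_mem _
    · have key : ∀ x ∈ trace (factorVertex e i) (Set.Iic j)
          (⊤ : Submodule (FactorAlgebra e i) (P (factorVertex e i) j)),
          ∀ p, projFactor e j p = x → p ∈ trace e (Set.Iic (j : Q₀)) ⊤ := by
        have hdiff : ∀ p r, projFactor e j p = projFactor e j r →
            r ∈ trace e (Set.Iic (j : Q₀)) (⊤ : Submodule A (P e (j : Q₀))) →
            p ∈ trace e (Set.Iic (j : Q₀)) (⊤ : Submodule A (P e (j : Q₀))) := by
          intro p r hpr hr
          have h1 : p - r ∈ trace e (Set.Iic i) ⊤ := by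
            rw [← projFactor_eq_zero hc, map_sub, hpr, sub_self]
          simpa using add_mem (hle h1) hr
        intro x hx
        refine Submodule.span_induction (p := fun x _ => ∀ p, projFactor e j p = x →
          p ∈ trace e (Set.Iic (j : Q₀)) ⊤) ?_ ?_ ?_ ?_ hx
        · rintro _ ⟨l, hl, n, -, rfl⟩ p hp
          obtain ⟨n, rfl⟩ := projFactor_surjective j n
          rw [factorVertex_smul, ← map_smul] at hp
          exact hdiff _ _ hp (smul_mem_trace (Λ := Set.Iic (j : Q₀)) hl Submodule.mem_top)
        · intro p hp
          exact hdiff p 0 (by rw [hp, map_zero]) (zero_mem _)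
        · intro x y _ _ hx hy p hp
          obtain ⟨r, rfl⟩ := projFactor_surjective j x
          obtain ⟨s, rfl⟩ := projFactor_surjective j y
          exact hdiff p (r + s) (by rw [hp, map_add]) (add_mem (hx _ rfl) (hy _ rfl))
        · intro b x _ hx p hp
          obtain ⟨a, rfl⟩ := Ideal.Quotient.mk_surjective b
          obtain ⟨r, rfl⟩ := projFactor_surjective j x
          rw [mk_smul] at hp
          exact hdiff p (a • r) (by rw [hp, map_smul]) (Submodule.smul_mem _ _ (hx _ rfl))
      exact key _ ((hq0 p).1 hp) p rfl
  exact ⟨(Submodule.quotEquivOfEq _ _ hker).trans (q.quotKerEquivOfSurjective hq)⟩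

theorem Filtered.factor (hc : CompleteOrthogonalIdempotents e) {M : Type x} [AddCommGroup M]
    [Module A M] {M' : Type y} [AddCommGroup M'] [Module A M'] [Module (FactorAlgebra e i) M']
    [IsScalarTower A (FactorAlgebra e i) M'] (p : M →ₗ[A] M') {N₀ N : Submodule A M}
    {s : Multiset Q₀} (h : Filtered (Standard K e) N₀ N s) (hs : ∀ k ∈ s, k ≤ i)
    (hp : LinearMap.ker p ≤ N₀) :
    ∃ t : Multiset (Set.Iic i), t.map Subtype.val = s ∧
      Filtered (Standard K (factorVertex e i)) (extendSubmodule (e := e) (i := i) (N₀.map p))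
        (extendSubmodule (e := e) (i := i) (N.map p)) t := by
  induction h with
  | refl => exact ⟨0, rfl, .refl⟩
  | @step N N' s k hN hs' ih =>
    obtain ⟨t, rfl, ht⟩ := ih fun k hk => hs k (Multiset.mem_cons_of_mem hk)
    obtain ⟨φ⟩ := nonempty_standard_equiv (K := K) hc
      (⟨k, hs k (Multiset.mem_cons_self _ _)⟩ : Set.Iic i)
    obtain ⟨hle, f, hf, hker⟩ := hs'.map p (hp.trans hN.le)
    refine ⟨⟨k, hs k (Multiset.mem_cons_self _ _)⟩ ::ₘ t, Multiset.map_cons _ _ _, .step ht ?_⟩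
    let f' : (extendSubmodule (e := e) (i := i) (N'.map p)) →ₗ[A]
        Standard K (factorVertex e i) ⟨k, hs k (Multiset.mem_cons_self _ _)⟩ :=
      { toFun := fun m => φ (f ⟨m, m.2⟩)
        map_add' := fun m n => by
          rw [← map_add, ← map_add]
          rfl
        map_smul' := fun a m => by
          rw [RingHom.id_apply, ← map_smul, ← map_smul]
          rfl }
    refine ⟨hle, extendMap f', fun b => ?_, fun m => ?_⟩
    · obtain ⟨m, hm⟩ := hf (φ.symm b)
      exact ⟨⟨m, m.2⟩, by
        change φ (f m) = b
        rw [hm, φ.apply_symm_apply]⟩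
    · change φ (f ⟨m, m.2⟩) = 0 ↔ _
      rw [φ.map_eq_zero_iff, hker]
      rfl

end Projective

/-! ### Injective and costandard modules of `A(i)` -/

section Injective

variable {K : Type u} [Field K] {A : Type v} [Ring A] [Algebra K A]
  {Q₀ : Type w} [PartialOrder Q₀] [Fintype Q₀] {e : Q₀ → A} {i : Q₀}

/-- The inclusion of the injective `A(i)`-module at `j` into `I(j)`. -/
noncomputable def injFactor (e : Q₀ → A) {i : Q₀} (j : Set.Iic i) :
    I K (factorVertex e i) j →ₗ[A] I K e (j : Q₀) where
  toFun φ := ⟨LinearMap.comp (show FactorAlgebra e i →ₗ[K] K from φ.1)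
    ((J e i).mkQ.restrictScalars K), fun a => φ.2 (Ideal.Quotient.mk (J e i) a)⟩
  map_add' _ _ := rfl
  map_smul' _ _ := rfl

theorem injFactor_apply (j : Set.Iic i) (φ : I K (factorVertex e i) j) (a : A) :
    (injFactor e j φ).1 a = φ.1 (Ideal.Quotient.mk (J e i) a) := rfl

theorem injFactor_injective (j : Set.Iic i) :
    Function.Injective (injFactor (K := K) e j) := by
  intro φ ψ h
  refine Subtype.ext (RegularDual.ext fun b => ?_)
  obtain ⟨a, rfl⟩ := Ideal.Quotient.mk_surjective b
  rw [← injFactor_apply, ← injFactor_apply, h]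

/-- An element of the cotrace is annihilated by `J(i)`; evaluating at `1` shows that the functional
itself vanishes on `J(i)` and descends to `A(i)`. -/
theorem mem_range_injFactor (hc : CompleteOrthogonalIdempotents e) (j : Set.Iic i)
    (φ : I K e (j : Q₀)) :
    φ ∈ LinearMap.range (injFactor (K := K) e j) ↔ φ ∈ cotrace e (Set.Iic i) (I K e (j : Q₀)) := by
  constructor
  · rintro ⟨ψ, rfl⟩ l hl a
    rw [← map_smul, ← map_smul]
    rw [weight_factor (i := i) hc (by simpa using hl), map_zero]
  · intro h
    have hJ : (J e i).restrictScalars K ≤ LinearMap.ker (show A →ₗ[K] K from φ.1) := by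
      intro a ha
      have h1 := J_smul (e := e) (i := i) (M := cotrace e (Set.Iic i) (I K e (j : Q₀)))
        (fun l hl m => weight_cotrace (Λ := Set.Iic i) (by simpa using hl) m) ha ⟨φ, h⟩
      have h2 : φ.1 (1 * a) = 0 :=
        congrArg (fun t : cotrace e (Set.Iic i) (I K e (j : Q₀)) => (t : I K e (j : Q₀)).1 1) h1
      rwa [one_mul] at h2
    let ψ : FactorAlgebra e i →ₗ[K] K :=
      ((J e i).restrictScalars K).liftQ (show A →ₗ[K] K from φ.1) hJ
    refine ⟨⟨ψ, fun b => ?_⟩, rfl⟩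
    obtain ⟨a, rfl⟩ := Ideal.Quotient.mk_surjective b
    exact φ.2 a

theorem injFactor_mem_cotrace_iff (hc : CompleteOrthogonalIdempotents e) (j : Set.Iic i)
    (φ : I K (factorVertex e i) j) :
    injFactor e j φ ∈ cotrace e (Set.Iic (j : Q₀)) (I K e (j : Q₀)) ↔
      φ ∈ cotrace (factorVertex e i) (Set.Iic j) (I K (factorVertex e i) j) := by
  constructor
  · intro h l hl b
    obtain ⟨a, rfl⟩ := Ideal.Quotient.mk_surjective b
    refine injFactor_injective (K := K) j ?_
    rw [factorVertex_smul, mk_smul, map_smul, map_smul, h l hl, map_zero]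
  · intro h l hl a
    rw [← map_smul, ← map_smul]
    by_cases hli : l ≤ i
    · have h1 := h ⟨l, hli⟩ hl (Ideal.Quotient.mk (J e i) a)
      rw [factorVertex_smul, mk_smul] at h1
      rw [h1, map_zero]
    · rw [weight_factor (i := i) hc hli, map_zero]

theorem nonempty_costandard_equiv [Module.Finite K A] (hc : CompleteOrthogonalIdempotents e)
    (j : Set.Iic i) :
    Nonempty (Costandard K (factorVertex e i) j ≃ₗ[A] Costandard K e (j : Q₀)) := by
  have := finite_factor (K := K) (e := e) (i := i)
  have h1 : ∀ φ, injFactor e j φ ∈ costandard K e (j : Q₀) ↔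
      φ ∈ costandard K (factorVertex e i) j := by
    intro φ
    rw [costandard_eq, costandard_eq]
    exact injFactor_mem_cotrace_iff hc j φ
  let f : Costandard K (factorVertex e i) j →ₗ[A] Costandard K e (j : Q₀) :=
    { toFun := fun φ => ⟨injFactor e j φ, (h1 φ).2 φ.2⟩
      map_add' := fun _ _ => rfl
      map_smul' := fun _ _ => rfl }
  refine ⟨LinearEquiv.ofBijective f ⟨fun φ ψ h => ?_, fun φ => ?_⟩⟩
  · exact Subtype.ext (injFactor_injective j (congrArg Subtype.val h))
  · obtain ⟨ψ, hψ⟩ : (φ : I K e (j : Q₀)) ∈ LinearMap.range (injFactor (K := K) e j) := by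
      rw [mem_range_injFactor hc]
      obtain ⟨φ, h2⟩ := φ
      rw [costandard_eq] at h2
      exact cotrace_mono (Set.Iic_subset_Iic.2 j.2) h2
    exact ⟨⟨ψ, (h1 ψ).1 (hψ ▸ φ.2)⟩, Subtype.ext hψ⟩

end Injective

/-! ### When the factor algebra is 1-quasi-hereditary -/

theorem isLowerSet_diff {Q₀ : Type w} [PartialOrder Q₀] (i j : Q₀) :
    IsLowerSet {m : Q₀ | m ≤ i ∧ ¬ j ≤ m} :=
  fun _ _ hab ha => ⟨hab.trans ha.1, fun h => ha.2 (h.trans hab)⟩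

section FactorAlgebra

variable {K : Type u} [Field K] {A : Type v} [Ring A] [Algebra K A] [Module.Finite K A]
  {Q₀ : Type w} [PartialOrder Q₀] [Fintype Q₀] {e : Q₀ → A} {o i : Q₀}

/-- The vertices below `i` are split according to whether they lie above `j`. This is the dimension
count for embedding the projective at `j` into the one at `o`, and for the dual surjection. -/
theorem upperCount_Iic_eq_add (ho : IsBot o) (i j l : Q₀) :
    upperCount (Set.Iic i) o l =
      upperCount {m | m ≤ i ∧ ¬ j ≤ m} o l + upperCount (Set.Iic i) j l := by
  unfold upperCount
  rw [← Set.ncard_union_eq _ (Set.toFinite _) (Set.toFinite _)]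
  · congr 1
    ext m
    simp only [Set.mem_ofPred_eq, Set.mem_union, Set.mem_Iic]
    have := ho m
    tauto
  · rw [Set.disjoint_left]
    rintro m ⟨h1, -⟩ ⟨-, h2, -⟩
    exact h1.2 h2

theorem mult_projFactor (hA : IsOneQuasiHereditary K e) (j : Set.Iic i) (l : Q₀) :
    mult K e (P (factorVertex e i) j) l = upperCount (Set.Iic i) j l := by
  rw [← mult_quotient_trace hA (isLowerSet_Iic i)]
  have h : trace e (Set.Iic i) ⊤ = LinearMap.ker (projFactor e j) := by
    ext p
    exact (projFactor_eq_zero hA.complete).symm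
  exact mult_congr ((Submodule.quotEquivOfEq _ _ h).trans
    ((projFactor e j).quotKerEquivOfSurjective (projFactor_surjective j))).symm l

theorem nonempty_quotient_sumP_equiv (hA : IsOneQuasiHereditary K e) (ho : IsBot o) (i : Q₀) :
    Nonempty ((P e o ⧸ sumP e o i) ≃ₗ[A] P (factorVertex e i) ⟨o, ho i⟩) := by
  have h : sumP e o i = LinearMap.ker (projFactor e (⟨o, ho i⟩ : Set.Iic i)) := by
    rw [sumP_eq hA ho]
    ext p
    exact (projFactor_eq_zero (j := (⟨o, ho i⟩ : Set.Iic i)) hA.complete).symm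
  exact ⟨(Submodule.quotEquivOfEq _ _ h).trans ((projFactor e
    (⟨o, ho i⟩ : Set.Iic i)).quotKerEquivOfSurjective (projFactor_surjective _))⟩

theorem isCogenerated_of_factor (hA : IsOneQuasiHereditary K e) (ho : IsBot o)
    (hB : IsOneQuasiHereditary K (factorVertex e i)) :
    IsCogenerated e o (P e o ⧸ sumP e o i) := by
  have := finite_factor (K := K) (e := e) (i := i)
  obtain ⟨φ⟩ := nonempty_quotient_sumP_equiv hA ho i
  have h1 := isCogenerated_P hB (o := ⟨o, ho i⟩) (fun j => ho j) ⟨o, ho i⟩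
  have : Nontrivial (P (factorVertex e i) ⟨o, ho i⟩) :=
    ⟨⟨_, _, gen_factor_ne_zero hA.toIsQuasiHereditary _⟩⟩
  have := φ.toEquiv.nontrivial
  exact (isCogenerated_factor_iff.1 h1).of_injective φ.toLinearMap φ.injective

/-- The projective `A(i)`-modules embed into the projective `A(i)`-module at `o`. -/
theorem exists_injective_projFactor (hA : IsOneQuasiHereditary K e) (ho : IsBot o)
    (j : Set.Iic i) :
    ∃ f : P (factorVertex e i) j →ₗ[A] (P e o ⧸ sumP e o i), Function.Injective f := by
  obtain ⟨f, hf⟩ := exists_injective_P hA ho (j : Q₀)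
  obtain ⟨h, hh⟩ := exists_factor (projFactor e j) (projFactor_surjective j)
    ((sumP e o i).mkQ.comp f) (fun p hp => by
      rw [LinearMap.comp_apply, Submodule.mkQ_apply, Submodule.Quotient.mk_eq_zero,
        sumP_eq hA ho]
      exact trace_top_map_le ⟨p, (projFactor_eq_zero hA.complete).1 hp, rfl⟩)
  have := finite_factor (K := K) (e := e) (i := i)
  have := finite_submodule (K := K) (P (factorVertex e i) j)
  have := finite_submodule (K := K) (P e o)
  have := finite_quotient (K := K) (sumP e o i)
  let c : P e o →ₗ[A] ((P e o ⧸ sumP e o i) ⧸ LinearMap.range h) :=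
    (LinearMap.range h).mkQ.comp (sumP e o i).mkQ
  have hc : Function.Surjective c :=
    (Submodule.mkQ_surjective _).comp (Submodule.mkQ_surjective _)
  -- The embedded `P(j)` contains all weights `m ≥ j` of `P(o)`, so the cokernel of `h` has only
  -- weights `m ≤ i` with `j ≰ m`. It is thus a quotient of the corresponding truncation of `P(o)`,
  -- which bounds its dimensions from above.
  have hle : trace e {m | m ≤ i ∧ ¬ (j : Q₀) ≤ m} ⊤ ≤ LinearMap.ker c := by
    refine trace_le.2 fun m hm p _ => ?_
    by_cases hmi : m ≤ i
    · have hjm : (j : Q₀) ≤ m := by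
        by_contra hjm
        exact hm ⟨hmi, hjm⟩
      obtain ⟨q, hq⟩ := weight_mem_of_injective hA hjm f hf p
      rw [LinearMap.mem_ker, ← hq]
      exact (Submodule.Quotient.mk_eq_zero _).2 ⟨projFactor e j q, hh q⟩
    · rw [LinearMap.mem_ker, LinearMap.comp_apply, map_smul,
        weight_quotient_sumP hA ho hmi, map_zero]
  -- The bound on the cokernel bounds the image from below by the dimension vector of the source of
  -- `h`, so nothing is lost.
  have hinj := injective_of_mult_le (K := K) hA.complete h.rangeRestrict
    h.surjective_rangeRestrict fun l => by
      have h1 := mult_eq_add_quotient (K := K) (hA.complete.idem l) (LinearMap.range h)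
      rw [mult_quotient_sumP hA ho, upperCount_Iic_eq_add ho i j l] at h1
      have h2 : mult K e ((P e o ⧸ sumP e o i) ⧸ LinearMap.range h) l ≤
          upperCount {m | m ≤ i ∧ ¬ (j : Q₀) ≤ m} o l := by
        rw [← mult_quotient_trace hA (isLowerSet_diff i j)]
        have := finite_quotient (K := K)
          (trace e {m | m ≤ i ∧ ¬ (j : Q₀) ≤ m} (⊤ : Submodule A (P e o)))
        refine mult_le_of_surjective (hA.complete.idem l) (Submodule.liftQ _ c hle) fun b => ?_
        obtain ⟨a, rfl⟩ := hc b
        exact ⟨Submodule.Quotient.mk a, rfl⟩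
      rw [mult_projFactor hA]
      omega
  exact ⟨h, fun a b hab => hinj (Subtype.ext hab)⟩

/-- The injective `A(i)`-module at `o` maps onto the injective `A(i)`-modules. -/
theorem exists_surjective_injFactor (hA : IsOneQuasiHereditary K e) (ho : IsBot o)
    (j : Set.Iic i) :
    ∃ f : interKer K e o i →ₗ[A] I K (factorVertex e i) j, Function.Surjective f := by
  obtain ⟨g, hg⟩ := exists_surjective_I hA ho (j : Q₀)
  have := finite_I (K := K) (e := e) o
  have := finite_I (K := K) (e := e) (j : Q₀)
  have hW := interKer_eq hA ho i
  -- The image lies in the elements of `I(j)` with weights `≤ i`, that is, in the injective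
  -- `A(i)`-module. Equality is a dimension count, which needs an upper bound for the kernel.
  have hrange : (interKer K e o i).map g = LinearMap.range (injFactor (K := K) e j) := by
    have hV : LinearMap.range (injFactor (K := K) e j) =
        cotrace e (Set.Iic i) (I K e (j : Q₀)) := Submodule.ext fun φ =>
      mem_range_injFactor hA.complete j φ
    rw [hV]
    refine eq_of_le_of_mult_le (K := K) hA.complete ?_ fun l => ?_
    · rintro _ ⟨φ, hφ, rfl⟩
      exact map_mem_cotrace g (hW.le hφ)
    · have := finite_submodule (K := K) (interKer K e o i)
      have := finite_submodule (K := K)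
        (cotrace e {m | m ≤ i ∧ ¬ (j : Q₀) ≤ m} (I K e o))
      let r := g.submoduleMap (interKer K e o i)
      have h1 := mult_exact (K := K) (hA.complete.idem l)
        (M := LinearMap.ker r) (N := interKer K e o i) (LinearMap.ker r).subtype
        Subtype.val_injective r (g.submoduleMap_surjective _)
        (fun n => ⟨fun h => ⟨⟨n, h⟩, rfl⟩, by rintro ⟨m, rfl⟩; exact m.2⟩)
      -- A surjection `I(o) → I(j)` is injective on weights `m ≥ j`, so the kernel has only weights
      -- `m ≤ i` with `j ≰ m`.
      have hk : ∀ φ : LinearMap.ker r, ((φ : interKer K e o i) : I K e o) ∈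
          cotrace e {m | m ≤ i ∧ ¬ (j : Q₀) ≤ m} (I K e o) := by
        intro φ m hm a
        by_cases hmi : m ≤ i
        · have hjm : (j : Q₀) ≤ m := by
            by_contra hjm
            exact hm ⟨hmi, hjm⟩
          refine weight_eq_zero_of_surjective hA hjm g hg ?_
          have h0 : g φ = 0 := congrArg Subtype.val φ.2
          rw [map_smul, h0, smul_zero]
        · exact hW.le (φ : interKer K e o i).2 m (by simpa using hmi) a
      let ι : LinearMap.ker r →ₗ[A] cotrace e {m | m ≤ i ∧ ¬ (j : Q₀) ≤ m} (I K e o) :=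
        ((interKer K e o i).subtype.comp (LinearMap.ker r).subtype).codRestrict _ hk
      have hι : Function.Injective ι := fun a b hab =>
        Subtype.ext (Subtype.ext (congrArg Subtype.val hab : (ι a : I K e o) = ι b))
      have h2 := mult_le_of_injective (K := K) (e := e) (M := LinearMap.ker r)
        (N := cotrace e {m | m ≤ i ∧ ¬ (j : Q₀) ≤ m} (I K e o)) ι hι l
      rw [mult_cotrace_I hA (isLowerSet_diff i j)] at h2
      rw [mult_interKer hA ho, upperCount_Iic_eq_add ho i j l] at h1
      rw [mult_cotrace_I hA (isLowerSet_Iic i)]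
      omega
  let ψ : (interKer K e o i).map g ≃ₗ[A] I K (factorVertex e i) j :=
    (LinearEquiv.ofEq _ _ hrange).trans
      (LinearEquiv.ofInjective (injFactor (K := K) e j)
        (injFactor_injective (K := K) (e := e) j)).symm
  exact ⟨ψ.toLinearMap.comp (g.submoduleMap _),
    ψ.surjective.comp (g.submoduleMap_surjective _)⟩

-- The filtration of `P(j)` modulo its trace is carried over to `A(i)`; exactly the labels `k` with
-- `j ≤ k ≤ i` remain, each once.
open Classical in
theorem exists_filtration_factor (hA : IsOneQuasiHereditary K e) (j : Set.Iic i) :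
    ∃ F : DeltaFiltration K (factorVertex e i) (P (factorVertex e i) j),
      ∀ k, F.count k = if j ≤ k then 1 else 0 := by
  have : Nonempty (Set.Iic i) := ⟨j⟩
  obtain ⟨t, ht, hF⟩ := (filtered_P_trace hA (isLowerSet_Iic i) (j : Q₀)).factor (i := i)
    hA.complete (projFactor e j)
    (fun k hk => by
      simp only [Finset.mem_val, Finset.mem_filter] at hk
      exact hk.2.2)
    (fun p hp => (projFactor_eq_zero hA.complete).1 hp)
  have h1 : extendSubmodule (e := e) (i := i)
      ((trace e (Set.Iic i) ⊤).map (projFactor e j)) = ⊥ := by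
    rw [eq_bot_iff]
    rintro _ ⟨p, hp, rfl⟩
    exact (projFactor_eq_zero hA.complete).2 hp
  have h2 : extendSubmodule (e := e) (i := i)
      ((⊤ : Submodule A (P e (j : Q₀))).map (projFactor e j)) = ⊤ := by
    rw [eq_top_iff]
    intro b _
    obtain ⟨p, rfl⟩ := projFactor_surjective j b
    exact ⟨p, trivial, rfl⟩
  rw [h1, h2] at hF
  obtain ⟨F, hc⟩ := hF.goodFiltration
  refine ⟨F, fun k => ?_⟩
  have h3 : F.count k = (t.map Subtype.val).count (k : Q₀) := by
    rw [hc]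
    symm
    convert Multiset.count_map_eq_count' Subtype.val t Subtype.val_injective k
  rw [h3, ht]
  by_cases hjk : j ≤ k
  · rw [if_pos hjk, Multiset.count_eq_one_of_mem (Finset.nodup _)]
    simp only [Finset.mem_val, Finset.mem_filter, Finset.mem_univ, true_and]
    exact ⟨hjk, k.2⟩
  · rw [if_neg hjk, Multiset.count_eq_zero_of_notMem]
    simp only [Finset.mem_val, Finset.mem_filter, Finset.mem_univ, true_and]
    exact fun h => hjk h.1

theorem mult_standard_factor (hA : IsOneQuasiHereditary K e) {j k : Set.Iic i} (h : k ≤ j) :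
    mult K (factorVertex e i) (Standard K (factorVertex e i) j) k = 1 := by
  obtain ⟨φ⟩ := nonempty_standard_equiv (K := K) hA.complete j
  rw [mult_factor, ← mult_congr φ]
  exact hA.mult_standard j k h

/-- The standard and costandard modules at vertices `≤ i` are the same for `A` and `A(i)`, so the
axioms about them are inherited. The hypotheses `hP` and `hI` are the socle and top axioms at the
vertex `o`; they spread to submodules of that projective and quotients of that injective. -/
theorem isOneQuasiHereditary_factor (hA : IsOneQuasiHereditary K e) (ho : IsBot o)
    (hP : IsCogenerated e o (P e o ⧸ sumP e o i)) (hI : IsGenerated e o (interKer K e o i)) :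
    IsOneQuasiHereditary K (factorVertex e i) := by
  have hfin := finite_factor (K := K) (e := e) (i := i)
  have hnoeth := isNoetherian_of_finite K (A := FactorAlgebra e i) (FactorAlgebra e i)
  have hart := isArtinian_of_finite K (A := FactorAlgebra e i) (FactorAlgebra e i)
  have hb := isBasic_factor hA.toIsQuasiHereditary i
  have hbot : ∀ o' : Set.Iic i, IsBot o' → (o' : Q₀) = o := fun o' ho' =>
    le_antisymm (ho' ⟨o, ho i⟩) (ho _)
  have htop : ∀ t : Set.Iic i, IsTop t → t = ⟨i, le_rfl⟩ := fun t ht =>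
    le_antisymm t.2 (ht ⟨i, le_rfl⟩)
  classical
  exact
  { toIsBasic := hb
    standard_self := fun j => mult_standard_factor hA le_rfl
    projective := fun j => by
      obtain ⟨F, hF⟩ := exists_filtration_factor hA j
      exact ⟨F, fun k hk => by rw [hF, if_neg hk], by rw [hF, if_pos le_rfl]⟩
    exists_smallest := ⟨⟨o, ho i⟩, fun j => ho j⟩
    exists_largest := ⟨⟨i, le_rfl⟩, fun j => j.2⟩
    mult_standard := fun _ _ h => mult_standard_factor hA h
    mult_projective := fun k j h => by
      obtain ⟨F, hF⟩ := exists_filtration_factor hA j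
      exact ⟨F, by rw [hF, if_pos h]⟩
    soc_projective := fun o' ho' j => by
      have hfin1 := finite_submodule (K := K) (P (factorVertex e i) j)
      have hart1 := isArtinian_of_finite K (A := FactorAlgebra e i) (P (factorVertex e i) j)
      refine hb.nonempty_soc_equiv (isCogenerated_factor_iff.2 ?_)
      rw [hbot o' ho']
      obtain ⟨f, hf⟩ := exists_injective_projFactor hA ho j
      have : Nontrivial (P (factorVertex e i) j) :=
        ⟨⟨_, _, gen_factor_ne_zero hA.toIsQuasiHereditary j⟩⟩
      exact hP.of_injective f hf
    top_injective := fun o' ho' j => by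
      have hfin1 := finite_I (K := K) (e := factorVertex e i) j
      have hnoeth1 := isNoetherian_of_finite K (A := FactorAlgebra e i) (I K (factorVertex e i) j)
      refine hb.nonempty_top_equiv (isGenerated_factor_iff.2 ?_)
      rw [hbot o' ho']
      obtain ⟨f, hf⟩ := exists_surjective_injFactor hA ho j
      have : Nontrivial (I K (factorVertex e i) j) := by
        obtain ⟨φ⟩ := nonempty_costandard_equiv (K := K) hA.complete j
        have := nontrivial_costandard hA (j : Q₀)
        have := φ.toEquiv.nontrivial
        exact Subtype.val_injective.nontrivial (α := Costandard K (factorVertex e i) j)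
      exact hI.of_surjective f hf
    standard_embeds := fun t ht j => by
      rw [htop t ht]
      obtain ⟨φ⟩ := nonempty_standard_equiv (K := K) hA.complete j
      obtain ⟨ψ⟩ := nonempty_standard_equiv (K := K) hA.complete (⟨i, le_rfl⟩ : Set.Iic i)
      obtain ⟨f, hf⟩ := exists_injective_standard hA j.2
      exact ⟨extendMap (ψ.toLinearMap.comp (f.comp φ.symm.toLinearMap)),
        ψ.injective.comp (hf.comp φ.symm.injective)⟩
    costandard_covers := fun t ht j => by
      rw [htop t ht]
      obtain ⟨φ⟩ := nonempty_costandard_equiv (K := K) hA.complete j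
      obtain ⟨ψ⟩ := nonempty_costandard_equiv (K := K) hA.complete (⟨i, le_rfl⟩ : Set.Iic i)
      obtain ⟨f, hf⟩ := exists_surjective_costandard hA j.2
      exact ⟨extendMap (φ.symm.toLinearMap.comp (f.comp ψ.toLinearMap)),
        φ.symm.surjective.comp (hf.comp ψ.surjective)⟩ }

theorem IsTiltingSummand.isOneQuasiHereditary_factor {M : Type x} [AddCommGroup M] [Module K M]
    [Module A M] [IsScalarTower K A M] (hA : IsOneQuasiHereditary K e) (ho : IsBot o)
    (hT : IsTiltingSummand K e i M) (h : mult K e M o ≤ upperCount (Set.Iic i) o o) :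
    IsOneQuasiHereditary K (factorVertex e i) := by
  have := hT.finite
  have := hT.nontrivial
  obtain ⟨h1, h2, -⟩ := hT.of_mult_le hA ho h
  obtain ⟨φ⟩ := hT.nonempty_equiv_quotient hA ho h
  obtain ⟨ψ⟩ := hT.nonempty_equiv_interKer hA ho h
  have := φ.symm.toEquiv.nontrivial
  have := ψ.symm.toEquiv.nontrivial
  exact OneQH.isOneQuasiHereditary_factor hA ho
    (h1.of_injective φ.symm.toLinearMap φ.symm.injective)
    (h2.of_surjective ψ.toLinearMap ψ.surjective)

end FactorAlgebra

end OneQH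

theorem mainTheorem4 {K : Type*} [Field K] [IsAlgClosed K]
    {A : Type*} [Ring A] [Algebra K A] [Module.Finite K A]
    {Q₀ : Type*} [Fintype Q₀] [PartialOrder Q₀] (e : Q₀ → A)
    (hA : OneQH.IsOneQuasiHereditary K e)
    (o : Q₀) (ho : IsBot o) (i : Q₀)
    {T : Type*} [AddCommGroup T] [Module K T] [Module A T] [IsScalarTower K A T]
    (hT : OneQH.IsTiltingSummand K e i T) :
    List.TFAE [
      OneQH.IsOneQuasiHereditary K (OneQH.factorVertex e i),
      Nonempty (T ≃ₗ[A] (OneQH.P e o ⧸ OneQH.sumP e o i)),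
      Nonempty (T ≃ₗ[A] OneQH.interKer K e o i),
      IsSimpleModule A (OneQH.soc A T),
      IsSimpleModule A (OneQH.Top A T)] := by
  have := hT.finite
  have h2 : Nonempty (T ≃ₗ[A] (OneQH.P e o ⧸ OneQH.sumP e o i)) →
      OneQH.IsGenerated e o T := fun ⟨φ⟩ => hT.isGenerated_of_equiv hA φ
  have h3 : Nonempty (T ≃ₗ[A] OneQH.interKer K e o i) →
      OneQH.IsCogenerated e o T := fun ⟨φ⟩ => hT.isCogenerated_of_equiv hA ho φ
  -- The numerical bound is the common pivot: it is equivalent to a simple socle and, by `h5`, to a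
  -- simple top. A quotient of `P(o)` has simple top and a submodule of `I(o) ≅ P(o)` has simple
  -- socle, which is why (ii) feeds into (iii') and (ii') into (iii).
  have h4 : OneQH.mult K e T o ≤ OneQH.upperCount (Set.Iic i) o o ↔
      OneQH.IsCogenerated e o T :=
    ⟨fun h => (hT.of_mult_le hA ho h).1, hT.of_isCogenerated hA ho⟩
  have h5 : OneQH.mult K e T o ≤ OneQH.upperCount (Set.Iic i) o o ↔
      OneQH.IsGenerated e o T :=
    ⟨fun h => (hT.of_mult_le hA ho h).2.1, hT.of_isGenerated hA ho⟩
  rw [← hT.isCogenerated_iff hA ho, ← hT.isGenerated_iff hA ho]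
  tfae_have 1 → 2 := fun hB =>
    hT.nonempty_equiv_of_isCogenerated hA ho (OneQH.isCogenerated_of_factor hA ho hB)
  tfae_have 2 → 5 := h2
  tfae_have 5 → 4 := fun h => h4.1 (h5.2 h)
  tfae_have 4 → 3 := fun h => hT.nonempty_equiv_interKer hA ho (h4.2 h)
  tfae_have 3 → 1 := fun h => hT.isOneQuasiHereditary_factor hA ho (h4.2 (h3 h))
  tfae_finish
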